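/- **Setting.** Let $\mathrm{Aut}_+(\mathcal O)$ be the set of formal series $f(z)=z\,g(z)$, $g(z)=1+\sum_{k\ge1}c_kz^k$, with complex affine coordinates $c_1,c_2,\dots$ (the coefficient body), and put $c_0=1$. Polynomial sections of the trivial line bundle $E_{c,h}=\mathrm{Aut}_+(\mathcal O)\times\mathbb C$ ($c,h\in\mathbb C$) are the elements of $\mathcal P=\mathbb C[c_1,c_2,\dots]$; write $\partial_k=\partial/\partial c_k$. For $n\in\mathbb Z$ the Virasoro generator $L_n$ (central charge $c$) acts on $\mathcal P$ by $$L_n=\sum_{k\ge1}V_{n,k}\,\partial_k+h\,[z^{-n}]\Big(\frac{zf'}{f}\Big)^2+\frac c{12}\,[z^{-n-2}]\Big(\frac{f'''}{f'}-\frac32\Big(\frac{f''}{f'}\Big)^2\Big),$$ $$V_{n,k}=[z^{k+1}]\Big(z^{n+1}f'(z)-\sum_{m\le1}u_{n,m}f(z)^m\Big),\qquad u_{n,m}=\operatorname{Res}_{z=0}z^{n+1}f'(z)^2f(z)^{-m-1}dz ,$$ where the sum over $m$ is finite, as $u_{n,m}=0$ for $m<n+1$. The module of *sections generated from $1$* is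 the smallest subspace of $\mathcal P$ that contains the constant section $1$ and is stable under $L_n$ for all $n<1$. On the dual space $\mathcal P^*$ put $(\pi_n\varphi)(P)=\varphi(L_{-n}P)$, and let $\varepsilon(P)=P(0)$. The Verma module $V(c,h)$ is realised as the smallest subspace of $\mathcal P^*$ that contains $\varepsilon$ and is stable under $\pi_n$ for all $n<1$. A *null vector of level two* is a nonzero $v\in V(c,h)$ with $\pi_0v=(h+2)v$ and $\pi_nv=0$ for all $n\ge1$. Let $\kappa>0$, and let $B$ be a standard Brownian motion adapted to a filtration $(\mathcal F_t)_{t\ge0}$, with $B_t-B_s$ independent of $\mathcal F_s$ for $s\le t$. The *chordal SLE$_\kappa$ flow on the coefficient body* is the adapted process of formal series $f_t(z)=z\big(1+\sum_{k\ge1}b_k(t)z^{-k}\big)\in\mathrm{Aut}_+(\mathcal O_\infty)$ with $f_0(z)=z$ that solves $df_t(z)=\frac{2}{f_t(z)}dt-\sqrt\kappa\,dB_t$ coefficient by coefficient. Let $P_k\in\mathbb C[b_1,b_2,\dots]$ be the coefficient of $z^{1-k}$ in $1/F$, for $F=z(1+\sum_{k\ge1}b_kz^{-k})$, and put $L_1^\infty=\partial/\partial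 b_1$, $L_2^\infty=-\sum_{k\ge2}P_k\,\partial/\partial b_k$. The generator of the flow is $\frac\kappa2(L_1^\infty)^2-2L_2^\infty=\frac\kappa2\partial_{b_1}^2+2\sum_{k\ge2}P_k\partial_{b_k}$. Let $\hat L_1,\hat L_2$ be the operators on $\mathcal P$ that correspond to $L_1^\infty,L_2^\infty$ under the identification $\mathrm{Aut}_+(\mathcal O)\cong\mathrm{Aut}_+(\mathcal O_\infty)$, $f(z)\leftrightarrow1/f(1/z)$; the lifted generator is $\hat A_\kappa=\frac\kappa2\hat L_1^2-2\hat L_2$. For $\kappa\in\mathbb C\setminus\{0\}$ put $$c_\kappa=\frac{(6-\kappa)(3\kappa-8)}{2\kappa},\qquad h_\kappa=\frac{6-\kappa}{2\kappa}.$$ **Claim.** (0) For all $c,h\in\mathbb C$, the operators have the coordinate form $$L_n=\partial_n+\sum_{k\ge1}(k+1)c_k\partial_{n+k}\ (n\ge1),\qquad L_0=h+\sum_{k\ge1}kc_k\partial_k,$$ $$L_{-1}=\sum_{k\ge1}\big((k+2)c_{k+1}-2c_1c_k\big)\partial_k+2hc_1,$$ $$L_{-2}=\sum_{k\ge1}\big((k+3)c_{k+2}-(4c_2-c_1^2)c_k-a_k\big)\partial_k+h(4c_2-c_1^2)+\tfrac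 c2(c_2-c_1^2),$$ where $a_k$ is the coefficient of $z^{k+1}$ in $1/f(z)$. (1) For $c,h\in\mathbb C$, the Verma module $V(c,h)$ contains a null vector of level two if and only if $c=c_{\kappa}$ and $h=h_{\kappa}$ for some $\kappa\in\mathbb C\setminus\{0\}$. Now fix a real $\kappa>0$. (2) For $c,h\in\mathbb C$, the vector $\big(\frac\kappa2\pi_{-1}^2-2\pi_{-2}\big)\varepsilon$ of $V(c,h)$ is a null vector of level two if and only if $c=c_\kappa$ and $h=h_\kappa$. (3) For $c,h\in\mathbb C$, the corresponding section $\big(\frac\kappa2L_{-1}^2-2L_{-2}\big)1$ vanishes if and only if either $(c,h)=(c_\kappa,h_\kappa)$, or $(c,h)=(0,0)$ (where the sections generated from $1$ are the constants). (4) For $c,h\in\mathbb C$, all sections generated from $1$ lie in the kernel of the lifted generator $\hat A_\kappa$ if and only if $(c,h)=(c_\kappa,h_\kappa)$ or $(c,h)=(0,0)$. In particular, they are all harmonic for $(c,h)=(c_\kappa,h_\kappa)$. (5) Harmonic sections give local martingales (generalised Doob–Getoor $h$-transform): if $\sigma\in\mathcal P$ satisfies $\hat A_\kappa\sigma=0$,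 then for every chordal SLE$_\kappa$ flow $(f_t)_{t\ge0}$ on the coefficient body, on any probability space, the value $\sigma(f_t)$, i.e. $\sigma$ at the point $1/f_t(1/z)$ of $\mathrm{Aut}_+(\mathcal O)$, is a local martingale for $(\mathcal F_t)$. -/

import Mathlib

open MeasureTheory ProbabilityTheory
open scoped NNReal

noncomputable section

namespace SLEVirasoro

/-- Polynomials in the affine coordinates `c₁, c₂, …` of the coefficient body; these are the
polynomial sections of the trivialised line bundle `E_{c,h}`. -/
abbrev Sec : Type := MvPolynomial ℕ+ ℂ

/-- The coordinate `c_k`, with the convention `c₀ = 1`. -/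
def coord (k : ℕ) : Sec := if hk : 0 < k then MvPolynomial.X ⟨k, hk⟩ else 1

/-- The coefficient of index `i : ℤ` of a power series, which is `0` for `i < 0`. -/
def zcoeff (i : ℤ) (p : PowerSeries Sec) : Sec :=
  if 0 ≤ i then PowerSeries.coeff i.toNat p else 0

/-- `g = 1 + ∑_{k ≥ 1} c_k z^k`, so that the generic point of `Aut₊(O)` is `f = z g`. -/
def g : PowerSeries Sec := PowerSeries.mk coord

/-- `1 / g`. -/
def gInv : PowerSeries Sec := PowerSeries.invOfUnit g 1

/-- The derivative `f'` of the generic point `f = z g`. -/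
def f' : PowerSeries Sec := PowerSeries.derivative Sec (PowerSeries.X * g)

/-- `f'' / f'`. -/
def preSchwarz : PowerSeries Sec :=
  PowerSeries.derivative Sec f' * PowerSeries.invOfUnit f' 1

/-- The Schwarzian derivative `f''' / f' - (3/2) (f'' / f')²` of `f`. -/
def schwarzian : PowerSeries Sec :=
  PowerSeries.derivative Sec (PowerSeries.derivative Sec f') * PowerSeries.invOfUnit f' 1
    - (3 / 2 : ℂ) • preSchwarz ^ 2

/-- The residue of `z^{n+1} f'(z)² f(z)^{j-2} dz`: with `w = f(z)`, this is the coefficient of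
`w^{1-j}` in the push-forward by `f` of the vector field `z^{n+1} ∂_z`. Here `f = z g`, so it is
the coefficient of `z^{-n-j}` in `f'² g^{j-2}`. -/
def pushCoeff (n : ℤ) (j : ℕ) : Sec := zcoeff (-n - j) (f' ^ 2 * gInv ^ 2 * g ^ j)

/-- The Lie field `𝓛_n` at `f`: the component along `∂/∂c_k`, which is the coefficient of `z^{k+1}`
in `z^{n+1} f'(z) - ∑_{j ≥ 0} (pushCoeff n j) f(z)^{1-j}`
(`pushCoeff n j` is zero for `j > -n`, and `f^{1-j} = z^{1-j} g^{1-j}`). -/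
def lieField (n : ℤ) (k : ℕ+) : Sec :=
  zcoeff (k - n) f'
    - ∑ j ∈ Finset.range ((-n).toNat + 1), pushCoeff n j * zcoeff (k + j) (g * gInv ^ j)

/-- The multiplier `h ∮ (w f'/f)² w^n dw/w + (c/12) ∮ w² S(f,w) w^n dw/w`. -/
def multiplier (c h : ℂ) (n : ℤ) : Sec :=
  h • zcoeff (-n) ((f' * gInv) ^ 2) + (c / 12) • zcoeff (-n - 2) schwarzian

/-- The vector field `∑_k V_k ∂/∂c_k` acting on polynomials. -/
def vectorField (V : ℕ+ → Sec) : Module.End ℂ Sec := (MvPolynomial.mkDerivation ℂ V).toLinearMap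

/-- The Virasoro generator `L_n` acting on polynomial sections of `E_{c,h}`. -/
def L (c h : ℂ) (n : ℤ) : Module.End ℂ Sec :=
  vectorField (lieField n) + LinearMap.mulLeft ℂ (multiplier c h n)

/-- The smallest subspace that contains `v` and is stable under the operators `T n`, `n < 1`. -/
def generated {M : Type*} [AddCommGroup M] [Module ℂ M] (T : ℤ → Module.End ℂ M) (v : M) :
    Submodule ℂ M :=
  sInf {N : Submodule ℂ M | v ∈ N ∧ ∀ n : ℤ, n < 1 → ∀ x ∈ N, T n x ∈ N}

/-- The module of polynomial sections generated from the constant section `1`. -/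
def polyModule (c h : ℂ) : Submodule ℂ Sec := generated (L c h) 1

/-- The contragredient action on linear functionals on sections: `(dualL n φ) P = φ (L_{-n} P)`. -/
def dualL (c h : ℂ) (n : ℤ) : Module.End ℂ (Module.Dual ℂ Sec) := (L c h (-n)).dualMap

/-- The pairing `⟨1, ·⟩` with the constant section, i.e. evaluation at the origin. -/
def vacuum : Module.Dual ℂ Sec := (MvPolynomial.aeval (fun _ : ℕ+ => (0 : ℂ))).toLinearMap

/-- The Verma module `V(c,h)`, realised in the dual of the space of sections. -/
def verma (c h : ℂ) : Submodule ℂ (Module.Dual ℂ Sec) := generated (dualL c h) vacuum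

/-- `v` is a null (singular) vector of level two of the Verma module `V(c,h)`. -/
def IsNullLevelTwo (c h : ℂ) (v : Module.Dual ℂ Sec) : Prop :=
  v ∈ verma c h ∧ v ≠ 0 ∧ dualL c h 0 v = (h + 2) • v ∧ ∀ n : ℤ, 1 ≤ n → dualL c h n v = 0

/-- The polynomial `P_k`: the coefficient of `z^{1-k}` in `1 / F`, for
`F = z (1 + ∑_{k ≥ 1} b_k z^{-k})` the generic point of `Aut₊(O_∞)`, in the variables `b_k`
(`P₁ = 0`, `P₂ = 1`, `P₃ = -b₁`, …). -/
def loewnerDrift (k : ℕ+) : Sec := zcoeff ((k : ℤ) - 2) gInv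

/-- `L₁^∞ = ∂/∂b₁`. -/
def Linf1 : Module.End ℂ Sec := (MvPolynomial.pderiv (1 : ℕ+)).toLinearMap

/-- `L₂^∞ = -∑_{k ≥ 2} P_k ∂/∂b_k`. -/
def Linf2 : Module.End ℂ Sec := -vectorField loewnerDrift

/-- The change of coordinates between `Aut₊(O)` and `Aut₊(O_∞)` given by `f(z) ↦ 1 / f(1/z)`. It
sends each coordinate to the coefficient of the reciprocal series, and it is an involution. -/
def inversion : Sec →ₐ[ℂ] Sec := MvPolynomial.aeval (fun k : ℕ+ => PowerSeries.coeff k gInv)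

/-- An operator on functions on `Aut₊(O_∞)`, carried over to sections over `Aut₊(O)`. -/
def lift (D : Module.End ℂ Sec) : Module.End ℂ Sec :=
  inversion.toLinearMap ∘ₗ D ∘ₗ inversion.toLinearMap

/-- The lifted generator `(κ/2) L̂₁² - 2 L̂₂` of the flow, acting on sections. -/
def liftedGenerator (κ : ℝ) : Module.End ℂ Sec :=
  ((κ : ℂ) / 2) • (lift Linf1 ^ 2) - (2 : ℂ) • lift Linf2

/-- `b` is the chordal SLE_κ flow on the coefficient body, driven by the `𝓕`-Brownian motion `B`:
the formal series `f_t(z) = z (1 + ∑_k b_k(t) z^{-k})` satisfies `f_0(z) = z` and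
`df_t(z) = (2 / f_t(z)) dt - √κ dB_t`, coefficient by coefficient. -/
structure IsSLEFlow {Ω : Type*} {mΩ : MeasurableSpace Ω} (κ : ℝ) (P : Measure Ω)
    (𝓕 : Filtration ℝ≥0 mΩ) (B : ℝ≥0 → Ω → ℝ) (b : ℕ+ → ℝ≥0 → Ω → ℂ) : Prop where
  brownian : IsBrownianReal B P
  adapted_driving : StronglyAdapted 𝓕 B
  indep_increments : ∀ s t : ℝ≥0, s ≤ t →
    Indep (MeasurableSpace.comap (fun ω => B t ω - B s ω) inferInstance) (𝓕 s) P
  adapted : ∀ k, StronglyAdapted 𝓕 (b k)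
  loewner : ∀ᵐ ω ∂P, ∀ (t : ℝ≥0) (k : ℕ+),
    b k t ω = (∫ s in (0 : ℝ)..t, 2 * MvPolynomial.eval (fun j => b j s.toNNReal ω) (loewnerDrift k))
      - (if k = 1 then ((Real.sqrt κ * B t ω : ℝ) : ℂ) else 0)

/-- The value of the section `σ` along the flow: `σ` at the point `1 / f_t(1/z)` of `Aut₊(O)`. -/
def alongFlow {Ω : Type*} (b : ℕ+ → ℝ≥0 → Ω → ℂ) (σ : Sec) (t : ℝ≥0) (ω : Ω) : ℂ :=
  MvPolynomial.eval (fun k => b k t ω) (inversion σ)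

/-- `c_κ = (6 - κ)(3κ - 8) / (2κ)`. -/
def critC (κ : ℂ) : ℂ := (6 - κ) * (3 * κ - 8) / (2 * κ)

/-- `h_κ = (6 - κ) / (2κ)`. -/
def critH (κ : ℂ) : ℂ := (6 - κ) / (2 * κ)

end SLEVirasoro

end

open SLEVirasoro

open SLEVirasoro

namespace SLEVirasoro

section

open PowerSeries

/-! ### The generators in coordinates -/

/-! Parts (1)–(3) rest on a grading. Give `c_k` degree `k`. Every series built from `g` is
homogeneous, so `L_n` lowers degree by `n` and `L_0` is `h` plus the degree. A `π_0`-eigenvector of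
weight `h + 2` is therefore a functional supported on degree two, which is spanned by `c₁²` and
`c₂`. All such functionals have the form `(a π_{-1}² + b π_{-2}) ε` (`eq_levelTwo`), and the null
conditions reduce to two linear equations in `a, b` (`isNullLevelTwo_levelTwo_iff`). The Virasoro
commutation relations are never needed, only values in degree at most two.

Part (4) is geometric. In terms of `f`, the fields `L̂₁` and `L̂₂` are the variations `δf = -f²` and
`δf = f³`, that is, post-composition of `f` with flows. The Lie field `𝓛_n` is pre-composition with
`z^{n+1} ∂_z`, corrected by a post-composition `∑ u_j f^{1-j}` that restores the normalisation of
`f`. Pre- and post-composition commute, so only the correction contributes to the commutators.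
Writing `u_j` for `pushCoeff (-N) j`, one finds `[L̂₁, 𝓛_{-N}] = u₀ L̂₁` and `[L̂₂, 𝓛_{-N}] = 2u₀
L̂₂ - 3u₁ L̂₁`. Together with the variation of the multiplier this gives the identity
`liftedGenerator_L`: the lifted generator intertwines `L_{-N} + 2u₀` with `L_{-N}`, up to error
terms with the scalar factors `6 - κ(2h+1)` and `3κh - 8h - c`. Both vanish exactly on the critical
curve, and then the kernel of the generator is stable under all `L_n` with `n < 1`.

Part (5) avoids stochastic integration. Along the flow `b₁ = -√κ B`, while each later `b_k` is the
time integral of a polynomial in earlier coefficients, so it is of class `C¹`. A monomial is a power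
of a Gaussian process times a `C¹` process. For such products, Gaussian integration by parts on the
increments, Fubini and a pathwise integration by parts yield Dynkin's formula on every event of the
past (`dynkin_pow_mul`, `IsSLEFlow.dynkin`). All moments are bounded on compact time intervals, so a
harmonic section even gives a true martingale. -/

theorem coeff_g (k : ℕ) : coeff k g = coord k := by simp [g]

@[simp] theorem coord_zero : coord 0 = 1 := by simp [coord]

theorem coord_pnat (k : ℕ+) : coord k = MvPolynomial.X k := by
  rw [coord, dif_pos k.pos]
  rfl

@[simp] theorem constantCoeff_g : constantCoeff g = 1 := by
  rw [← coeff_zero_eq_constantCoeff_apply, coeff_g, coord_zero]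

theorem g_mul_gInv : g * gInv = 1 := mul_invOfUnit _ _ (by simp)

@[simp] theorem constantCoeff_gInv : constantCoeff gInv = 1 := by
  simp [gInv]

theorem f'_eq : f' = g + X * derivative Sec g := by
  rw [f', Derivation.leibniz, derivative_X]; simp [add_comm]

theorem coeff_f' (k : ℕ) : coeff k f' = ((k + 1 : ℕ) : Sec) * coord k := by
  rw [f', coeff_derivative, coeff_succ_X_mul, coeff_g]; push_cast; ring

@[simp] theorem constantCoeff_f' : constantCoeff f' = 1 := by
  rw [← coeff_zero_eq_constantCoeff_apply, coeff_f']; simp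

theorem f'_mul_inv : f' * invOfUnit f' 1 = 1 := mul_invOfUnit _ _ (by simp)

theorem zcoeff_natCast (k : ℕ) (p : PowerSeries Sec) : zcoeff k p = coeff k p := by
  simp [zcoeff]

theorem zcoeff_of_neg {i : ℤ} (hi : i < 0) (p : PowerSeries Sec) : zcoeff i p = 0 := by
  simp [zcoeff, hi]

/-- The coefficients of `f' / g = z f' / f` follow recursively from `(f' / g) g = f'`, without
expanding `1 / g`. -/
theorem coeff_logDeriv_one : coeff 1 (f' * gInv) = coord 1 := by
  have h : f' * gInv * g = f' := by rw [mul_assoc, mul_comm gInv, g_mul_gInv, mul_one]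
  have h0 : constantCoeff (f' * gInv) = 1 := by simp
  generalize f' * gInv = q at h h0 ⊢
  have h1 := congrArg (coeff 1) h
  simp [h0, coeff_mul, Finset.Nat.antidiagonal_succ, coeff_f', coeff_g] at h1
  linear_combination h1

theorem coeff_logDeriv_two : coeff 2 (f' * gInv) = 2 * coord 2 - coord 1 ^ 2 := by
  have h : f' * gInv * g = f' := by rw [mul_assoc, mul_comm gInv, g_mul_gInv, mul_one]
  have h0 : constantCoeff (f' * gInv) = 1 := by simp
  have h1' := coeff_logDeriv_one
  generalize f' * gInv = q at h h0 h1' ⊢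
  have h1 := congrArg (coeff 2) h
  rw [coeff_mul] at h1
  simp [h0, h1', Finset.Nat.antidiagonal_succ, coeff_f', coeff_g] at h1
  linear_combination h1

theorem coeff_logDeriv_sq_one : coeff 1 ((f' * gInv) ^ 2) = 2 * coord 1 := by
  rw [pow_two, coeff_mul]
  simp [Finset.Nat.antidiagonal_succ, coeff_logDeriv_one]
  ring

theorem coeff_logDeriv_sq_two : coeff 2 ((f' * gInv) ^ 2) = 4 * coord 2 - coord 1 ^ 2 := by
  rw [pow_two, coeff_mul]
  simp [Finset.Nat.antidiagonal_succ, coeff_logDeriv_one, coeff_logDeriv_two]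
  ring

theorem constantCoeff_schwarzian :
    constantCoeff schwarzian = 6 * (coord 2 - coord 1 ^ 2) := by
  have h1 : constantCoeff (derivative Sec f') = 2 * coord 1 := by
    rw [← coeff_zero_eq_constantCoeff_apply, coeff_derivative, coeff_f']; push_cast; ring
  have h2 : constantCoeff (derivative Sec (derivative Sec f')) = 6 * coord 2 := by
    rw [← coeff_zero_eq_constantCoeff_apply, coeff_derivative, coeff_derivative, coeff_f']
    push_cast; ring
  have h3 : ∀ (a : ℂ) (p : PowerSeries Sec), constantCoeff (a • p) = a • constantCoeff p :=
    fun a p => rfl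
  rw [schwarzian, preSchwarz, map_sub, h3]
  simp [h1, h2]
  rw [MvPolynomial.smul_eq_C_mul]
  have : (MvPolynomial.C (3 / 2 : ℂ) : Sec) * 4 = 6 := by
    rw [← map_ofNat MvPolynomial.C 4, ← map_ofNat MvPolynomial.C 6, ← map_mul]; norm_num
  linear_combination -coord 1 ^ 2 * this

theorem pushCoeff_eq_zero {n : ℤ} {j : ℕ} (h : -n < j) : pushCoeff n j = 0 :=
  zcoeff_of_neg (by omega) _

theorem L_pos (c h : ℂ) (n : ℕ+) : L c h n = vectorField fun k =>
    if n ≤ k then (((k : ℕ) - n + 1 : ℕ) : Sec) * coord ((k : ℕ) - n) else 0 := by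
  have hn := n.pos
  have hm : multiplier c h n = 0 := by
    rw [multiplier, zcoeff_of_neg (by omega), zcoeff_of_neg (by omega)]; simp
  have hl : lieField n = fun k : ℕ+ =>
      if n ≤ k then (((k : ℕ) - n + 1 : ℕ) : Sec) * coord ((k : ℕ) - n) else 0 := by
    ext1 k
    rw [lieField, Finset.sum_eq_zero, sub_zero]
    · split_ifs with hk
      · have : ((k : ℕ) : ℤ) - (n : ℕ) = (((k : ℕ) - n : ℕ) : ℤ) := by
          have : (n : ℕ) ≤ k := hk
          omega
        rw [this, zcoeff_natCast, coeff_f']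
      · have : (k : ℕ) < n := not_le.1 hk
        exact zcoeff_of_neg (by omega) _
    · intro j _
      rw [pushCoeff_eq_zero (by omega), zero_mul]
  rw [L, hm, hl]
  ext1 x
  simp

theorem L_zero (c h : ℂ) : L c h 0 = vectorField (fun k => ((k : ℕ) : Sec) * coord k)
    + LinearMap.mulLeft ℂ (MvPolynomial.C h) := by
  have h0 : ∀ p : PowerSeries Sec, zcoeff 0 p = constantCoeff p := fun p => by
    simpa using zcoeff_natCast 0 p
  have hm : multiplier c h 0 = MvPolynomial.C h := by
    rw [multiplier, neg_zero, h0, zcoeff_of_neg (by omega)]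
    simp [MvPolynomial.smul_eq_C_mul]
  have hl : lieField 0 = fun k : ℕ+ => ((k : ℕ) : Sec) * coord k := by
    ext1 k
    simp only [lieField, neg_zero, Int.toNat_zero, zero_add, Finset.sum_range_one, pushCoeff,
      Nat.cast_zero, sub_zero, add_zero, h0, zcoeff_natCast, coeff_f', pow_zero, mul_one, coeff_g]
    simp
    ring
  rw [L, hm, hl]

theorem pushCoeff_neg_one_zero : pushCoeff (-1) 0 = 2 * coord 1 := by
  have : (-(-1 : ℤ) - (0 : ℕ)) = ((1 : ℕ) : ℤ) := by norm_num
  rw [pushCoeff, this, zcoeff_natCast, pow_zero, mul_one, ← mul_pow, coeff_logDeriv_sq_one]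

theorem pushCoeff_neg_two_zero : pushCoeff (-2) 0 = 4 * coord 2 - coord 1 ^ 2 := by
  have : (-(-2 : ℤ) - (0 : ℕ)) = ((2 : ℕ) : ℤ) := by norm_num
  rw [pushCoeff, this, zcoeff_natCast, pow_zero, mul_one, ← mul_pow, coeff_logDeriv_sq_two]

theorem pushCoeff_neg_self (N : ℕ) : pushCoeff (-N) N = 1 := by
  have : (-(-N : ℤ) - (N : ℕ)) = ((0 : ℕ) : ℤ) := by simp
  rw [pushCoeff, this, zcoeff_natCast]
  simp

theorem L_neg_one (c h : ℂ) : L c h (-1) = vectorField (fun k =>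
    (((k : ℕ) + 2 : ℕ) : Sec) * coord (k + 1) - 2 * coord 1 * coord k)
    + LinearMap.mulLeft ℂ (MvPolynomial.C (2 * h) * coord 1) := by
  have hm : multiplier c h (-1) = MvPolynomial.C (2 * h) * coord 1 := by
    have : -(-1 : ℤ) = ((1 : ℕ) : ℤ) := by norm_num
    rw [multiplier, zcoeff_of_neg (i := -(-1) - 2) (by norm_num), this, zcoeff_natCast, coeff_logDeriv_sq_one,
      MvPolynomial.smul_eq_C_mul, map_mul, map_ofNat]
    simp
    ring
  have hl : lieField (-1) = fun k : ℕ+ =>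
      (((k : ℕ) + 2 : ℕ) : Sec) * coord (k + 1) - 2 * coord 1 * coord k := by
    ext1 k
    have h1 : ((k : ℕ) : ℤ) - (-1) = ((k + 1 : ℕ) : ℤ) := by push_cast; ring
    have h2 : ((k : ℕ) : ℤ) + (1 : ℕ) = ((k + 1 : ℕ) : ℤ) := by push_cast; ring
    have h3 : ((k : ℕ) : ℤ) + (0 : ℕ) = (k : ℕ) := by simp
    have h4 : (-(-1 : ℤ)).toNat + 1 = 2 := rfl
    rw [lieField, h4, Finset.sum_range_succ, Finset.sum_range_one, pushCoeff_neg_one_zero, h1, h2,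
      h3, zcoeff_natCast, zcoeff_natCast, zcoeff_natCast, pow_zero, mul_one, pow_one, g_mul_gInv,
      coeff_g, coeff_f']
    simp [coeff_one, add_assoc, one_add_one_eq_two]
  rw [L, hm, hl]

theorem L_neg_two (c h : ℂ) : L c h (-2) = vectorField (fun k =>
    (((k : ℕ) + 3 : ℕ) : Sec) * coord (k + 2) - (4 * coord 2 - coord 1 ^ 2) * coord k
      - PowerSeries.coeff ((k : ℕ) + 2) gInv)
    + LinearMap.mulLeft ℂ (MvPolynomial.C h * (4 * coord 2 - coord 1 ^ 2)
      + MvPolynomial.C (c / 2) * (coord 2 - coord 1 ^ 2)) := by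
  have hm : multiplier c h (-2) = MvPolynomial.C h * (4 * coord 2 - coord 1 ^ 2)
      + MvPolynomial.C (c / 2) * (coord 2 - coord 1 ^ 2) := by
    have h1 : -(-2 : ℤ) = ((2 : ℕ) : ℤ) := by norm_num
    have h2 : -(-2 : ℤ) - 2 = ((0 : ℕ) : ℤ) := by norm_num
    rw [multiplier, h2, h1, zcoeff_natCast, zcoeff_natCast, coeff_logDeriv_sq_two,
      coeff_zero_eq_constantCoeff_apply, constantCoeff_schwarzian,
      MvPolynomial.smul_eq_C_mul, MvPolynomial.smul_eq_C_mul]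
    have : (MvPolynomial.C (c / 12) : Sec) * 6 = MvPolynomial.C (c / 2) := by
      rw [← map_ofNat MvPolynomial.C 6, ← map_mul]; congr 1; ring
    linear_combination (coord 2 - coord 1 ^ 2) * this
  have hl : lieField (-2) = fun k : ℕ+ =>
      (((k : ℕ) + 3 : ℕ) : Sec) * coord (k + 2) - (4 * coord 2 - coord 1 ^ 2) * coord k
      - PowerSeries.coeff ((k : ℕ) + 2) gInv := by
    ext1 k
    have h1 : ((k : ℕ) : ℤ) - (-2) = ((k + 2 : ℕ) : ℤ) := by push_cast; ring
    have h2 : ((k : ℕ) : ℤ) + (2 : ℕ) = ((k + 2 : ℕ) : ℤ) := by push_cast; ring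
    have h3 : ((k : ℕ) : ℤ) + (0 : ℕ) = (k : ℕ) := by simp
    have h4 : (-(-2 : ℤ)).toNat + 1 = 3 := rfl
    have h5 : ((k : ℕ) : ℤ) + (1 : ℕ) = ((k + 1 : ℕ) : ℤ) := by push_cast; ring
    have h6 : pushCoeff (-2) 2 = 1 := pushCoeff_neg_self 2
    rw [lieField, h4, Finset.sum_range_succ, Finset.sum_range_succ, Finset.sum_range_one,
      pushCoeff_neg_two_zero, h1, h2, h3, h5, h6,
      zcoeff_natCast, zcoeff_natCast, zcoeff_natCast, zcoeff_natCast, pow_zero, mul_one, pow_one,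
      g_mul_gInv, pow_two gInv, ← mul_assoc g, g_mul_gInv, one_mul, coeff_g, coeff_f']
    simp [coeff_one]
    ring
  rw [L, hm, hl]

/-! ### The grading -/

/-- The integer grading of the coordinates: `c_k` has degree `k`. -/
def wt (k : ℕ+) : ℤ := (k : ℕ)

/-- Homogeneous sections of degree `d` for the grading in which `c_k` has degree `k`. -/
abbrev Homog (P : Sec) (d : ℤ) : Prop := MvPolynomial.IsWeightedHomogeneous wt P d

/-- The coefficient of `z^i` is homogeneous of degree `i + d`. -/
def HomogSeries (p : PowerSeries Sec) (d : ℤ) : Prop := ∀ i : ℕ, Homog (coeff i p) (i + d)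

theorem homog_coord (k : ℕ) : Homog (coord k) k := by
  rcases Nat.eq_zero_or_pos k with rfl | hk
  · simpa using MvPolynomial.isWeightedHomogeneous_one ℂ wt
  · lift k to ℕ+ using hk
    rw [coord_pnat]
    exact MvPolynomial.isWeightedHomogeneous_X ℂ wt k

theorem homog_natCast_mul {P : Sec} {d : ℤ} (hP : Homog P d) (n : ℕ) : Homog ((n : Sec) * P) d := by
  rw [← map_natCast (MvPolynomial.C (R := ℂ) (σ := ℕ+))]
  exact hP.C_mul _

theorem homog_zero (d : ℤ) : Homog 0 d := MvPolynomial.isWeightedHomogeneous_zero ℂ wt d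

theorem homog_sum {ι : Type*} {s : Finset ι} {P : ι → Sec} {d : ℤ} (h : ∀ i ∈ s, Homog (P i) d) :
    Homog (∑ i ∈ s, P i) d :=
  (MvPolynomial.weightedHomogeneousSubmodule ℂ wt d).sum_mem h

namespace HomogSeries

variable {p q : PowerSeries Sec} {d e : ℤ}

theorem mul (hp : HomogSeries p d) (hq : HomogSeries q e) : HomogSeries (p * q) (d + e) := by
  intro i
  rw [coeff_mul]
  refine homog_sum fun x hx => ?_
  have := (hp x.1).mul (hq x.2)
  have hx := Finset.HasAntidiagonal.mem_antidiagonal.1 hx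
  convert this using 1
  rw [← hx]; push_cast; ring

theorem one : HomogSeries 1 0 := by
  intro i
  rw [coeff_one]
  split_ifs with h
  · simpa [h] using MvPolynomial.isWeightedHomogeneous_one ℂ wt
  · exact homog_zero _

theorem pow (hp : HomogSeries p 0) (n : ℕ) : HomogSeries (p ^ n) 0 := by
  induction n with
  | zero => simpa using one
  | succ n ih => simpa [pow_succ] using ih.mul hp

theorem derivative (hp : HomogSeries p d) : HomogSeries (derivative Sec p) (d + 1) := by
  intro i
  rw [coeff_derivative, mul_comm, ← Nat.cast_succ]
  refine homog_natCast_mul ?_ _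
  convert hp (i + 1) using 1
  push_cast; ring

theorem sub (hp : HomogSeries p d) (hq : HomogSeries q d) : HomogSeries (p - q) d := fun i => by
  rw [map_sub]; exact (hp i).sub (hq i)

theorem smul (hp : HomogSeries p d) (a : ℂ) : HomogSeries (a • p) d := fun i =>
  (MvPolynomial.weightedHomogeneousSubmodule ℂ wt _).smul_mem a (hp i)

theorem invOfUnit (hp : HomogSeries p 0) : HomogSeries (invOfUnit p 1) 0 := by
  intro i
  induction i using Nat.strong_induction_on with
  | _ i ih =>
    rw [coeff_invOfUnit]
    split_ifs with h
    · simpa [h] using MvPolynomial.isWeightedHomogeneous_one ℂ wt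
    · simp only [inv_one, Units.val_one, neg_mul, one_mul]
      refine (homog_sum fun x hx => ?_).neg
      split_ifs with h'
      · have := (hp x.1).mul (ih x.2 h')
        have hx := Finset.HasAntidiagonal.mem_antidiagonal.1 hx
        convert this using 1
        rw [← hx]; push_cast; ring
      · exact homog_zero _

theorem zcoeff (hp : HomogSeries p d) (i : ℤ) : Homog (zcoeff i p) (i + d) := by
  rcases lt_or_ge i 0 with h | h
  · rw [zcoeff_of_neg h]; exact homog_zero _
  · lift i to ℕ using h
    rw [zcoeff_natCast]; exact hp i

end HomogSeries

theorem homogSeries_g : HomogSeries g 0 := fun i => by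
  rw [coeff_g, add_zero]; exact homog_coord i

theorem homogSeries_gInv : HomogSeries gInv 0 := homogSeries_g.invOfUnit

theorem homogSeries_f' : HomogSeries f' 0 := fun i => by
  rw [coeff_f', add_zero]; exact homog_natCast_mul (homog_coord i) _

theorem homogSeries_schwarzian : HomogSeries schwarzian 2 := by
  have h1 := homogSeries_f'.derivative
  have h2 := h1.derivative.mul homogSeries_f'.invOfUnit
  have h3 : HomogSeries preSchwarz 1 := by simpa [preSchwarz] using h1.mul homogSeries_f'.invOfUnit
  refine HomogSeries.sub (by simpa using h2) (HomogSeries.smul ?_ _)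
  simpa [pow_two] using h3.mul h3

/-- In each summand the residue has degree `-n - j` and the coefficient of `f^{1-j}` has degree `k +
j`, so `j` cancels. -/
theorem homog_lieField (n : ℤ) (k : ℕ+) : Homog (lieField n k) (wt k - n) := by
  refine MvPolynomial.IsWeightedHomogeneous.sub ?_ (homog_sum fun j _ => ?_)
  · simpa [wt] using homogSeries_f'.zcoeff ((k : ℕ) - n)
  · have h1 := (((homogSeries_f'.pow 2).mul (homogSeries_gInv.pow 2)).mul
      (homogSeries_g.pow j)).zcoeff (-n - j)
    have h2 := (homogSeries_g.mul (homogSeries_gInv.pow j)).zcoeff (k + j)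
    have h3 : wt k - n = -n - j + (0 + 0 + 0) + (k + j + (0 + 0)) := by simp only [wt]; ring
    rw [h3]
    exact h1.mul h2

theorem homog_multiplier (c h : ℂ) (n : ℤ) : Homog (multiplier c h n) (-n) := by
  refine MvPolynomial.IsWeightedHomogeneous.add
    ((MvPolynomial.weightedHomogeneousSubmodule ℂ wt _).smul_mem h ?_)
    ((MvPolynomial.weightedHomogeneousSubmodule ℂ wt _).smul_mem _ ?_)
  · simpa using ((homogSeries_f'.mul homogSeries_gInv).pow 2).zcoeff (-n)
  · simpa using homogSeries_schwarzian.zcoeff (-n - 2)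

theorem vectorField_apply (V : ℕ+ → Sec) (P : Sec) :
    vectorField V P = MvPolynomial.mkDerivation ℂ V P := rfl

@[simp] theorem vectorField_X (V : ℕ+ → Sec) (k : ℕ+) : vectorField V (MvPolynomial.X k) = V k :=
  MvPolynomial.mkDerivation_X _ _ _

theorem vectorField_mul (V : ℕ+ → Sec) (P Q : Sec) :
    vectorField V (P * Q) = P * vectorField V Q + vectorField V P * Q := by
  simp only [vectorField_apply, Derivation.leibniz, smul_eq_mul]; ring

@[simp] theorem vectorField_one (V : ℕ+ → Sec) : vectorField V 1 = 0 :=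
  Derivation.map_one_eq_zero _

theorem homog_monomial (s : ℕ+ →₀ ℕ) (a : ℂ) :
    Homog (MvPolynomial.monomial s a) (Finsupp.weight wt s) :=
  MvPolynomial.isWeightedHomogeneous_monomial _ _ _ rfl

/-- An induction suited to the Leibniz rule: a property of monomials that tracks the exponent and
passes to products need only be checked on the variables. -/
theorem monomial_one_induction {p : (ℕ+ →₀ ℕ) → Sec → Prop} (h0 : p 0 1)
    (hX : ∀ k, p (Finsupp.single k 1) (MvPolynomial.X k))
    (hmul : ∀ s t, p s (MvPolynomial.monomial s 1) → p t (MvPolynomial.monomial t 1) →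
      p (s + t) (MvPolynomial.monomial s 1 * MvPolynomial.monomial t 1)) (s : ℕ+ →₀ ℕ) :
    p s (MvPolynomial.monomial s 1) := by
  have hadd : ∀ s t, p s (MvPolynomial.monomial s 1) → p t (MvPolynomial.monomial t 1) →
      p (s + t) (MvPolynomial.monomial (s + t) 1) := fun s t hs ht => by
    simpa [MvPolynomial.monomial_mul] using hmul s t hs ht
  induction s using Finsupp.induction_linear with
  | zero => exact h0
  | add s t hs ht => exact hadd s t hs ht
  | single k n =>
    induction n with
    | zero => simpa using h0
    | succ n ih => rw [Finsupp.single_add]; exact hadd _ _ ih (hX k)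

theorem homog_vectorField {V : ℕ+ → Sec} {n d : ℤ} (hV : ∀ k, Homog (V k) (wt k + n)) {P : Sec}
    (hP : Homog P d) : Homog (vectorField V P) (d + n) := by
  have hmon : ∀ s, Homog (vectorField V (MvPolynomial.monomial s 1)) (Finsupp.weight wt s + n) := by
    refine fun s => monomial_one_induction
      (p := fun s P => Homog (vectorField V P) (Finsupp.weight wt s + n)) ?_ ?_ ?_ s
    · simpa using homog_zero _
    · intro k; simpa [Finsupp.weight_apply] using hV k
    · intro s t hs ht
      rw [vectorField_mul]
      refine MvPolynomial.IsWeightedHomogeneous.add ?_ ?_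
      · convert (homog_monomial s 1).mul ht using 1
        rw [map_add]; ring
      · convert hs.mul (homog_monomial t 1) using 1
        rw [map_add]; ring
  rw [P.as_sum, map_sum]
  refine homog_sum fun s hs => ?_
  have h1 := hP (MvPolynomial.mem_support_iff.1 hs)
  rw [← h1, ← mul_one (MvPolynomial.coeff s P), ← smul_eq_mul, ← MvPolynomial.smul_monomial,
    map_smul]
  exact (MvPolynomial.weightedHomogeneousSubmodule ℂ wt _).smul_mem _ (hmon s)

theorem L_apply (c h : ℂ) (n : ℤ) (P : Sec) :
    L c h n P = vectorField (lieField n) P + multiplier c h n * P := rfl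

theorem homog_L (c h : ℂ) (n : ℤ) {P : Sec} {d : ℤ} (hP : Homog P d) :
    Homog (L c h n P) (d - n) := by
  rw [L_apply]
  refine MvPolynomial.IsWeightedHomogeneous.add ?_ ?_
  · rw [sub_eq_add_neg]
    exact homog_vectorField (fun k => by simpa [sub_eq_add_neg] using homog_lieField n k) hP
  · simpa [sub_eq_add_neg, add_comm] using (homog_multiplier c h n).mul hP

/-- The vector field in `L_0` is the Euler field `∑ k c_k ∂_k` of the grading. -/
theorem L_zero_of_homog (c h : ℂ) {P : Sec} {d : ℤ} (hP : Homog P d) :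
    L c h 0 P = (h + d) • P := by
  have hmon : ∀ s, vectorField (fun k => ((k : ℕ) : Sec) * coord k) (MvPolynomial.monomial s 1)
      = ((Finsupp.weight wt s : ℤ) : ℂ) • MvPolynomial.monomial s 1 := by
    refine monomial_one_induction (p := fun s P =>
      vectorField (fun k => ((k : ℕ) : Sec) * coord k) P = ((Finsupp.weight wt s : ℤ) : ℂ) • P)
      ?_ ?_ ?_
    · simp
    · intro k
      simp [Finsupp.weight_apply, wt, coord_pnat, MvPolynomial.smul_eq_C_mul]
    · intro s t hs ht
      rw [vectorField_mul, hs, ht, map_add]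
      push_cast
      rw [mul_smul_comm, smul_mul_assoc, ← add_smul, add_comm]
  have hE : vectorField (fun k => ((k : ℕ) : Sec) * coord k) P = (d : ℂ) • P := by
    conv_lhs => rw [P.as_sum]
    conv_rhs => rw [P.as_sum]
    rw [map_sum, Finset.smul_sum]
    refine Finset.sum_congr rfl fun s hs => ?_
    have h1 := hP (MvPolynomial.mem_support_iff.1 hs)
    rw [← mul_one (MvPolynomial.coeff s P), ← smul_eq_mul, ← MvPolynomial.smul_monomial,
      map_smul, hmon, h1, smul_comm]
  rw [L_zero, LinearMap.add_apply, hE, LinearMap.mulLeft_apply, add_smul, add_comm,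
    MvPolynomial.smul_eq_C_mul P h]

/-- The functional `φ` is concentrated in degree `d`. -/
def ConcentratedIn (φ : Module.Dual ℂ Sec) (d : ℤ) : Prop := ∀ e ≠ d, ∀ P, Homog P e → φ P = 0

theorem ConcentratedIn.dualL {φ : Module.Dual ℂ Sec} {d : ℤ} (hφ : ConcentratedIn φ d) (c h : ℂ)
    (n : ℤ) : ConcentratedIn (dualL c h n φ) (d - n) := fun e he P hP =>
  hφ (e - -n) (by omega) _ (homog_L c h (-n) hP)

theorem ConcentratedIn.add {φ ψ : Module.Dual ℂ Sec} {d : ℤ} (hφ : ConcentratedIn φ d)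
    (hψ : ConcentratedIn ψ d) : ConcentratedIn (φ + ψ) d := fun e he P hP => by
  rw [LinearMap.add_apply, hφ e he P hP, hψ e he P hP, add_zero]

theorem ConcentratedIn.smul {φ : Module.Dual ℂ Sec} {d : ℤ} (hφ : ConcentratedIn φ d) (a : ℂ) :
    ConcentratedIn (a • φ) d := fun e he P hP => by
  rw [LinearMap.smul_apply, hφ e he P hP, smul_zero]

/-! ### Monomials of degree at most two, and functionals concentrated in one degree. -/

theorem weight_wt_eq (s : ℕ+ →₀ ℕ) :
    Finsupp.weight wt s = (Finsupp.weight (fun k : ℕ+ => (k : ℕ)) s : ℕ) := by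
  simp [Finsupp.weight_apply, Finsupp.sum, wt]

theorem weight_wt_nonneg (s : ℕ+ →₀ ℕ) : 0 ≤ Finsupp.weight wt s := by
  rw [weight_wt_eq]; positivity

theorem eq_zero_or_exists_single_add (s : ℕ+ →₀ ℕ) :
    s = 0 ∨ ∃ (k : ℕ+) (t : ℕ+ →₀ ℕ), s = Finsupp.single k 1 + t ∧
      Finsupp.weight wt s = (k : ℕ) + Finsupp.weight wt t := by
  refine or_iff_not_imp_left.2 fun h => ?_
  obtain ⟨k, hk⟩ := Finsupp.support_nonempty_iff.2 h
  have hk' : s k ≠ 0 := Finsupp.mem_support_iff.1 hk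
  have : s = Finsupp.single k 1 + (s - Finsupp.single k 1) :=
    (add_tsub_cancel_of_le (Finsupp.single_le_iff.2 (Nat.one_le_iff_ne_zero.2 hk'))).symm
  refine ⟨k, s - Finsupp.single k 1, this, ?_⟩
  conv_lhs => rw [this, map_add]
  simp [Finsupp.weight_apply, wt]

theorem eq_zero_of_weight_eq_zero {s : ℕ+ →₀ ℕ} (hs : Finsupp.weight wt s = 0) : s = 0 := by
  rcases eq_zero_or_exists_single_add s with rfl | ⟨k, t, rfl, h⟩
  · rfl
  · have := weight_wt_nonneg t
    have := k.pos
    omega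

theorem eq_single_of_weight_eq_one {s : ℕ+ →₀ ℕ} (hs : Finsupp.weight wt s = 1) :
    s = Finsupp.single 1 1 := by
  rcases eq_zero_or_exists_single_add s with rfl | ⟨k, t, rfl, h⟩
  · simp at hs
  · have := weight_wt_nonneg t
    have := k.pos
    have hk : (k : ℕ) = 1 := by omega
    rw [eq_zero_of_weight_eq_zero (s := t) (by omega), PNat.coe_eq_one_iff.1 hk, add_zero]

theorem eq_of_weight_eq_two {s : ℕ+ →₀ ℕ} (hs : Finsupp.weight wt s = 2) :
    s = Finsupp.single 1 1 + Finsupp.single 1 1 ∨ s = Finsupp.single 2 1 := by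
  rcases eq_zero_or_exists_single_add s with rfl | ⟨k, t, rfl, h⟩
  · simp at hs
  · have := weight_wt_nonneg t
    have := k.pos
    have hk : (k : ℕ) = 1 ∨ (k : ℕ) = 2 := by omega
    rcases hk with hk | hk
    · left
      rw [eq_single_of_weight_eq_one (s := t) (by omega), PNat.coe_eq_one_iff.1 hk]
    · right
      have : k = 2 := PNat.eq hk
      rw [eq_zero_of_weight_eq_zero (s := t) (by omega), this, add_zero]

theorem ConcentratedIn.eq_zero {φ : Module.Dual ℂ Sec} {d : ℤ} (hφ : ConcentratedIn φ d)
    (h : ∀ s, Finsupp.weight wt s = d → φ (MvPolynomial.monomial s 1) = 0) : φ = 0 := by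
  refine MvPolynomial.linearMap_ext fun s => LinearMap.ext_ring ?_
  by_cases hs : Finsupp.weight wt s = d
  · simpa using h s hs
  · simpa using hφ _ hs _ (homog_monomial s 1)

theorem concentratedIn_vacuum : ConcentratedIn vacuum 0 := by
  intro e he P hP
  have h : vacuum P = MvPolynomial.constantCoeff P := by
    simp [vacuum, MvPolynomial.aeval_def, MvPolynomial.eval₂_zero'_apply]
  rw [h]
  exact hP.coeff_eq_zero 0 (by simpa using he.symm)

/-- On degree `e` the operator `L_0` is the scalar `h + e`; different degrees have different
eigenvalues, so an eigenvector of `π_0` can only see one of them. -/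
theorem dualL_zero_eq_iff {c h : ℂ} {v : Module.Dual ℂ Sec} (d : ℤ) :
    dualL c h 0 v = (h + d) • v ↔ ConcentratedIn v d := by
  have key : ∀ {e : ℤ} {P : Sec}, Homog P e → dualL c h 0 v P = (h + e) • v P := fun hP => by
    rw [dualL, neg_zero, LinearMap.dualMap_apply, L_zero_of_homog c h hP, map_smul]
  constructor
  · intro hv e he P hP
    have h1 := key hP
    rw [hv, LinearMap.smul_apply, smul_eq_mul, smul_eq_mul, mul_eq_mul_right_iff] at h1
    refine h1.resolve_left fun h2 => he ?_
    exact_mod_cast (add_left_cancel h2).symm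
  · intro hv
    refine MvPolynomial.linearMap_ext fun s => LinearMap.ext_ring ?_
    rw [LinearMap.comp_apply, LinearMap.comp_apply, key (homog_monomial s 1),
      LinearMap.smul_apply]
    by_cases hs : Finsupp.weight wt s = d
    · rw [hs]
    · rw [hv _ hs _ (homog_monomial s 1), smul_zero, smul_zero]

/-! ### Null vectors of level two -/

theorem mem_generated_self {M : Type*} [AddCommGroup M] [Module ℂ M] (T : ℤ → Module.End ℂ M)
    (v : M) : v ∈ generated T v :=
  Submodule.mem_sInf.2 fun _ hN => hN.1

theorem mem_generated_of_mem {M : Type*} [AddCommGroup M] [Module ℂ M] {T : ℤ → Module.End ℂ M}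
    {v x : M} {n : ℤ} (hn : n < 1) (hx : x ∈ generated T v) : T n x ∈ generated T v :=
  Submodule.mem_sInf.2 fun N hN => hN.2 n hn x (Submodule.mem_sInf.1 hx N hN)

theorem generated_le {M : Type*} [AddCommGroup M] [Module ℂ M] {T : ℤ → Module.End ℂ M}
    {v : M} {N : Submodule ℂ M} (hv : v ∈ N) (hN : ∀ n : ℤ, n < 1 → ∀ x ∈ N, T n x ∈ N) :
    generated T v ≤ N :=
  sInf_le ⟨hv, hN⟩

/-- The general vector `(a π_{-1}² + b π_{-2}) ε` of level two in the Verma module. -/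
noncomputable def levelTwo (c h a b : ℂ) : Module.Dual ℂ Sec :=
  (a • (dualL c h (-1) ^ 2) + b • dualL c h (-2)) vacuum

theorem levelTwo_apply (c h a b : ℂ) (P : Sec) :
    levelTwo c h a b P = a * vacuum (L c h 1 (L c h 1 P)) + b * vacuum (L c h 2 P) := rfl

theorem levelTwo_mem_verma (c h a b : ℂ) : levelTwo c h a b ∈ verma c h := by
  have h0 : vacuum ∈ verma c h := mem_generated_self _ _
  have h1 := mem_generated_of_mem (n := -1) (by norm_num) h0
  have h11 := mem_generated_of_mem (n := -1) (by norm_num) h1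
  have h2 := mem_generated_of_mem (n := -2) (by norm_num) h0
  exact (verma c h).add_mem ((verma c h).smul_mem a h11) ((verma c h).smul_mem b h2)

theorem levelTwo_eq (c h a b : ℂ) : levelTwo c h a b =
    a • dualL c h (-1) (dualL c h (-1) vacuum) + b • dualL c h (-2) vacuum := by
  rw [levelTwo, LinearMap.add_apply, LinearMap.smul_apply, LinearMap.smul_apply, pow_two,
    Module.End.mul_apply]

theorem concentratedIn_levelTwo (c h a b : ℂ) : ConcentratedIn (levelTwo c h a b) 2 := by
  have h1 := ((concentratedIn_vacuum.dualL c h (-1)).dualL c h (-1)).smul a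
  have h2 := (concentratedIn_vacuum.dualL c h (-2)).smul b
  rw [levelTwo_eq]
  norm_num at h1 h2
  exact h1.add h2

theorem L_one (c h : ℂ) : L c h 1 = vectorField fun k : ℕ+ => ((k : ℕ) : Sec) * coord (k - 1) := by
  have := L_pos c h 1
  simp only [PNat.val_ofNat, Nat.cast_one] at this
  rw [this]
  congr 1
  ext1 k
  rw [if_pos one_le, Nat.sub_add_cancel k.pos]

theorem coord_one : coord 1 = MvPolynomial.X 1 := coord_pnat 1

theorem coord_two : coord 2 = MvPolynomial.X 2 := coord_pnat 2

theorem L_two_X_one (c h : ℂ) : L c h 2 (MvPolynomial.X 1) = 0 := by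
  have := L_pos c h 2
  simp only [PNat.val_ofNat, Nat.cast_ofNat] at this
  rw [this, vectorField_X, if_neg (by decide)]

theorem L_two_X_two (c h : ℂ) : L c h 2 (MvPolynomial.X 2) = 1 := by
  have := L_pos c h 2
  simp only [PNat.val_ofNat, Nat.cast_ofNat] at this
  rw [this, vectorField_X, if_pos le_rfl]
  simp

theorem L_two_mul (c h : ℂ) (P Q : Sec) : L c h 2 (P * Q) = P * L c h 2 Q + L c h 2 P * Q := by
  have := L_pos c h 2
  simp only [PNat.val_ofNat, Nat.cast_ofNat] at this
  rw [this, vectorField_mul]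

theorem vacuum_eq (P : Sec) : vacuum P = MvPolynomial.constantCoeff P := by
  simp [vacuum, MvPolynomial.aeval_def, MvPolynomial.eval₂_zero'_apply]

theorem levelTwo_X_one_sq (c h a b : ℂ) :
    levelTwo c h a b (MvPolynomial.X 1 * MvPolynomial.X 1) = 2 * a := by
  rw [levelTwo_apply, L_two_mul, L_two_X_one, L_one, vectorField_mul, vectorField_X, map_add,
    vectorField_mul, vectorField_mul, vectorField_X]
  simp [vacuum_eq]
  ring

theorem levelTwo_X_two (c h a b : ℂ) : levelTwo c h a b (MvPolynomial.X 2) = 2 * a + b := by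
  rw [levelTwo_apply, L_two_X_two, L_one, vectorField_X, vectorField_mul]
  have : vectorField (fun k : ℕ+ => ((k : ℕ) : Sec) * coord (k - 1))
      (((2 : ℕ+) : ℕ) : Sec) = 0 :=
    Derivation.map_natCast _ _
  rw [this]
  simp [vacuum_eq, coord_one]
  rw [map_ofNat MvPolynomial.constantCoeff 2]
  ring

/-- A functional of degree two is determined by its values on `X₁²` and `X₂`. For `levelTwo c h a b`
these are `2a` and `2a + b`, and the system can be solved for `a` and `b`. -/
theorem eq_levelTwo {v : Module.Dual ℂ Sec} (hv : ConcentratedIn v 2) (c h : ℂ) :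
    ∃ a b, v = levelTwo c h a b := by
  refine ⟨v (MvPolynomial.X 1 * MvPolynomial.X 1) / 2,
    v (MvPolynomial.X 2) - v (MvPolynomial.X 1 * MvPolynomial.X 1), ?_⟩
  set a := v (MvPolynomial.X 1 * MvPolynomial.X 1) / 2 with ha
  set b := v (MvPolynomial.X 2) - v (MvPolynomial.X 1 * MvPolynomial.X 1) with hb
  rw [← add_neg_eq_zero, ← neg_one_smul ℂ]
  refine (hv.add ((concentratedIn_levelTwo c h a b).smul (-1))).eq_zero fun s hs => ?_
  rcases eq_of_weight_eq_two hs with rfl | rfl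
  · rw [← one_mul (1 : ℂ), ← MvPolynomial.monomial_mul, LinearMap.add_apply, LinearMap.smul_apply]
    change v (MvPolynomial.X 1 * MvPolynomial.X 1) +
      -(1 * 1) • levelTwo c h a b (MvPolynomial.X 1 * MvPolynomial.X 1) = 0
    rw [levelTwo_X_one_sq, ha, smul_eq_mul]; ring
  · rw [LinearMap.add_apply, LinearMap.smul_apply]
    change v (MvPolynomial.X 2) + (-1 : ℂ) • levelTwo c h a b (MvPolynomial.X 2) = 0
    rw [levelTwo_X_two, ha, hb, smul_eq_mul]; ring

theorem L_neg_one_one (c h : ℂ) : L c h (-1) 1 = (2 * h) • MvPolynomial.X 1 := by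
  rw [L_neg_one]
  simp [coord_one, MvPolynomial.smul_eq_C_mul, mul_assoc]

theorem L_neg_one_X_one (c h : ℂ) : L c h (-1) (MvPolynomial.X 1) =
    (3 : ℂ) • MvPolynomial.X 2 + (2 * h - 2) • (MvPolynomial.X 1 * MvPolynomial.X 1) := by
  rw [L_neg_one]
  simp [coord_one, coord_two, MvPolynomial.smul_eq_C_mul, one_add_one_eq_two]
  rw [map_ofNat MvPolynomial.C 2, map_ofNat MvPolynomial.C 3]
  ring

theorem L_neg_two_one (c h : ℂ) : L c h (-2) 1 =
    (4 * h + c / 2) • MvPolynomial.X 2 - (h + c / 2) • (MvPolynomial.X 1 * MvPolynomial.X 1) := by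
  rw [L_neg_two]
  simp [coord_one, coord_two, MvPolynomial.smul_eq_C_mul]
  rw [map_ofNat MvPolynomial.C 4]
  ring

/-- `π_n v` is concentrated in degree `2 - n`, so it vanishes automatically for `n ≥ 3`. For `n = 1`
and `n = 2` it is tested on the only monomials available, `X₁` and `1`, and the two equations are
the resulting values. -/
theorem isNullLevelTwo_levelTwo_iff (c h a b : ℂ) : IsNullLevelTwo c h (levelTwo c h a b) ↔
    (a ≠ 0 ∨ b ≠ 0) ∧ a * (4 * h + 2) + 3 * b = 0 ∧ 6 * a * h + b * (4 * h + c / 2) = 0 := by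
  have hconc := concentratedIn_levelTwo c h a b
  have h1 : dualL c h 1 (levelTwo c h a b) (MvPolynomial.X 1) = a * (4 * h + 2) + 3 * b := by
    change levelTwo c h a b (L c h (-1) (MvPolynomial.X 1)) = _
    rw [L_neg_one_X_one, map_add, map_smul, map_smul, levelTwo_X_two, levelTwo_X_one_sq]
    simp only [smul_eq_mul]; ring
  have h2 : dualL c h 2 (levelTwo c h a b) 1 = 6 * a * h + b * (4 * h + c / 2) := by
    change levelTwo c h a b (L c h (-2) 1) = _
    rw [L_neg_two_one, map_sub, map_smul, map_smul, levelTwo_X_two, levelTwo_X_one_sq]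
    simp only [smul_eq_mul]; ring
  have h0 : levelTwo c h a b ≠ 0 ↔ a ≠ 0 ∨ b ≠ 0 := by
    rw [← not_and_or, not_iff_not]
    constructor
    · intro h0
      have e1 := levelTwo_X_one_sq c h a b
      have e2 := levelTwo_X_two c h a b
      rw [h0, LinearMap.zero_apply] at e1 e2
      have ha : a = 0 := by linear_combination -e1 / 2
      exact ⟨ha, by linear_combination -e2 - 2 * ha⟩
    · rintro ⟨rfl, rfl⟩
      ext1 s
      simp [levelTwo]
  constructor
  · rintro ⟨-, hne, -, hann⟩
    refine ⟨h0.1 hne, ?_, ?_⟩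
    · rw [← h1, hann 1 le_rfl, LinearMap.zero_apply]
    · rw [← h2, hann 2 (by norm_num), LinearMap.zero_apply]
  · rintro ⟨hne, e1, e2⟩
    refine ⟨levelTwo_mem_verma c h a b, h0.2 hne, ?_, fun n hn => ?_⟩
    · exact_mod_cast (dualL_zero_eq_iff 2).2 hconc
    · refine (hconc.dualL c h n).eq_zero fun s hs => ?_
      have hs0 := weight_wt_nonneg s
      -- Weights are nonnegative and `s` has weight `2 - n`, which leaves only these cases.
      obtain rfl | rfl : n = 1 ∨ n = 2 := by omega
      · rw [eq_single_of_weight_eq_one (hs.trans (by norm_num))]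
        exact h1.trans e1
      · rw [eq_zero_of_weight_eq_zero (hs.trans (by norm_num))]
        exact h2.trans e2

theorem isNullLevelTwo_iff_exists (c h : ℂ) : (∃ v, IsNullLevelTwo c h v) ↔
    ∃ a b, IsNullLevelTwo c h (levelTwo c h a b) := by
  refine ⟨fun ⟨v, hv⟩ => ?_, fun ⟨a, b, hv⟩ => ⟨_, hv⟩⟩
  have hc : ConcentratedIn v 2 := (dualL_zero_eq_iff 2).1 (by exact_mod_cast hv.2.2.1)
  obtain ⟨a, b, rfl⟩ := eq_levelTwo hc c h
  exact ⟨a, b, hv⟩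

/-- The two equations that cut out the critical curve. -/
theorem eq_crit_iff {κ : ℂ} (hκ : κ ≠ 0) (c h : ℂ) : c = critC κ ∧ h = critH κ ↔
    κ * (2 * h + 1) = 6 ∧ 3 * κ * h = 8 * h + c := by
  have hH : h = critH κ ↔ κ * (2 * h + 1) = 6 := by
    rw [critH, eq_div_iff (by simpa using hκ)]
    constructor <;> intro e <;> linear_combination e
  rw [and_comm, hH]
  refine and_congr_right fun e => ?_
  have hh : h = (6 - κ) / (2 * κ) := hH.2 e
  have : critC κ = (3 * κ - 8) * h := by rw [hh, critC]; ring
  rw [this]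
  constructor <;> intro e <;> linear_combination -e

theorem exists_isNullLevelTwo_iff (c h : ℂ) : (∃ v, IsNullLevelTwo c h v) ↔
    ∃ κ : ℂ, κ ≠ 0 ∧ c = critC κ ∧ h = critH κ := by
  rw [isNullLevelTwo_iff_exists]
  constructor
  · rintro ⟨a, b, hv⟩
    obtain ⟨hne, e1, e2⟩ := (isNullLevelTwo_levelTwo_iff c h a b).1 hv
    have ha : a ≠ 0 := by
      rintro rfl
      simp at hne e1
      exact hne e1
    have hb : b ≠ 0 := by
      rintro rfl
      have e3 : 4 * h + 2 = 0 := by simpa [ha] using e1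
      have e4 : h = 0 := by simpa [ha] using e2
      rw [e4] at e3
      norm_num at e3
    -- This makes `(a, b)` proportional to `(κ/2, -2)`, the coefficients of the generator.
    refine ⟨-4 * a / b, by simp [ha, hb], ?_⟩
    rw [eq_crit_iff (by simp [ha, hb])]
    constructor
    · field_simp
      linear_combination -2 * e1
    · field_simp
      linear_combination -2 * e2
  · rintro ⟨κ, hκ, hc⟩
    obtain ⟨e1, e2⟩ := (eq_crit_iff hκ c h).1 hc
    exact ⟨κ / 2, -2, (isNullLevelTwo_levelTwo_iff _ _ _ _).2
      ⟨Or.inl (by simpa using hκ), by linear_combination e1, by linear_combination e2⟩⟩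

theorem isNullLevelTwo_generator_iff {κ : ℝ} (hκ : 0 < κ) (c h : ℂ) :
    IsNullLevelTwo c h
      ((((κ : ℂ) / 2) • (dualL c h (-1) ^ 2) - (2 : ℂ) • dualL c h (-2)) vacuum) ↔
      c = critC κ ∧ h = critH κ := by
  have hκ' : (κ : ℂ) ≠ 0 := by exact_mod_cast hκ.ne'
  have hlt : (((κ : ℂ) / 2) • (dualL c h (-1) ^ 2) - (2 : ℂ) • dualL c h (-2)) vacuum =
      levelTwo c h (κ / 2) (-2) := by
    rw [levelTwo, LinearMap.sub_apply, LinearMap.add_apply, LinearMap.smul_apply,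
      LinearMap.smul_apply, LinearMap.smul_apply, neg_smul, sub_eq_add_neg]
  rw [hlt]
  refine (isNullLevelTwo_levelTwo_iff c h (κ / 2) (-2)).trans ?_
  rw [eq_crit_iff hκ']
  constructor
  · rintro ⟨-, e1, e2⟩
    exact ⟨by linear_combination e1, by linear_combination e2⟩
  · rintro ⟨e1, e2⟩
    exact ⟨Or.inr (by norm_num), by linear_combination e1, by linear_combination e2⟩

theorem smul_X_two_add_smul_sq_eq_zero_iff (a b : ℂ) :
    a • (MvPolynomial.X 2 : Sec) + b • (MvPolynomial.X 1 * MvPolynomial.X 1) = 0 ↔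
      a = 0 ∧ b = 0 := by
  refine ⟨fun e => ?_, fun ⟨ha, hb⟩ => by simp [ha, hb]⟩
  have e1 := congrArg (MvPolynomial.eval (fun k : ℕ+ => if k = 2 then (1 : ℂ) else 0)) e
  have e2 := congrArg (MvPolynomial.eval (fun k : ℕ+ => if k = 1 then (1 : ℂ) else 0)) e
  have h12 : (1 : ℕ+) ≠ 2 := by decide
  simp [MvPolynomial.smul_eval, h12, h12.symm] at e1 e2
  exact ⟨e1, e2⟩

theorem generator_one_eq_zero_iff {κ : ℝ} (hκ : 0 < κ) (c h : ℂ) :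
    (((κ : ℂ) / 2) • (L c h (-1) ^ 2) - (2 : ℂ) • L c h (-2)) (1 : Sec) = 0 ↔
      (c = critC κ ∧ h = critH κ) ∨ (c = 0 ∧ h = 0) := by
  have hκ' : (κ : ℂ) ≠ 0 := by exact_mod_cast hκ.ne'
  have key : (((κ : ℂ) / 2) • (L c h (-1) ^ 2) - (2 : ℂ) • L c h (-2)) (1 : Sec) =
      (3 * κ * h - 8 * h - c) • MvPolynomial.X 2 +
      (κ * h * (2 * h - 2) + 2 * h + c) • (MvPolynomial.X 1 * MvPolynomial.X 1) := by
    rw [LinearMap.sub_apply, LinearMap.smul_apply, LinearMap.smul_apply, pow_two,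
      Module.End.mul_apply, L_neg_one_one, map_smul, L_neg_one_X_one, L_neg_two_one]
    module
  rw [key, smul_X_two_add_smul_sq_eq_zero_iff, eq_crit_iff hκ']
  constructor
  · rintro ⟨e1, e2⟩
    -- Adding the two coefficients eliminates `c`; the factor `h` is the source of the extra
    -- solution `(0, 0)`.
    have e3 : h * (κ * (2 * h + 1) - 6) = 0 := by linear_combination e1 + e2
    rcases mul_eq_zero.1 e3 with rfl | e4
    · exact Or.inr ⟨by linear_combination -e1, rfl⟩
    · exact Or.inl ⟨by linear_combination e4, by linear_combination e1⟩
  · rintro (⟨e1, e2⟩ | ⟨rfl, rfl⟩)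
    · exact ⟨by linear_combination e2, by linear_combination h * e1 - e2⟩
    · simp

/-! ### The lifted generator -/

/-- The coefficientwise extension of a derivation of `Sec` to power series. -/
noncomputable def seriesDer (D : Derivation ℂ Sec Sec) :
    Derivation ℤ (PowerSeries Sec) (PowerSeries Sec) :=
  Derivation.mk'
    (AddMonoidHom.toIntLinearMap
      { toFun := fun p => PowerSeries.mk fun i => D (coeff i p)
        map_zero' := by ext1 i; simp
        map_add' := fun p q => by ext1 i; simp })
    fun p q => by
      change (PowerSeries.mk fun i => D (coeff i (p * q))) =
        p * (PowerSeries.mk fun i => D (coeff i q)) + q * PowerSeries.mk fun i => D (coeff i p)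
      ext1 i
      simp only [coeff_mk, smul_eq_mul, map_add, coeff_mul, map_sum, Derivation.leibniz,
        Finset.sum_add_distrib]
      congr 1
      rw [← Finset.Nat.sum_antidiagonal_swap]
      rfl

@[simp] theorem coeff_seriesDer (D : Derivation ℂ Sec Sec) (i : ℕ) (p : PowerSeries Sec) :
    coeff i (seriesDer D p) = D (coeff i p) :=
  coeff_mk i fun i => D (coeff i p)

theorem seriesDer_C (D : Derivation ℂ Sec Sec) (P : Sec) :
    seriesDer D (PowerSeries.C P) = PowerSeries.C (D P) := by
  ext1 i
  rw [coeff_seriesDer, coeff_C, coeff_C]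
  split_ifs <;> simp

@[simp] theorem seriesDer_X (D : Derivation ℂ Sec Sec) : seriesDer D PowerSeries.X = 0 := by
  ext1 i
  rw [coeff_seriesDer, coeff_X]
  split_ifs <;> simp

theorem seriesDer_derivative (D : Derivation ℂ Sec Sec) (p : PowerSeries Sec) :
    seriesDer D (derivative Sec p) = derivative Sec (seriesDer D p) := by
  ext1 i
  rw [coeff_seriesDer, coeff_derivative, coeff_derivative, coeff_seriesDer, ← Nat.cast_succ,
    Derivation.leibniz, Derivation.map_natCast, smul_zero, zero_add, smul_eq_mul, mul_comm]

theorem zcoeff_seriesDer (D : Derivation ℂ Sec Sec) (i : ℤ) (p : PowerSeries Sec) :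
    zcoeff i (seriesDer D p) = D (zcoeff i p) := by
  unfold zcoeff
  split_ifs <;> simp

theorem zcoeff_X_pow_mul (i : ℤ) (a : ℕ) (p : PowerSeries Sec) :
    zcoeff i (PowerSeries.X ^ a * p) = zcoeff (i - a) p := by
  rcases lt_or_ge i 0 with h | h
  · rw [zcoeff_of_neg h, zcoeff_of_neg (by omega)]
  · lift i to ℕ using h
    rw [zcoeff_natCast, coeff_X_pow_mul']
    split_ifs with ha
    · rw [← Nat.cast_sub ha, zcoeff_natCast]
    · rw [zcoeff_of_neg (by omega)]

theorem zcoeff_C_mul (i : ℤ) (P : Sec) (p : PowerSeries Sec) :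
    zcoeff i (PowerSeries.C P * p) = P * zcoeff i p := by
  unfold zcoeff
  split_ifs <;> simp

theorem seriesDer_mul (D : Derivation ℂ Sec Sec) (p q : PowerSeries Sec) :
    seriesDer D (p * q) = p * seriesDer D q + q * seriesDer D p := by
  rw [Derivation.leibniz, smul_eq_mul, smul_eq_mul]

theorem seriesDer_of_mul_eq_one (D : Derivation ℂ Sec Sec) {u v : PowerSeries Sec}
    (h : u * v = 1) : seriesDer D v = -v ^ 2 * seriesDer D u := by
  have h1 := seriesDer_mul D u v
  rw [h, Derivation.map_one_eq_zero] at h1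
  linear_combination -v * h1 - seriesDer D v * h

theorem seriesDer_gInv (D : Derivation ℂ Sec Sec) :
    seriesDer D gInv = -gInv ^ 2 * seriesDer D g := seriesDer_of_mul_eq_one _ g_mul_gInv

/-- The coefficients of `g` generate the polynomial ring, so identities between vector fields may be
checked on the single series `g`. -/
theorem derivation_ext_of_seriesDer {D E : Derivation ℂ Sec Sec}
    (h : seriesDer D g = seriesDer E g) : D = E := by
  refine MvPolynomial.derivation_ext fun k => ?_
  have := congrArg (coeff (k : ℕ)) h
  rwa [coeff_seriesDer, coeff_seriesDer, coeff_g, coord_pnat] at this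

/-! ### The left-invariant fields `L̂₁` and `L̂₂` -/

theorem map_inversion_g : PowerSeries.map inversion.toRingHom g = gInv := by
  ext1 i
  rw [coeff_map, coeff_g]
  rcases Nat.eq_zero_or_pos i with rfl | hi
  · simp
  · lift i to ℕ+ using hi
    rw [coord_pnat]
    exact MvPolynomial.aeval_X _ _

theorem map_inversion_gInv : PowerSeries.map inversion.toRingHom gInv = g := by
  have h := congrArg (PowerSeries.map inversion.toRingHom) g_mul_gInv
  rw [map_mul, map_one, map_inversion_g] at h
  linear_combination g * h - PowerSeries.map inversion.toRingHom gInv * g_mul_gInv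

theorem inversion_inversion (P : Sec) : inversion (inversion P) = P := by
  have h : (inversion.comp inversion) = AlgHom.id ℂ Sec := by
    refine MvPolynomial.algHom_ext fun k => ?_
    have h1 : inversion (MvPolynomial.X k) = coeff k gInv := MvPolynomial.aeval_X _ _
    have h2 := congrArg (coeff (k : ℕ)) map_inversion_gInv
    rw [coeff_map, coeff_g, coord_pnat] at h2
    rw [AlgHom.comp_apply, h1]
    exact h2
  exact DFunLike.congr_fun h P

/-- The conjugate of a derivation by the inversion. -/
noncomputable def liftDer (D : Derivation ℂ Sec Sec) : Derivation ℂ Sec Sec :=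
  Derivation.mk' (SLEVirasoro.lift D.toLinearMap) fun P Q => by
    change inversion (D (inversion (P * Q))) =
      P • inversion (D (inversion Q)) + Q • inversion (D (inversion P))
    rw [map_mul, Derivation.leibniz, map_add, smul_eq_mul, smul_eq_mul, map_mul, map_mul,
      inversion_inversion, inversion_inversion, smul_eq_mul, smul_eq_mul]

theorem liftDer_apply (D : Derivation ℂ Sec Sec) (P : Sec) :
    liftDer D P = inversion (D (inversion P)) := rfl

/-- The inversion exchanges `g` and `1/g`, so this is the chain rule for `w ↦ 1/w`. -/
theorem seriesDer_liftDer_g (D : Derivation ℂ Sec Sec) :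
    seriesDer (liftDer D) g = -g ^ 2 * PowerSeries.map inversion.toRingHom (seriesDer D g) := by
  have h : seriesDer (liftDer D) g = PowerSeries.map inversion.toRingHom (seriesDer D gInv) := by
    rw [← map_inversion_g]
    ext1 i
    rw [coeff_seriesDer, coeff_map, coeff_seriesDer, coeff_map, liftDer_apply]
    rfl
  rw [h, seriesDer_gInv, map_mul, map_neg, map_pow, map_inversion_gInv]

/-- The derivation `L̂₁`. -/
noncomputable def lhat1 : Derivation ℂ Sec Sec := liftDer (MvPolynomial.pderiv 1)

/-- The derivation `L̂₂`. -/
noncomputable def lhat2 : Derivation ℂ Sec Sec :=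
  liftDer (-MvPolynomial.mkDerivation ℂ loewnerDrift)

/-- For `f = z g` this reads `δf = -f²`: at infinity the variation is `δF = 1`, a translation. -/
theorem seriesDer_lhat1_g : seriesDer lhat1 g = -(PowerSeries.X * g ^ 2) := by
  have h : seriesDer (MvPolynomial.pderiv 1) g = PowerSeries.X := by
    ext1 i
    rw [coeff_seriesDer, coeff_g, coeff_X]
    rcases Nat.eq_zero_or_pos i with rfl | hi
    · simp
    · lift i to ℕ+ using hi
      rw [coord_pnat, MvPolynomial.pderiv_X]
      simp only [PNat.coe_eq_one_iff, Pi.single_apply]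
  rw [lhat1, seriesDer_liftDer_g, h, PowerSeries.map_X]
  ring

/-- For `f = z g` this reads `δf = f³`, the image of `δF = -1/F`. -/
theorem seriesDer_lhat2_g : seriesDer lhat2 g = PowerSeries.X ^ 2 * g ^ 3 := by
  have h : seriesDer (-MvPolynomial.mkDerivation ℂ loewnerDrift) g =
      -(PowerSeries.X ^ 2 * gInv) := by
    ext1 i
    rw [coeff_seriesDer, coeff_g, map_neg, ← zcoeff_natCast, zcoeff_X_pow_mul,
      Derivation.neg_apply]
    rcases Nat.eq_zero_or_pos i with rfl | hi
    · rw [zcoeff_of_neg (by norm_num)]; simp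
    · lift i to ℕ+ using hi
      rw [coord_pnat, MvPolynomial.mkDerivation_X]
      rfl
  rw [lhat2, seriesDer_liftDer_g, h, map_neg, map_mul, map_inversion_gInv, map_pow,
    PowerSeries.map_X]
  ring

theorem liftedGenerator_apply (κ : ℝ) (σ : Sec) : liftedGenerator κ σ =
    ((κ : ℂ) / 2) • lhat1 (lhat1 σ) - (2 : ℂ) • lhat2 σ := by
  rw [liftedGenerator, LinearMap.sub_apply, LinearMap.smul_apply, LinearMap.smul_apply, pow_two,
    Module.End.mul_apply]
  rfl

/-! ### Variation of `f'`, of the residues and of the Schwarzian under `L̂₁` and `L̂₂`. -/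

theorem seriesDer_f' (D : Derivation ℂ Sec Sec) :
    seriesDer D f' = derivative Sec (PowerSeries.X * seriesDer D g) := by
  rw [f', seriesDer_derivative, Derivation.leibniz, seriesDer_X, smul_zero, add_zero, smul_eq_mul]

theorem derivative_X_mul_g_pow (n : ℕ) : derivative Sec ((PowerSeries.X * g) ^ (n + 1)) =
    ((n + 1 : ℕ) : PowerSeries Sec) * (PowerSeries.X * g) ^ n * f' := by
  rw [derivative_pow, Nat.add_sub_cancel, f']

theorem seriesDer_lhat1_f' : seriesDer lhat1 f' = -2 * (PowerSeries.X * g) * f' := by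
  have : PowerSeries.X * -(PowerSeries.X * g ^ 2) = -(PowerSeries.X * g) ^ 2 := by ring
  rw [seriesDer_f', seriesDer_lhat1_g, this, map_neg, derivative_X_mul_g_pow 1]
  push_cast; ring

theorem seriesDer_lhat2_f' : seriesDer lhat2 f' = 3 * (PowerSeries.X * g) ^ 2 * f' := by
  have : PowerSeries.X * (PowerSeries.X ^ 2 * g ^ 3) = (PowerSeries.X * g) ^ 3 := by ring
  rw [seriesDer_f', seriesDer_lhat2_g, this, derivative_X_mul_g_pow 2]
  push_cast; ring

/-- The inverse `q` replaces `p ^ (n - 1)` by `p ^ n * q`, so that no truncated exponent appears. -/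
theorem seriesDer_pow (D : Derivation ℂ Sec Sec) (p q : PowerSeries Sec) (hq : p * q = 1) (n : ℕ) :
    seriesDer D (p ^ n) = n * p ^ n * q * seriesDer D p := by
  rw [Derivation.leibniz_pow, smul_eq_mul, nsmul_eq_mul]
  cases n with
  | zero => simp
  | succ n =>
    rw [Nat.add_sub_cancel]
    linear_combination (-((n + 1 : ℕ) : PowerSeries Sec) * p ^ n * seriesDer D p) * hq

/-- Logarithmic differentiation of the integrand of `pushCoeff`. For a variation `δf = w(f)`, the
series `u` is `w'(f)` and `gInv * v` is `w(f)/f`. The fields `-w²` and `w³` then produce the factors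
`-(j + 2) f` and `(j + 4) f²`, and hence the index shifts by one and two below. -/
theorem seriesDer_push (D : Derivation ℂ Sec Sec) {u v : PowerSeries Sec}
    (hg : seriesDer D g = v) (hf : seriesDer D f' = u * f') (j : ℕ) :
    seriesDer D (f' ^ 2 * gInv ^ 2 * g ^ j) =
      (2 * u + (j - 2) * gInv * v) * (f' ^ 2 * gInv ^ 2 * g ^ j) := by
  rw [seriesDer_mul, seriesDer_mul, seriesDer_pow D g gInv g_mul_gInv,
    seriesDer_pow D gInv g (by rw [mul_comm, g_mul_gInv]),
    seriesDer_pow D f' (invOfUnit f' 1) f'_mul_inv, seriesDer_gInv, hf, hg]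
  push_cast
  linear_combination (2 * f' ^ 2 * gInv ^ 2 * g ^ j * u) * f'_mul_inv -
    (2 * g ^ j * f' ^ 2 * gInv ^ 3 * v) * g_mul_gInv

theorem lhat1_pushCoeff (n : ℤ) (j : ℕ) :
    lhat1 (pushCoeff n j) = -(((j : Sec) + 2) * pushCoeff n (j + 1)) := by
  have h : seriesDer lhat1 (f' ^ 2 * gInv ^ 2 * g ^ j) = PowerSeries.X ^ 1 *
      (PowerSeries.C (-((j : Sec) + 2)) * (f' ^ 2 * gInv ^ 2 * g ^ (j + 1))) := by
    rw [seriesDer_push lhat1 seriesDer_lhat1_g seriesDer_lhat1_f']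
    simp only [map_neg, map_add, map_natCast, map_ofNat]
    linear_combination (-((j : PowerSeries Sec) - 2) * PowerSeries.X * g * f' ^ 2 * gInv ^ 2 * g ^ j)
      * g_mul_gInv
  rw [pushCoeff, ← zcoeff_seriesDer, h, zcoeff_X_pow_mul, zcoeff_C_mul, neg_mul, pushCoeff]
  push_cast
  rw [sub_sub]

theorem lhat2_pushCoeff (n : ℤ) (j : ℕ) :
    lhat2 (pushCoeff n j) = ((j : Sec) + 4) * pushCoeff n (j + 2) := by
  have h : seriesDer lhat2 (f' ^ 2 * gInv ^ 2 * g ^ j) = PowerSeries.X ^ 2 *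
      (PowerSeries.C ((j : Sec) + 4) * (f' ^ 2 * gInv ^ 2 * g ^ (j + 2))) := by
    rw [seriesDer_push lhat2 seriesDer_lhat2_g seriesDer_lhat2_f']
    simp only [map_add, map_natCast, map_ofNat]
    linear_combination (((j : PowerSeries Sec) - 2) * PowerSeries.X ^ 2 * g ^ 2 * f' ^ 2 * gInv ^ 2
      * g ^ j) * g_mul_gInv
  rw [pushCoeff, ← zcoeff_seriesDer, h, zcoeff_X_pow_mul, zcoeff_C_mul, pushCoeff]
  push_cast
  rw [sub_sub]

theorem schwarzian_eq : schwarzian =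
    derivative Sec (derivative Sec f') * invOfUnit f' 1
      - PowerSeries.C (MvPolynomial.C (3 / 2 : ℂ) : Sec) *
        (derivative Sec f' * invOfUnit f' 1) ^ 2 := by
  rw [schwarzian, preSchwarz]
  congr 1
  ext1 i
  rw [coeff_C_mul, ← MvPolynomial.smul_eq_C_mul]
  rfl

theorem seriesDer_schwarzian (D : Derivation ℂ Sec Sec) {a b c : PowerSeries Sec}
    (ha : seriesDer D f' = a) (hb : seriesDer D (derivative Sec f') = b)
    (hc : seriesDer D (derivative Sec (derivative Sec f')) = c) :
    seriesDer D schwarzian = c * invOfUnit f' 1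
      - derivative Sec (derivative Sec f') * invOfUnit f' 1 ^ 2 * a
      - 2 * PowerSeries.C (MvPolynomial.C (3 / 2 : ℂ) : Sec) * (derivative Sec f' * invOfUnit f' 1)
        * (b * invOfUnit f' 1 - derivative Sec f' * invOfUnit f' 1 ^ 2 * a) := by
  rw [schwarzian_eq, map_sub, seriesDer_mul, seriesDer_mul, seriesDer_C,
    MvPolynomial.derivation_C, map_zero, pow_two, seriesDer_mul,
    seriesDer_mul, seriesDer_of_mul_eq_one D f'_mul_inv, ha, hb, hc]
  ring

theorem two_mul_C_three_halves :
    2 * PowerSeries.C (MvPolynomial.C (3 / 2 : ℂ) : Sec) = 3 := by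
  rw [← map_ofNat PowerSeries.C 2, ← map_mul, ← map_ofNat MvPolynomial.C 2, ← map_mul]
  norm_num
  rw [map_ofNat MvPolynomial.C 3, map_ofNat PowerSeries.C 3]

theorem derivative_two : derivative Sec 2 = 0 := by
  exact_mod_cast (derivative Sec).map_natCast 2

theorem derivative_three : derivative Sec 3 = 0 := by
  exact_mod_cast (derivative Sec).map_natCast 3

theorem derivative_mul (p q : PowerSeries Sec) :
    derivative Sec (p * q) = p * derivative Sec q + q * derivative Sec p := by
  rw [Derivation.leibniz, smul_eq_mul, smul_eq_mul]

/-- Möbius invariance of the Schwarzian: `δf = -f²` is an infinitesimal Möbius transformation. -/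
theorem seriesDer_lhat1_schwarzian : seriesDer lhat1 schwarzian = 0 := by
  have hF : derivative Sec (PowerSeries.X * g) = f' := rfl
  have ha : seriesDer lhat1 f' = -(2 * ((PowerSeries.X * g) * f')) := by
    rw [seriesDer_lhat1_f']; ring
  have hb : seriesDer lhat1 (derivative Sec f') =
      -(2 * (f' * f' + (PowerSeries.X * g) * derivative Sec f')) := by
    rw [seriesDer_derivative, ha, map_neg, derivative_mul, derivative_mul, derivative_two, hF]
    ring
  have hc : seriesDer lhat1 (derivative Sec (derivative Sec f')) =
      -6 * f' * derivative Sec f'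
        - 2 * (PowerSeries.X * g) * derivative Sec (derivative Sec f') := by
    rw [seriesDer_derivative, hb, map_neg, derivative_mul, map_add, derivative_mul, derivative_mul,
      derivative_two, hF]
    ring
  rw [seriesDer_schwarzian lhat1 ha hb hc]
  have h := f'_mul_inv
  have hr := two_mul_C_three_halves
  -- With the derivatives of `f` as independent variables, the claim is a polynomial identity modulo
  -- `a * i = 1` and `2 * r = 3`.
  generalize PowerSeries.C (MvPolynomial.C (3 / 2 : ℂ) : Sec) = r at hr ⊢
  generalize derivative Sec (derivative Sec f') = c
  generalize derivative Sec f' = b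
  generalize invOfUnit f' 1 = i at h ⊢
  generalize PowerSeries.X * g = F
  generalize f' = a at h ⊢
  linear_combination (-6 * b + 2 * F * c * i + 4 * r * b * (a * i + 1) - 4 * r * F * b ^ 2 * i ^ 2)
    * h + 2 * b * hr

/-- Under `δf = v(f)` the Schwarzian varies by `v'''(f) f'²`, and here `v = w³`. This is where the
central charge enters the harmonicity condition. -/
theorem seriesDer_lhat2_schwarzian : seriesDer lhat2 schwarzian = 6 * f' ^ 2 := by
  have hF : derivative Sec (PowerSeries.X * g) = f' := rfl
  have ha := seriesDer_lhat2_f'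
  generalize PowerSeries.X * g = F at hF ha
  have hb : seriesDer lhat2 (derivative Sec f') =
      3 * (2 * (F * (f' * f')) + F * (F * derivative Sec f')) := by
    rw [seriesDer_derivative, ha, pow_two, derivative_mul, derivative_mul, derivative_mul,
      derivative_three, hF]
    ring
  have hc : seriesDer lhat2 (derivative Sec (derivative Sec f')) =
      6 * f' ^ 3 + 18 * F * f' * derivative Sec f'
        + 3 * F ^ 2 * derivative Sec (derivative Sec f') := by
    rw [seriesDer_derivative, hb]
    simp only [derivative_mul, map_add, derivative_two, derivative_three, hF]
    ring
  rw [seriesDer_schwarzian lhat2 ha hb hc]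
  have h := f'_mul_inv
  have hr := two_mul_C_three_halves
  generalize PowerSeries.C (MvPolynomial.C (3 / 2 : ℂ) : Sec) = r at hr ⊢
  generalize derivative Sec (derivative Sec f') = c
  generalize derivative Sec f' = b
  generalize invOfUnit f' 1 = i at h ⊢
  generalize f' = a at h ⊢
  linear_combination (6 * a ^ 2 + 18 * F * b - 3 * F ^ 2 * c * i - 12 * r * F * b * (a * i + 1)
    + 6 * r * F ^ 2 * b ^ 2 * i ^ 2) * h - 6 * F * b * hr

/-! ### Vanishing of the low-order terms of the Lie fields. -/

theorem coeff_f'_mul_gInv_pow (a : ℕ) :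
    coeff a (f' * gInv ^ (a + 1)) = if a = 0 then 1 else 0 := by
  split_ifs with ha
  · subst ha; simp
  have hX : ∀ p : PowerSeries Sec, coeff a (PowerSeries.X * derivative Sec p) = a * coeff a p := by
    intro p
    obtain ⟨b, rfl⟩ : ∃ b, a = b + 1 := ⟨a - 1, by omega⟩
    rw [coeff_succ_X_mul, coeff_derivative]; push_cast; ring
  have h1 : derivative Sec (gInv ^ a) = -(a * gInv ^ (a + 1) * derivative Sec g) := by
    have h2 := derivative_mul g gInv
    rw [g_mul_gInv, Derivation.map_one_eq_zero] at h2
    obtain ⟨b, rfl⟩ : ∃ b, a = b + 1 := ⟨a - 1, by omega⟩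
    rw [derivative_pow, Nat.add_sub_cancel]
    linear_combination (-((b + 1 : ℕ) : PowerSeries Sec) * gInv ^ (b + 1)) * h2
      - ((b + 1 : ℕ) : PowerSeries Sec) * gInv ^ b * derivative Sec gInv * g_mul_gInv
  have h3 : (a : PowerSeries Sec) * (f' * gInv ^ (a + 1)) =
      (a : PowerSeries Sec) * gInv ^ a - PowerSeries.X * derivative Sec (gInv ^ a) := by
    rw [h1, f'_eq]
    linear_combination (a : PowerSeries Sec) * gInv ^ a * g_mul_gInv
  have h4 := congrArg (coeff a) h3
  have hC : ∀ p : PowerSeries Sec, coeff a ((a : PowerSeries Sec) * p) = a * coeff a p := fun p => by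
    rw [← map_natCast (PowerSeries.C (R := Sec)) a, coeff_C_mul]
  rw [map_sub, hX, hC, hC, sub_self] at h4
  exact (mul_eq_zero.1 h4).resolve_left (by exact_mod_cast ha)

/-- The field `z^{1-N} f' - ∑_j (pushCoeff (-N) j) f^{1-j}`, multiplied by `z^{N-1}`. -/
noncomputable def fieldSeries (N : ℕ) : PowerSeries Sec :=
  f' - ∑ j ∈ Finset.range (N + 1),
    PowerSeries.C (pushCoeff (-N) j) * PowerSeries.X ^ (N - j) * (g * gInv ^ j)

/-- This is the residue of the field against `f' f^{l-2} dz`. The main term contributes `u_l` by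
definition. By `coeff_f'_mul_gInv_pow`, which says that `f' f^{-a-1} dz` has residue zero for `a ≠
0` (it is exact), the sum contributes `u_l` as well. -/
theorem coeff_fieldSeries_mul {N l : ℕ} (hl : l ≤ N) :
    coeff (N - l) (fieldSeries N * (f' * gInv ^ 2 * g ^ l)) = 0 := by
  have h1 : fieldSeries N * (f' * gInv ^ 2 * g ^ l) = f' ^ 2 * gInv ^ 2 * g ^ l -
      ∑ j ∈ Finset.range (N + 1), PowerSeries.X ^ (N - j) *
        (PowerSeries.C (pushCoeff (-N) j) * (f' * (gInv * gInv ^ j * g ^ l))) := by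
    rw [fieldSeries, sub_mul, Finset.sum_mul]
    refine congrArg₂ (· - ·) ?_ ?_
    · ring
    · refine Finset.sum_congr rfl fun j _ => ?_
      have h := g_mul_gInv
      generalize gInv ^ j = p
      generalize g ^ l = q
      linear_combination (PowerSeries.C (pushCoeff (-N) j) * PowerSeries.X ^ (N - j) * p * f'
        * gInv * q) * h
  rw [h1, map_sub, map_sum, Finset.sum_eq_single l]
  · have : (-(-N : ℤ) - (l : ℕ)) = ((N - l : ℕ) : ℤ) := by omega
    have h2 : gInv * gInv ^ l * g ^ l = gInv := by
      rw [mul_assoc, ← mul_pow, mul_comm gInv g, g_mul_gInv, one_pow, mul_one]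
    rw [coeff_X_pow_mul', if_pos le_rfl, Nat.sub_self, coeff_C_mul, h2, pushCoeff, this,
      zcoeff_natCast]
    simp
  · intro j hj hjl
    have hjN : j ≤ N := Nat.lt_succ_iff.1 (Finset.mem_range.1 hj)
    rw [coeff_X_pow_mul']
    split_ifs with h
    · have hlj : l ≤ j := by omega
      obtain ⟨a, rfl⟩ := Nat.exists_eq_add_of_le hlj
      have h2 : gInv * gInv ^ (l + a) * g ^ l = gInv ^ (a + 1) := by
        have : (g * gInv) ^ l = 1 := by rw [g_mul_gInv, one_pow]
        rw [mul_pow] at this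
        rw [pow_add, pow_succ]
        linear_combination gInv * gInv ^ a * this
      have h3 : N - l - (N - (l + a)) = a := by omega
      rw [coeff_C_mul, h2, h3, coeff_f'_mul_gInv_pow, if_neg (by omega), mul_zero]
    · rfl
  · intro h
    exact absurd (Finset.mem_range.2 (by omega)) h

/-- The test series `f' gInv² g^l` have constant term `1`, so the residue conditions form a
triangular system. The outcome is that the corrected variation has no terms of order at most one in
`z`, so it preserves the normalisation of `f`. -/
theorem coeff_fieldSeries_eq_zero {N i : ℕ} (hi : i ≤ N) : coeff i (fieldSeries N) = 0 := by
  induction i using Nat.strong_induction_on with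
  | _ i ih =>
    have h := coeff_fieldSeries_mul (Nat.sub_le N i)
    rw [Nat.sub_sub_self hi, coeff_mul,
      Finset.sum_eq_single ((i, 0) : ℕ × ℕ)] at h
    · simpa using h
    · rintro ⟨x, y⟩ hxy hne
      have hxy := Finset.HasAntidiagonal.mem_antidiagonal.1 hxy
      have hx : x < i := by
        rcases Nat.eq_zero_or_pos y with rfl | hy
        · exact absurd (by simpa using hxy) hne
        · simp only at hxy; omega
      simp only
      rw [ih x hx (by omega), zero_mul]
    · intro hne
      exact absurd (Finset.HasAntidiagonal.mem_antidiagonal.2 (by simp)) hne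

/-- The derivation along the Lie field `𝓛_n`. -/
noncomputable def lieDer (n : ℤ) : Derivation ℂ Sec Sec := MvPolynomial.mkDerivation ℂ (lieField n)

/-- The components of `lieField` only record `k ≥ 1`; the vanishing of the lower coefficients makes
this an identity of full series. The factor `z^N` avoids Laurent series. -/
theorem X_pow_mul_seriesDer_lieDer_g (N : ℕ) :
    PowerSeries.X ^ N * seriesDer (lieDer (-N)) g = fieldSeries N := by
  ext1 i
  rw [coeff_X_pow_mul']
  split_ifs with hi
  · obtain ⟨k, rfl⟩ := Nat.exists_eq_add_of_le hi
    rw [Nat.add_sub_cancel_left, coeff_seriesDer, coeff_g]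
    rcases Nat.eq_zero_or_pos k with rfl | hk
    · rw [coord_zero, Derivation.map_one_eq_zero, add_zero, coeff_fieldSeries_eq_zero le_rfl]
    · lift k to ℕ+ using hk
      rw [coord_pnat, lieDer, MvPolynomial.mkDerivation_X, lieField, fieldSeries, map_sub, map_sum]
      have h1 : ((k : ℕ) : ℤ) - (-N) = ((N + k : ℕ) : ℤ) := by push_cast; ring
      rw [h1, zcoeff_natCast, neg_neg, Int.toNat_natCast]
      congr 1
      refine Finset.sum_congr rfl fun j hj => ?_
      have hjN : j ≤ N := Nat.lt_succ_iff.1 (Finset.mem_range.1 hj)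
      have h2 : N + (k : ℕ) = (k + j) + (N - j) := by omega
      rw [mul_assoc, coeff_C_mul, h2, coeff_X_pow_mul, ← Nat.cast_add, zcoeff_natCast]
  · rw [coeff_fieldSeries_eq_zero (by omega)]

/-! ### Harmonic sections -/

theorem pushCoeff_neg_of_lt {N j : ℕ} (h : N < j) : pushCoeff (-N) j = 0 :=
  pushCoeff_eq_zero (by omega)

theorem seriesDer_X_pow (D : Derivation ℂ Sec Sec) (N : ℕ) :
    seriesDer D (PowerSeries.X ^ N) = 0 := by
  rw [Derivation.leibniz_pow, seriesDer_X, smul_zero, smul_zero]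

/-- The action of a derivation on `fieldSeries`. -/
theorem seriesDer_fieldSeries (D : Derivation ℂ Sec Sec) {u v : PowerSeries Sec}
    (hg : seriesDer D g = g * v) (hf : seriesDer D f' = u * f') (N : ℕ) :
    seriesDer D (fieldSeries N) = u * f' - ∑ j ∈ Finset.range (N + 1),
      (PowerSeries.C (D (pushCoeff (-N) j)) * PowerSeries.X ^ (N - j) * (g * gInv ^ j) +
        (1 - (j : PowerSeries Sec)) * v * (PowerSeries.C (pushCoeff (-N) j) * PowerSeries.X ^ (N - j) * (g * gInv ^ j)))
      := by
  rw [fieldSeries, map_sub, map_sum, hf]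
  refine congrArg₂ (· - ·) rfl (Finset.sum_congr rfl fun j _ => ?_)
  rw [seriesDer_mul, seriesDer_mul, seriesDer_mul D (PowerSeries.C (pushCoeff (-N) j)), seriesDer_C, seriesDer_X_pow,
    seriesDer_pow D gInv g (by rw [mul_comm, g_mul_gInv]), seriesDer_gInv, hg]
  have h := g_mul_gInv
  generalize gInv ^ j = p
  generalize (PowerSeries.X : PowerSeries Sec) ^ (N - j) = q
  generalize PowerSeries.C (pushCoeff (-N) j) = r
  generalize PowerSeries.C (D (pushCoeff (-N) j)) = s
  generalize (j : PowerSeries Sec) = t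
  generalize gInv = i at h ⊢
  generalize g = g at h ⊢
  linear_combination (-r * q * t * p * g * v * (g * i + 1)) * h

theorem X_pow_mul_seriesDer_seriesDer_lieDer_g (D : Derivation ℂ Sec Sec) (N : ℕ) :
    PowerSeries.X ^ N * seriesDer D (seriesDer (lieDer (-N)) g) = seriesDer D (fieldSeries N) := by
  rw [← X_pow_mul_seriesDer_lieDer_g N, seriesDer_mul, seriesDer_X_pow, mul_zero, add_zero]

theorem seriesDer_commutator (D E : Derivation ℂ Sec Sec) (p : PowerSeries Sec) :
    seriesDer ⁅D, E⁆ p = seriesDer D (seriesDer E p) - seriesDer E (seriesDer D p) := by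
  ext1 i
  simp [Derivation.commutator_apply]

theorem seriesDer_smul (P : Sec) (D : Derivation ℂ Sec Sec) (p : PowerSeries Sec) :
    seriesDer (P • D) p = PowerSeries.C P * seriesDer D p := by
  ext1 i
  simp

theorem seriesDer_add (D E : Derivation ℂ Sec Sec) (p : PowerSeries Sec) :
    seriesDer (D + E) p = seriesDer D p + seriesDer E p := by
  ext1 i
  simp

/-- Apply `L̂₁` to `z^{1-N} f' - ∑ u_j f^{1-j}`. It sends `u_j` to `-(j+2) u_{j+1}` and `f^{1-j}` to
`-(1-j) f^{2-j}`. After an index shift the result is `-2f` times the field, which is `𝓛_{-N}`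
applied to `-f²`, except for the boundary term `-u₀ f²`. -/
theorem commutator_lhat1 (N : ℕ) (P : Sec) : lhat1 (lieDer (-N) P) =
    lieDer (-N) (lhat1 P) + pushCoeff (-N) 0 * lhat1 P := by
  have hX := X_pow_mul_seriesDer_lieDer_g N
  have hsum : ∑ j ∈ Finset.range (N + 1),
      ((j : PowerSeries Sec) + 2) * (PowerSeries.C (pushCoeff (-N) (j + 1)) *
        PowerSeries.X ^ (N - j) * (g * gInv ^ j)) + PowerSeries.C (pushCoeff (-N) 0) *
        PowerSeries.X ^ (N + 1) * g ^ 2 =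
      ∑ j ∈ Finset.range (N + 1), ((j : PowerSeries Sec) + 1) *
        (PowerSeries.C (pushCoeff (-N) j) * PowerSeries.X ^ (N - j) * (g * gInv ^ j)) *
          (PowerSeries.X * g) := by
    set U : ℕ → PowerSeries Sec := fun j => ((j : PowerSeries Sec) + 1) *
      (PowerSeries.C (pushCoeff (-N) j) * PowerSeries.X ^ (N + 1 - j) * (g ^ 2 * gInv ^ j)) with hU
    have h2 := Finset.sum_range_succ U (N + 1)
    rw [Finset.sum_range_succ'] at h2
    -- The top term vanishes since `u_j = 0` for `j > N`, so the shift only leaves a boundary term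
    -- at `j = 0`.
    have h3 : U (N + 1) = 0 := by
      simp only [hU]
      rw [pushCoeff_neg_of_lt (Nat.lt_succ_self N), map_zero]; ring
    rw [h3, add_zero] at h2
    refine Eq.trans (congrArg₂ (· + ·) (Finset.sum_congr rfl fun j _ => ?_) ?_)
      (h2.trans (Finset.sum_congr rfl fun j hj => ?_))
    · simp only [hU]
      rw [Nat.add_sub_add_right]
      push_cast
      linear_combination (-((j : PowerSeries Sec) + 2) * PowerSeries.C (pushCoeff (-N) (j + 1)) *
        PowerSeries.X ^ (N - j) * g * gInv ^ j) * g_mul_gInv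
    · simp only [hU]
      simp [mul_assoc]
    · simp only [hU]
      have hjN : j ≤ N := Nat.lt_succ_iff.1 (Finset.mem_range.1 hj)
      rw [Nat.succ_sub hjN, pow_succ]
      ring
  have h4 : seriesDer lhat1 g = g * (-(PowerSeries.X * g)) := by rw [seriesDer_lhat1_g]; ring
  have hff : seriesDer lhat1 f' = (-2 * (PowerSeries.X * g)) * f' := seriesDer_lhat1_f'
  have hcomm : seriesDer lhat1 (seriesDer (lieDer (-N)) g) =
      seriesDer (lieDer (-N)) (seriesDer lhat1 g)
        + PowerSeries.C (pushCoeff (-N) 0) * seriesDer lhat1 g := by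
    -- Multiplying by `z^N` brings in the explicit series `fieldSeries N`.
    refine mul_left_cancel₀ (pow_ne_zero N PowerSeries.X_ne_zero) ?_
    rw [X_pow_mul_seriesDer_seriesDer_lieDer_g, seriesDer_fieldSeries lhat1 h4 hff, Finset.sum_add_distrib]
    have h5 : PowerSeries.X ^ N * seriesDer (lieDer (-N)) (seriesDer lhat1 g) =
        -2 * (PowerSeries.X * g) * fieldSeries N := by
      rw [← hX, seriesDer_lhat1_g, map_neg, seriesDer_mul, seriesDer_X, pow_two, seriesDer_mul]
      ring
    have h6 : ∑ j ∈ Finset.range (N + 1), PowerSeries.C (lhat1 (pushCoeff (-N) j)) *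
        PowerSeries.X ^ (N - j) * (g * gInv ^ j) = -∑ j ∈ Finset.range (N + 1),
        ((j : PowerSeries Sec) + 2) * (PowerSeries.C (pushCoeff (-N) (j + 1)) *
          PowerSeries.X ^ (N - j) * (g * gInv ^ j)) := by
      rw [← Finset.sum_neg_distrib]
      refine Finset.sum_congr rfl fun j _ => ?_
      rw [lhat1_pushCoeff, map_neg, map_mul, map_add, map_natCast, map_ofNat]
      ring
    have h7 : ∑ j ∈ Finset.range (N + 1), (1 - (j : PowerSeries Sec)) * (-(PowerSeries.X * g)) *
        (PowerSeries.C (pushCoeff (-N) j) * PowerSeries.X ^ (N - j) * (g * gInv ^ j)) =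
        ∑ j ∈ Finset.range (N + 1), ((j : PowerSeries Sec) + 1) *
        (PowerSeries.C (pushCoeff (-N) j) * PowerSeries.X ^ (N - j) * (g * gInv ^ j)) *
          (PowerSeries.X * g) - 2 * (PowerSeries.X * g) * ∑ j ∈ Finset.range (N + 1),
        PowerSeries.C (pushCoeff (-N) j) * PowerSeries.X ^ (N - j) * (g * gInv ^ j) := by
      rw [Finset.mul_sum, ← Finset.sum_sub_distrib]
      exact Finset.sum_congr rfl fun j _ => by ring
    rw [h6, h7, ← hsum, mul_add, h5, seriesDer_lhat1_g, fieldSeries]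
    ring
  have hder : ⁅lhat1, lieDer (-N)⁆ = pushCoeff (-N) 0 • lhat1 := by
    refine derivation_ext_of_seriesDer ?_
    rw [seriesDer_commutator, seriesDer_smul, hcomm]
    ring
  have := DFunLike.congr_fun hder P
  rw [Derivation.commutator_apply, Derivation.smul_apply, smul_eq_mul] at this
  linear_combination this

/-- The same computation for `δf = f³`. The index now shifts by two, which leaves the two boundary
terms `2u₀ f³` and `3u₁ f²`; the latter is `-3u₁` times the variation of `f` under `L̂₁`. -/
theorem commutator_lhat2 (N : ℕ) (P : Sec) : lhat2 (lieDer (-N) P) =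
    lieDer (-N) (lhat2 P) + 2 * pushCoeff (-N) 0 * lhat2 P - 3 * pushCoeff (-N) 1 * lhat1 P := by
  have hX := X_pow_mul_seriesDer_lieDer_g N
  have hsum : ∑ j ∈ Finset.range (N + 1),
      ((j : PowerSeries Sec) + 4) * (PowerSeries.C (pushCoeff (-N) (j + 2)) *
        PowerSeries.X ^ (N - j) * (g * gInv ^ j)) + 3 * PowerSeries.C (pushCoeff (-N) 1) *
        PowerSeries.X ^ (N + 1) * g ^ 2 + 2 * PowerSeries.C (pushCoeff (-N) 0) *
        PowerSeries.X ^ (N + 2) * g ^ 3 =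
      ∑ j ∈ Finset.range (N + 1), ((j : PowerSeries Sec) + 2) *
        (PowerSeries.C (pushCoeff (-N) j) * PowerSeries.X ^ (N - j) * (g * gInv ^ j)) *
          (PowerSeries.X * g) ^ 2 := by
    set U : ℕ → PowerSeries Sec := fun j => ((j : PowerSeries Sec) + 2) *
      (PowerSeries.C (pushCoeff (-N) j) * PowerSeries.X ^ (N + 2 - j) * (g ^ 3 * gInv ^ j)) with hU
    have hU0 : ∀ j, N < j → U j = 0 := fun j hj => by
      simp only [hU]
      rw [pushCoeff_neg_of_lt hj, map_zero]; ring
    have h2 : ∑ j ∈ Finset.range (N + 1), U (j + 2) + U 1 + U 0 =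
        ∑ j ∈ Finset.range (N + 1), U j := by
      rw [← Finset.sum_range_succ' (fun j => U (j + 1)), ← Finset.sum_range_succ',
        Finset.sum_range_succ, Finset.sum_range_succ, hU0 _ (Nat.lt_succ_self N),
        hU0 _ (by omega), add_zero, add_zero]
    refine Eq.trans (congrArg₂ (· + ·) (congrArg₂ (· + ·)
      (Finset.sum_congr rfl fun j _ => ?_) ?_) ?_)
      (h2.trans (Finset.sum_congr rfl fun j hj => ?_))
    · simp only [hU]
      rw [Nat.add_sub_add_right]
      push_cast
      linear_combination (-((j : PowerSeries Sec) + 4) * PowerSeries.C (pushCoeff (-N) (j + 2)) *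
        PowerSeries.X ^ (N - j) * g * gInv ^ j * (g * gInv + 1)) * g_mul_gInv
    · simp only [hU]
      rw [show N + 2 - 1 = N + 1 from rfl]
      push_cast
      linear_combination (-3 * PowerSeries.C (pushCoeff (-N) 1) *
        PowerSeries.X ^ (N + 1) * g ^ 2) * g_mul_gInv
    · simp only [hU]
      simp [mul_assoc]
    · simp only [hU]
      have hjN : j ≤ N := Nat.lt_succ_iff.1 (Finset.mem_range.1 hj)
      rw [show N + 2 - j = N - j + 2 by omega, pow_add]
      ring
  have h4 : seriesDer lhat2 g = g * (PowerSeries.X * g) ^ 2 := by rw [seriesDer_lhat2_g]; ring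
  have hff : seriesDer lhat2 f' = (3 * (PowerSeries.X * g) ^ 2) * f' := seriesDer_lhat2_f'
  have hcomm : seriesDer lhat2 (seriesDer (lieDer (-N)) g) =
      seriesDer (lieDer (-N)) (seriesDer lhat2 g)
        + (2 * PowerSeries.C (pushCoeff (-N) 0) * seriesDer lhat2 g
          - 3 * PowerSeries.C (pushCoeff (-N) 1) * seriesDer lhat1 g) := by
    refine mul_left_cancel₀ (pow_ne_zero N PowerSeries.X_ne_zero) ?_
    rw [X_pow_mul_seriesDer_seriesDer_lieDer_g, seriesDer_fieldSeries lhat2 h4 hff,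
      Finset.sum_add_distrib]
    have h5 : PowerSeries.X ^ N * seriesDer (lieDer (-N)) (seriesDer lhat2 g) =
        3 * (PowerSeries.X * g) ^ 2 * fieldSeries N := by
      rw [← hX, seriesDer_lhat2_g, seriesDer_mul, seriesDer_X_pow, pow_succ g 2, pow_two g,
        seriesDer_mul, seriesDer_mul]
      ring
    have h6 : ∑ j ∈ Finset.range (N + 1), PowerSeries.C (lhat2 (pushCoeff (-N) j)) *
        PowerSeries.X ^ (N - j) * (g * gInv ^ j) = ∑ j ∈ Finset.range (N + 1),
        ((j : PowerSeries Sec) + 4) * (PowerSeries.C (pushCoeff (-N) (j + 2)) *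
          PowerSeries.X ^ (N - j) * (g * gInv ^ j)) := by
      refine Finset.sum_congr rfl fun j _ => ?_
      rw [lhat2_pushCoeff, map_mul, map_add, map_natCast, map_ofNat]
      ring
    have h7 : ∑ j ∈ Finset.range (N + 1), (1 - (j : PowerSeries Sec)) * (PowerSeries.X * g) ^ 2 *
        (PowerSeries.C (pushCoeff (-N) j) * PowerSeries.X ^ (N - j) * (g * gInv ^ j)) =
        3 * (PowerSeries.X * g) ^ 2 * ∑ j ∈ Finset.range (N + 1),
        PowerSeries.C (pushCoeff (-N) j) * PowerSeries.X ^ (N - j) * (g * gInv ^ j) -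
        ∑ j ∈ Finset.range (N + 1), ((j : PowerSeries Sec) + 2) *
        (PowerSeries.C (pushCoeff (-N) j) * PowerSeries.X ^ (N - j) * (g * gInv ^ j)) *
          (PowerSeries.X * g) ^ 2 := by
      rw [Finset.mul_sum, ← Finset.sum_sub_distrib]
      exact Finset.sum_congr rfl fun j _ => by ring
    rw [h6, h7, ← hsum, mul_add, h5, seriesDer_lhat2_g, seriesDer_lhat1_g, fieldSeries]
    ring
  have hder : ⁅lhat2, lieDer (-N)⁆ =
      (2 * pushCoeff (-N) 0) • lhat2 + (-3 * pushCoeff (-N) 1) • lhat1 := by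
    refine derivation_ext_of_seriesDer ?_
    rw [seriesDer_commutator, seriesDer_add, seriesDer_smul, seriesDer_smul, hcomm, map_mul,
      map_mul, map_neg, map_ofNat, map_ofNat]
    ring
  have := DFunLike.congr_fun hder P
  rw [Derivation.commutator_apply, Derivation.add_apply, Derivation.smul_apply,
    Derivation.smul_apply, smul_eq_mul, smul_eq_mul] at this
  linear_combination this

/-! ### The intertwining identity and harmonicity. -/

theorem multiplier_eq (c h : ℂ) (n : ℤ) : multiplier c h n =
    MvPolynomial.C h * pushCoeff n 0 + MvPolynomial.C (c / 12) * zcoeff (-n - 2) schwarzian := by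
  rw [multiplier, MvPolynomial.smul_eq_C_mul, MvPolynomial.smul_eq_C_mul, pushCoeff, mul_pow,
    pow_zero, mul_one, Nat.cast_zero, sub_zero]

theorem derivation_C_mul (D : Derivation ℂ Sec Sec) (a : ℂ) (P : Sec) :
    D (MvPolynomial.C a * P) = MvPolynomial.C a * D P := by
  rw [← MvPolynomial.smul_eq_C_mul, D.map_smul, MvPolynomial.smul_eq_C_mul]

theorem lhat1_multiplier (c h : ℂ) (n : ℤ) :
    lhat1 (multiplier c h n) = -(2 * MvPolynomial.C h * pushCoeff n 1) := by
  rw [multiplier_eq, map_add, derivation_C_mul, derivation_C_mul, lhat1_pushCoeff,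
    ← zcoeff_seriesDer, seriesDer_lhat1_schwarzian]
  simp [zcoeff]
  ring

theorem lhat2_multiplier (c h : ℂ) (n : ℤ) : lhat2 (multiplier c h n) =
    (4 * MvPolynomial.C h + 6 * MvPolynomial.C (c / 12)) * pushCoeff n 2 := by
  have h1 : gInv ^ 2 * g ^ 2 = 1 := by rw [← mul_pow, mul_comm gInv, g_mul_gInv, one_pow]
  have h2 : zcoeff (-n - 2) (6 * f' ^ 2) = 6 * pushCoeff n 2 := by
    rw [pushCoeff, mul_assoc, h1, mul_one, ← zcoeff_C_mul, map_ofNat]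
    rfl
  rw [multiplier_eq, map_add, derivation_C_mul, derivation_C_mul, lhat2_pushCoeff,
    ← zcoeff_seriesDer, seriesDer_lhat2_schwarzian, h2, zero_add]
  push_cast
  ring

theorem liftedGenerator_eq (κ : ℝ) (σ : Sec) : liftedGenerator κ σ =
    MvPolynomial.C ((κ : ℂ) / 2) * lhat1 (lhat1 σ) - 2 * lhat2 σ := by
  rw [liftedGenerator_apply, MvPolynomial.smul_eq_C_mul, MvPolynomial.smul_eq_C_mul,
    map_ofNat MvPolynomial.C 2]

theorem derivation_mul' (D : Derivation ℂ Sec Sec) (P Q : Sec) : D (P * Q) = P * D Q + Q * D P := by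
  rw [Derivation.leibniz, smul_eq_mul, smul_eq_mul]

/-- Collect the commutators and the variations of the multiplier. The `u₁ L̂₁` terms are `6` from
`-2L̂₂` and `-κ(1 + 2h)` from `(κ/2) L̂₁²`. The `u₂` terms are `3κh` from differentiating `-2h u₁`
once more, and `-8h - c` from `-2L̂₂` acting on the multiplier. -/
theorem liftedGenerator_L (κ : ℝ) (c h : ℂ) (N : ℕ) (σ : Sec) :
    liftedGenerator κ (L c h (-N) σ) = L c h (-N) (liftedGenerator κ σ)
      + 2 * pushCoeff (-N) 0 * liftedGenerator κ σ
      + MvPolynomial.C (6 - κ * (2 * h + 1)) * pushCoeff (-N) 1 * lhat1 σ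
      + MvPolynomial.C (3 * κ * h - 8 * h - c) * pushCoeff (-N) 2 * σ := by
  have e0 : ∀ P, L c h (-N) P = lieDer (-N) P + multiplier c h (-N) * P := fun _ => rfl
  have e1 : (MvPolynomial.C (κ / 2 : ℂ) : Sec) * 2 = MvPolynomial.C (κ : ℂ) := by
    rw [← map_ofNat MvPolynomial.C 2, ← map_mul]; congr 1; ring
  have e2 : (MvPolynomial.C (c / 12 : ℂ) : Sec) * 12 = MvPolynomial.C c := by
    rw [← map_ofNat MvPolynomial.C 12, ← map_mul]; congr 1; ring
  have e3 : lhat1 (2 * MvPolynomial.C h * pushCoeff (-N) 1) =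
      -(6 * MvPolynomial.C h * pushCoeff (-N) 2) := by
    rw [mul_assoc, ← map_ofNat MvPolynomial.C 2, derivation_C_mul, derivation_C_mul,
      lhat1_pushCoeff, map_ofNat]
    push_cast; ring
  have e4 : lhat1 (pushCoeff (-N) 0) = -(2 * pushCoeff (-N) 1) := by
    rw [lhat1_pushCoeff]; push_cast; ring
  have e5 : lhat1 (L c h (-N) σ) = lieDer (-N) (lhat1 σ) + pushCoeff (-N) 0 * lhat1 σ +
      (multiplier c h (-N) * lhat1 σ - 2 * MvPolynomial.C h * pushCoeff (-N) 1 * σ) := by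
    rw [e0, map_add, commutator_lhat1, derivation_mul', lhat1_multiplier]
    ring
  rw [liftedGenerator_eq, liftedGenerator_eq, e5, e0, map_add, map_add, map_sub, commutator_lhat1,
    derivation_mul', e4, derivation_mul', lhat1_multiplier, derivation_mul', e3, map_add lhat2,
    commutator_lhat2, derivation_mul', lhat2_multiplier, e0, map_sub (lieDer (-N)),
    derivation_C_mul]
  have e6 : lieDer (-N) (2 * lhat2 σ) = 2 * lieDer (-N) (lhat2 σ) := by
    rw [← map_ofNat MvPolynomial.C 2, derivation_C_mul]
  rw [e6]
  simp only [map_sub, map_mul, map_add, map_ofNat, map_one]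
  rw [← e1, ← e2]
  ring

theorem lhat1_X (k : ℕ+) : lhat1 (MvPolynomial.X k) = -zcoeff ((k : ℤ) - 1) (g ^ 2) := by
  have h := congrArg (coeff (k : ℕ)) seriesDer_lhat1_g
  rw [coeff_seriesDer, coeff_g, coord_pnat, map_neg, ← zcoeff_natCast, ← pow_one PowerSeries.X,
    zcoeff_X_pow_mul] at h
  exact_mod_cast h

theorem lhat2_X (k : ℕ+) : lhat2 (MvPolynomial.X k) = zcoeff ((k : ℤ) - 2) (g ^ 3) := by
  have h := congrArg (coeff (k : ℕ)) seriesDer_lhat2_g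
  rw [coeff_seriesDer, coeff_g, coord_pnat, ← zcoeff_natCast, zcoeff_X_pow_mul] at h
  exact_mod_cast h

theorem lhat1_X_one : lhat1 (MvPolynomial.X 1) = -1 := by
  rw [lhat1_X]
  simp [zcoeff]

theorem lhat1_X_two : lhat1 (MvPolynomial.X 2) = -(2 * MvPolynomial.X 1) := by
  rw [lhat1_X]
  have : (((2 : ℕ+) : ℕ) : ℤ) - 1 = (1 : ℕ) := by norm_num
  rw [this, zcoeff_natCast, pow_two, coeff_mul]
  simp [Finset.Nat.antidiagonal_succ, coeff_g, coord_one]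
  ring

theorem lhat2_X_one : lhat2 (MvPolynomial.X 1) = 0 := by
  rw [lhat2_X]
  simp [zcoeff]

theorem lhat2_X_two : lhat2 (MvPolynomial.X 2) = 1 := by
  rw [lhat2_X]
  simp [zcoeff]

theorem liftedGenerator_X_two (κ : ℝ) :
    liftedGenerator κ (MvPolynomial.X 2) = MvPolynomial.C ((κ : ℂ) - 2) := by
  have h1 : (MvPolynomial.C (κ / 2 : ℂ) : Sec) * 2 = MvPolynomial.C (κ : ℂ) := by
    rw [← map_ofNat MvPolynomial.C 2, ← map_mul]; congr 1; ring
  have h2 : lhat1 (2 * MvPolynomial.X 1) = -2 := by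
    rw [← map_ofNat MvPolynomial.C 2, derivation_C_mul, lhat1_X_one, map_ofNat]; ring
  rw [liftedGenerator_eq, lhat1_X_two, lhat2_X_two, map_neg, h2, map_sub, map_ofNat]
  linear_combination h1

theorem liftedGenerator_X_one_sq (κ : ℝ) :
    liftedGenerator κ (MvPolynomial.X 1 * MvPolynomial.X 1) = MvPolynomial.C (κ : ℂ) := by
  have h : lhat1 (MvPolynomial.X 1 * MvPolynomial.X 1) =
      MvPolynomial.C (-2) * MvPolynomial.X 1 := by
    rw [derivation_mul', lhat1_X_one, map_neg, map_ofNat]; ring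
  rw [liftedGenerator_eq, h, derivation_C_mul, lhat1_X_one, derivation_mul', lhat2_X_one,
    mul_zero, add_zero, mul_zero, sub_zero, mul_neg, mul_one, ← map_neg, ← map_mul]
  congr 1; ring

theorem polyModule_zero_zero_le_ker (κ : ℝ) :
    polyModule 0 0 ≤ LinearMap.ker (liftedGenerator κ) := by
  have hle : polyModule 0 0 ≤ Submodule.span ℂ {(1 : Sec)} := by
    refine generated_le (Submodule.mem_span_singleton_self 1) fun n _ x hx => ?_
    obtain ⟨a, rfl⟩ := Submodule.mem_span_singleton.1 hx
    rw [map_smul, L_apply, vectorField_one, multiplier]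
    simp
  refine hle.trans ((Submodule.span_singleton_le_iff_mem _ _).2 ?_)
  rw [LinearMap.mem_ker, liftedGenerator_eq]
  simp

theorem polyModule_crit_le_ker {κ : ℝ} {c h : ℂ} (e1 : κ * (2 * h + 1) = 6)
    (e2 : 3 * κ * h = 8 * h + c) : polyModule c h ≤ LinearMap.ker (liftedGenerator κ) := by
  refine generated_le ?_ fun n hn σ hσ => ?_
  · rw [LinearMap.mem_ker, liftedGenerator_eq]
    simp
  · obtain ⟨N, rfl⟩ : ∃ N : ℕ, n = -(N : ℤ) := ⟨(-n).toNat, by omega⟩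
    rw [LinearMap.mem_ker] at hσ ⊢
    have e3 : (6 - κ * (2 * h + 1) : ℂ) = 0 := by linear_combination -e1
    have e4 : (3 * κ * h - 8 * h - c : ℂ) = 0 := by linear_combination e2
    rw [liftedGenerator_L, hσ, e3, e4]
    simp

/-- Sufficiency is stability of the kernel, or, for `(0, 0)`, the fact that all multipliers vanish.
For necessity the two sections `L_{-1}² 1` and `L_{-2} 1` suffice: the generator sends degree two to
constants, and these constants give the equations of the curve up to a factor `h`. -/
theorem harmonic_iff {κ : ℝ} (hκ : 0 < κ) (c h : ℂ) :
    (∀ σ ∈ polyModule c h, liftedGenerator κ σ = 0) ↔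
      (c = critC κ ∧ h = critH κ) ∨ (c = 0 ∧ h = 0) := by
  have hκ' : (κ : ℂ) ≠ 0 := by exact_mod_cast hκ.ne'
  constructor
  · intro hA
    have m0 : (1 : Sec) ∈ polyModule c h := mem_generated_self _ _
    have m1 := mem_generated_of_mem (n := -1) (by norm_num) m0
    have a1 := hA _ (mem_generated_of_mem (n := -1) (by norm_num) m1)
    have a2 := hA _ (mem_generated_of_mem (n := -2) (by norm_num) m0)
    rw [L_neg_one_one, map_smul, L_neg_one_X_one, map_smul, map_add, map_smul, map_smul,
      liftedGenerator_X_two, liftedGenerator_X_one_sq] at a1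
    rw [L_neg_two_one, map_sub, map_smul, map_smul, liftedGenerator_X_two,
      liftedGenerator_X_one_sq] at a2
    have b1 := congrArg MvPolynomial.constantCoeff a1
    have b2 := congrArg MvPolynomial.constantCoeff a2
    simp only [MvPolynomial.smul_eq_C_mul, map_add, map_sub, map_mul, MvPolynomial.constantCoeff_C,
      map_zero] at b1 b2
    have b3 : h * (κ * (2 * h + 1) - 6) = 0 := by linear_combination b1 / 2
    rcases mul_eq_zero.1 b3 with rfl | b4
    · exact Or.inr ⟨by linear_combination -b2, rfl⟩
    · exact Or.inl ((eq_crit_iff hκ' c h).2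
        ⟨by linear_combination b4, by linear_combination b2⟩)
  · rintro (hc | ⟨rfl, rfl⟩) σ hσ
    · obtain ⟨e1, e2⟩ := (eq_crit_iff hκ' c h).1 hc
      exact polyModule_crit_le_ker e1 e2 hσ
    · exact polyModule_zero_zero_le_ker κ hσ

end

/-! ### Processes with bounded moments -/

section

open scoped ENNReal

/-- Continuous processes, indexed by the reals, all of whose moments are bounded on compact
intervals of nonnegative times. -/
structure MomentBounded {Ω : Type*} {mΩ : MeasurableSpace Ω} (P : Measure Ω) (X : ℝ → Ω → ℂ) :
    Prop where
  cont : ∀ ω, Continuous fun t => X t ω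
  meas : ∀ t, Measurable (X t)
  moment : ∀ (p : ℕ) (T : ℝ), ∃ C : ℝ≥0, ∀ t, 0 ≤ t → t ≤ T → ∫⁻ ω, ‖X t ω‖ₑ ^ p ∂P ≤ C

theorem ennreal_add_pow_le (a b : ℝ≥0∞) (p : ℕ) : (a + b) ^ p ≤ 2 ^ p * (a ^ p + b ^ p) := by
  have h : a + b ≤ 2 * max a b := by
    rw [two_mul]; exact add_le_add (le_max_left _ _) (le_max_right _ _)
  refine (pow_le_pow_left' h p).trans ?_
  rw [mul_pow]
  gcongr
  rcases max_cases a b with ⟨h, -⟩ | ⟨h, -⟩ <;> rw [h]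
  · exact le_self_add
  · exact le_add_self

theorem ennreal_mul_pow_le (a b : ℝ≥0∞) (p : ℕ) : (a * b) ^ p ≤ a ^ (2 * p) + b ^ (2 * p) := by
  have h : a * b ≤ max a b ^ 2 := by
    rw [pow_two]; exact mul_le_mul' (le_max_left _ _) (le_max_right _ _)
  refine (pow_le_pow_left' h p).trans ?_
  rw [← pow_mul]
  rcases max_cases a b with ⟨h, -⟩ | ⟨h, -⟩ <;> rw [h]
  · exact le_self_add
  · exact le_add_self

/-- Hölder's inequality for the exponents `1` and `n + 1` on a space of total mass `μ univ`. -/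
theorem lintegral_enorm_pow_le {α : Type*} {mα : MeasurableSpace α} {μ : Measure α} {f : α → ℂ}
    (hf : AEStronglyMeasurable f μ) (n : ℕ) :
    (∫⁻ x, ‖f x‖ₑ ∂μ) ^ (n + 1) ≤ (∫⁻ x, ‖f x‖ₑ ^ (n + 1) ∂μ) * μ Set.univ ^ n := by
  have hn : (0 : ℝ) < (n + 1 : ℕ) := by positivity
  have h := eLpNorm'_le_eLpNorm'_mul_rpow_measure_univ (p := 1) (q := (n + 1 : ℕ)) one_pos
    (by push_cast; linarith [n.cast_nonneg (α := ℝ)]) hf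
  have h2 := pow_le_pow_left' h (n + 1)
  simp only [eLpNorm'_eq_lintegral_enorm, ENNReal.rpow_one, div_one] at h2
  refine h2.trans (le_of_eq ?_)
  rw [mul_pow, ← ENNReal.rpow_natCast, ← ENNReal.rpow_mul, ← ENNReal.rpow_natCast (_ ^ _),
    ← ENNReal.rpow_mul, one_div, inv_mul_cancel₀ hn.ne', ENNReal.rpow_one]
  congr 1
  · simp_rw [ENNReal.rpow_natCast]
  · rw [← ENNReal.rpow_natCast]
    congr 1
    push_cast at hn ⊢
    field_simp
    ring

variable {Ω : Type*} {mΩ : MeasurableSpace Ω} {P : Measure Ω}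

namespace MomentBounded

variable {X Y : ℝ → Ω → ℂ}

theorem measurable_uncurry (hX : MomentBounded P X) : Measurable (Function.uncurry X) :=
  measurable_uncurry_of_continuous_of_measurable hX.cont hX.meas

theorem const [IsFiniteMeasure P] (a : ℂ) : MomentBounded P fun _ _ => a where
  cont _ := continuous_const
  meas _ := measurable_const
  moment p T := by
    refine ⟨(∫⁻ _, ‖a‖ₑ ^ p ∂P).toNNReal, fun t _ _ => ?_⟩
    rw [ENNReal.coe_toNNReal]
    exact (lintegral_const_lt_top (by simp)).ne

theorem add (hX : MomentBounded P X) (hY : MomentBounded P Y) :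
    MomentBounded P fun t ω => X t ω + Y t ω where
  cont ω := (hX.cont ω).add (hY.cont ω)
  meas t := (hX.meas t).add (hY.meas t)
  moment p T := by
    obtain ⟨C, hC⟩ := hX.moment p T
    obtain ⟨D, hD⟩ := hY.moment p T
    refine ⟨2 ^ p * (C + D), fun t h0 hT => ?_⟩
    calc ∫⁻ ω, ‖X t ω + Y t ω‖ₑ ^ p ∂P
        ≤ ∫⁻ ω, 2 ^ p * (‖X t ω‖ₑ ^ p + ‖Y t ω‖ₑ ^ p) ∂P := by
          refine lintegral_mono fun ω => ?_
          exact (pow_le_pow_left' (enorm_add_le _ _) p).trans (ennreal_add_pow_le _ _ p)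
      _ = 2 ^ p * (∫⁻ ω, ‖X t ω‖ₑ ^ p ∂P + ∫⁻ ω, ‖Y t ω‖ₑ ^ p ∂P) := by
          have := (hX.meas t).enorm.pow_const p
          have := (hY.meas t).enorm.pow_const p
          rw [lintegral_const_mul _ (by fun_prop), lintegral_add_left (by fun_prop)]
      _ ≤ _ := by
          push_cast
          gcongr
          · exact hC t h0 hT
          · exact hD t h0 hT

theorem mul (hX : MomentBounded P X) (hY : MomentBounded P Y) :
    MomentBounded P fun t ω => X t ω * Y t ω where
  cont ω := (hX.cont ω).mul (hY.cont ω)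
  meas t := (hX.meas t).mul (hY.meas t)
  moment p T := by
    obtain ⟨C, hC⟩ := hX.moment (2 * p) T
    obtain ⟨D, hD⟩ := hY.moment (2 * p) T
    refine ⟨C + D, fun t h0 hT => ?_⟩
    calc ∫⁻ ω, ‖X t ω * Y t ω‖ₑ ^ p ∂P
        ≤ ∫⁻ ω, (‖X t ω‖ₑ ^ (2 * p) + ‖Y t ω‖ₑ ^ (2 * p)) ∂P := by
          refine lintegral_mono fun ω => ?_
          rw [enorm_mul]
          exact ennreal_mul_pow_le _ _ p
      _ = ∫⁻ ω, ‖X t ω‖ₑ ^ (2 * p) ∂P + ∫⁻ ω, ‖Y t ω‖ₑ ^ (2 * p) ∂P :=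
          lintegral_add_left ((hX.meas t).enorm.pow_const _) _
      _ ≤ _ := by
          push_cast
          gcongr
          · exact hC t h0 hT
          · exact hD t h0 hT

theorem const_mul [IsFiniteMeasure P] (a : ℂ) (hX : MomentBounded P X) :
    MomentBounded P fun t ω => a * X t ω := (const a).mul hX

theorem sub [IsFiniteMeasure P] (hX : MomentBounded P X) (hY : MomentBounded P Y) :
    MomentBounded P fun t ω => X t ω - Y t ω := by
  simpa [sub_eq_add_neg] using hX.add (hY.const_mul (-1))

theorem pow [IsFiniteMeasure P] (hX : MomentBounded P X) (n : ℕ) :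
    MomentBounded P fun t ω => X t ω ^ n := by
  induction n with
  | zero => simpa using const 1
  | succ n ih => simpa [pow_succ] using ih.mul hX

/-- Random variables at a fixed time count as constant processes, so mixed products such as `V s * W
t` stay in the class. -/
theorem freeze (hX : MomentBounded P X) {s : ℝ} (hs : 0 ≤ s) : MomentBounded P fun _ => X s where
  cont _ := continuous_const
  meas _ := hX.meas s
  moment p T := by
    obtain ⟨C, hC⟩ := hX.moment p s
    exact ⟨C, fun _ _ _ => hC s hs le_rfl⟩

theorem congr_ae (hX : MomentBounded P X) (hc : ∀ ω, Continuous fun t => Y t ω)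
    (hm : ∀ t, Measurable (Y t)) (h : ∀ t, 0 ≤ t → Y t =ᵐ[P] X t) : MomentBounded P Y where
  cont := hc
  meas := hm
  moment p T := by
    obtain ⟨C, hC⟩ := hX.moment p T
    refine ⟨C, fun t h0 hT => (le_of_eq ?_).trans (hC t h0 hT)⟩
    refine lintegral_congr_ae ?_
    filter_upwards [h t h0] with ω hω
    rw [hω]

theorem eval [IsFiniteMeasure P] {ι : Type*} {X : ι → ℝ → Ω → ℂ} (hX : ∀ k, MomentBounded P (X k))
    (Q : MvPolynomial ι ℂ) :
    MomentBounded P fun t ω => MvPolynomial.eval (fun k => X k t ω) Q := by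
  induction Q using MvPolynomial.induction_on with
  | C a => simpa using const a
  | add p q hp hq => simpa using hp.add hq
  | mul_X p k hp => simpa using hp.mul (hX k)

/-- Moments of the primitive are bounded by Hölder in time, followed by Tonelli. -/
theorem integral [IsFiniteMeasure P] (hX : MomentBounded P X) :
    MomentBounded P fun t ω => ∫ r in (0 : ℝ)..t, X r ω where
  cont ω := intervalIntegral.continuous_primitive
    (fun a b => (hX.cont ω).intervalIntegrable a b) 0
  meas t := by
    have hm : StronglyMeasurable (Function.uncurry fun ω r => X r ω) :=
      (hX.measurable_uncurry.comp measurable_swap).stronglyMeasurable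
    simp only [intervalIntegral]
    exact ((hm.integral_prod_right (ν := volume.restrict _)).sub
      (hm.integral_prod_right (ν := volume.restrict _))).measurable
  moment p T := by
    rcases p with _ | n
    · refine ⟨(P Set.univ).toNNReal, fun t _ _ => ?_⟩
      rw [ENNReal.coe_toNNReal (measure_ne_top _ _)]
      simp
    obtain ⟨C, hC⟩ := hX.moment (n + 1) T
    refine ⟨C * (volume (Set.Ioc 0 T)).toNNReal * (volume (Set.Ioc 0 T)).toNNReal ^ n,
      fun t h0 hT => ?_⟩
    have hv : ((volume (Set.Ioc 0 T)).toNNReal : ℝ≥0∞) = volume (Set.Ioc 0 T) :=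
      ENNReal.coe_toNNReal measure_Ioc_lt_top.ne
    have hmeas : Measurable (Function.uncurry fun ω r => ‖X r ω‖ₑ ^ (n + 1)) :=
      (hX.measurable_uncurry.comp measurable_swap).enorm.pow_const _
    calc ∫⁻ ω, ‖∫ r in (0 : ℝ)..t, X r ω‖ₑ ^ (n + 1) ∂P
        ≤ ∫⁻ ω, (∫⁻ r in Set.Ioc 0 T, ‖X r ω‖ₑ ^ (n + 1)) * volume (Set.Ioc 0 T) ^ n ∂P := by
          refine lintegral_mono fun ω => ?_
          rw [intervalIntegral.integral_of_le h0]
          refine (pow_le_pow_left' ((enorm_integral_le_lintegral_enorm _).trans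
            (lintegral_mono_set (Set.Ioc_subset_Ioc_right hT))) _).trans ?_
          simpa using lintegral_enorm_pow_le (μ := volume.restrict (Set.Ioc 0 T))
            (hX.cont ω).aestronglyMeasurable n
      _ = (∫⁻ r in Set.Ioc 0 T, ∫⁻ ω, ‖X r ω‖ₑ ^ (n + 1) ∂P) * volume (Set.Ioc 0 T) ^ n := by
          have hm2 : Measurable fun ω => ∫⁻ r in Set.Ioc 0 T, ‖X r ω‖ₑ ^ (n + 1) :=
            hmeas.lintegral_prod_right'
          rw [lintegral_mul_const _ hm2,
            lintegral_lintegral_swap hmeas.aemeasurable]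
      _ ≤ (∫⁻ _ in Set.Ioc 0 T, C) * volume (Set.Ioc 0 T) ^ n := by
          refine mul_le_mul' (setLIntegral_mono measurable_const fun r hr => ?_) le_rfl
          exact hC r hr.1.le hr.2
      _ = _ := by
          rw [lintegral_const, Measure.restrict_apply_univ]
          push_cast
          rw [hv]

theorem integrable (hX : MomentBounded P X) {t : ℝ} (ht : 0 ≤ t) : Integrable (X t) P := by
  obtain ⟨C, hC⟩ := hX.moment 1 t
  refine ⟨(hX.meas t).aestronglyMeasurable, ?_⟩
  have := hC t ht le_rfl
  simp only [pow_one] at this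
  exact this.trans_lt ENNReal.coe_lt_top

theorem integral_intervalIntegral [IsFiniteMeasure P] (hX : MomentBounded P X) {s t : ℝ}
    (hs : 0 ≤ s) (hst : s ≤ t) :
    ∫ ω, (∫ r in s..t, X r ω) ∂P = ∫ r in s..t, (∫ ω, X r ω ∂P) := by
  refine (intervalIntegral_integral_swap ⟨hX.measurable_uncurry.aestronglyMeasurable, ?_⟩).symm
  obtain ⟨C, hC⟩ := hX.moment 1 t
  rw [Set.uIoc_of_le hst, HasFiniteIntegral, lintegral_prod _ hX.measurable_uncurry.enorm.aemeasurable]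
  calc ∫⁻ r in Set.Ioc s t, ∫⁻ ω, ‖X r ω‖ₑ ∂P ≤ ∫⁻ _ in Set.Ioc s t, C := by
        refine setLIntegral_mono measurable_const fun r hr => ?_
        simpa using hC r (hs.trans hr.1.le) hr.2
    _ < ⊤ := by
        rw [lintegral_const, Measure.restrict_apply_univ]
        exact ENNReal.mul_lt_top ENNReal.coe_lt_top measure_Ioc_lt_top

theorem of_moments {f : Ω → ℂ} (hf : Measurable f) (h : ∀ p : ℕ, ∫⁻ ω, ‖f ω‖ₑ ^ p ∂P < ⊤) :
    MomentBounded P fun _ => f where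
  cont _ := continuous_const
  meas _ := hf
  moment p _ := ⟨(∫⁻ ω, ‖f ω‖ₑ ^ p ∂P).toNNReal, fun _ _ _ => by
    rw [ENNReal.coe_toNNReal (h p).ne]⟩

end MomentBounded

end

/-! ### Gaussian increments -/

section

open scoped ENNReal

theorem lintegral_enorm_pow_gaussianReal_lt_top (v : ℝ≥0) (p : ℕ) :
    ∫⁻ y, ‖(y : ℂ)‖ₑ ^ p ∂(gaussianReal 0 v) < ⊤ := by
  rcases Nat.eq_zero_or_pos p with rfl | hp
  · simp
  have h := (MemLp.integrable_norm_pow (memLp_id_gaussianReal (μ := 0) (v := v) p) hp.ne').2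
  refine lt_of_le_of_lt (le_of_eq (lintegral_congr fun y => ?_)) h
  rw [enorm_pow, enorm_norm, id, ← ofReal_norm, ← ofReal_norm, Complex.norm_real]

theorem momentBounded_gaussianReal (v : ℝ≥0) :
    MomentBounded (gaussianReal 0 v) fun _ (y : ℝ) => (y : ℂ) :=
  MomentBounded.of_moments Complex.measurable_ofReal (lintegral_enorm_pow_gaussianReal_lt_top v)

theorem integrable_gaussianReal_iff {v : ℝ≥0} (hv : v ≠ 0) {f : ℝ → ℂ} :
    Integrable f (gaussianReal 0 v) ↔ Integrable fun y => gaussianPDFReal 0 v y • f y := by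
  rw [gaussianReal_of_var_ne_zero _ hv, integrable_withDensity_iff_integrable_smul'
    (measurable_gaussianPDF _ _) (Filter.Eventually.of_forall fun _ => gaussianPDF_lt_top)]
  simp only [toReal_gaussianPDF]

theorem hasDerivAt_gaussianPDFReal {v : ℝ≥0} (hv : v ≠ 0) (y : ℝ) :
    HasDerivAt (gaussianPDFReal 0 v) (-(y / v) * gaussianPDFReal 0 v y) y := by
  have hv' : (v : ℝ) ≠ 0 := by exact_mod_cast hv
  have h1 : HasDerivAt (fun y : ℝ => -(y - 0) ^ 2 / (2 * v)) (-(y / v)) y := by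
    have := (((hasDerivAt_id y).sub_const 0).pow 2).neg.div_const (2 * (v : ℝ))
    refine this.congr_deriv ?_
    simp
    field_simp
  have h2 := h1.exp.const_mul (√(2 * Real.pi * v))⁻¹
  rw [gaussianPDFReal_def]
  refine h2.congr_deriv ?_
  ring

/-- Gaussian integration by parts for powers of affine functions. -/
theorem integral_mul_affine_pow_gaussianReal (v : ℝ≥0) (x a : ℂ) (m : ℕ) :
    ∫ y : ℝ, y * (x + a * y) ^ m ∂(gaussianReal 0 v) =
      v * a * m * ∫ y : ℝ, (x + a * y) ^ (m - 1) ∂(gaussianReal 0 v) := by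
  rcases eq_or_ne v 0 with rfl | hv
  · simp [gaussianReal_zero_var]
  have hv' : (v : ℂ) ≠ 0 := by exact_mod_cast hv
  have hid := momentBounded_gaussianReal v
  have haff : ∀ m, MomentBounded (gaussianReal 0 v) fun _ (y : ℝ) => (x + a * y) ^ m := fun m =>
    ((MomentBounded.const x).add (hid.const_mul a)).pow m
  have i1 := (integrable_gaussianReal_iff hv).1 ((haff m).integrable le_rfl)
  have i2 := (integrable_gaussianReal_iff hv).1 ((hid.mul (haff m)).integrable le_rfl)
  have i3 := (integrable_gaussianReal_iff hv).1 ((haff (m - 1)).integrable le_rfl)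
  have hder : ∀ y : ℝ, HasDerivAt (fun y : ℝ => gaussianPDFReal 0 v y • (x + a * (y : ℂ)) ^ m)
      (a * m * (gaussianPDFReal 0 v y • (x + a * (y : ℂ)) ^ (m - 1))
        - (v : ℂ)⁻¹ * (gaussianPDFReal 0 v y • ((y : ℂ) * (x + a * (y : ℂ)) ^ m))) y := by
    intro y
    have h1 : HasDerivAt (fun y : ℝ => (x + a * (y : ℂ)) ^ m)
        (m * (x + a * (y : ℂ)) ^ (m - 1) * a) y := by
      have h2 : HasDerivAt (fun y : ℝ => x + a * (y : ℂ)) a y := by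
        simpa using ((Complex.ofRealCLM.hasDerivAt (x := y)).const_mul a).const_add x
      exact h2.pow m
    refine ((hasDerivAt_gaussianPDFReal hv y).smul h1).congr_deriv ?_
    simp only [Complex.real_smul]
    push_cast
    field_simp
    ring
  -- The density times the power has an integrable derivative, and the integral of that derivative
  -- is zero.
  have h0 := integral_eq_zero_of_hasDerivAt_of_integrable hder
    ((i3.const_mul _).sub (i2.const_mul _)) i1
  rw [integral_sub (i3.const_mul _) (i2.const_mul _), integral_const_mul, integral_const_mul] at h0
  rw [integral_gaussianReal_eq_integral_smul hv, integral_gaussianReal_eq_integral_smul hv]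
  field_simp at h0
  linear_combination -h0

variable {Ω : Type*} {m' mΩ : MeasurableSpace Ω} {P : Measure Ω}

theorem integral_comp_of_indep [IsProbabilityMeasure P] (hm : m' ≤ mΩ)
    {U : Ω → ℂ × ℂ} {ξ : Ω → ℝ} {γ : Measure ℝ} [IsProbabilityMeasure γ] (hU : Measurable[m'] U)
    (hξ : HasLaw ξ γ P) (hind : Indep (MeasurableSpace.comap ξ inferInstance) m' P)
    {F : (ℂ × ℂ) × ℝ → ℂ} (hF : Measurable F) (hint : Integrable (fun ω => F (U ω, ξ ω)) P) :
    ∫ ω, F (U ω, ξ ω) ∂P = ∫ ω, ∫ y, F (U ω, y) ∂γ ∂P := by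
  have hU' : Measurable U := hU.mono hm le_rfl
  have hUξ : IndepFun U ξ P := by
    rw [IndepFun_iff_Indep]
    exact (indep_of_indep_of_le_right hind hU.comap_le).symm
  have hmap : P.map (fun ω => (U ω, ξ ω)) = (P.map U).prod γ := by
    rw [← hξ.map_eq]
    exact (indepFun_iff_map_prod_eq_prod_map_map hU'.aemeasurable hξ.aemeasurable).1 hUξ
  have hpair : AEMeasurable (fun ω => (U ω, ξ ω)) P := hU'.aemeasurable.prodMk hξ.aemeasurable
  have hprob : IsProbabilityMeasure (P.map U) := Measure.isProbabilityMeasure_map hU'.aemeasurable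
  have hint' : Integrable F ((P.map U).prod γ) := by
    rw [← hmap]
    exact (integrable_map_measure hF.aestronglyMeasurable hpair).2 hint
  rw [← integral_map (φ := fun ω => (U ω, ξ ω)) hpair hF.aestronglyMeasurable, hmap,
    integral_prod _ hint', integral_map hU'.aemeasurable hint'.integral_prod_left.aestronglyMeasurable]

/-- Gaussian integration by parts for an increment that is independent of the past. -/
theorem integral_mul_increment_mul_pow [IsProbabilityMeasure P]
    (hm : m' ≤ mΩ) {Z X : Ω → ℂ} {ξ : Ω → ℝ} {v : ℝ≥0} (hZ : Measurable[m'] Z)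
    (hX : Measurable[m'] X) (hξ : HasLaw ξ (gaussianReal 0 v) P)
    (hind : Indep (MeasurableSpace.comap ξ inferInstance) m' P) (a : ℂ) (m : ℕ)
    (h1 : Integrable (fun ω => Z ω * (ξ ω * (X ω + a * ξ ω) ^ m)) P)
    (h2 : Integrable (fun ω => Z ω * (X ω + a * ξ ω) ^ (m - 1)) P) :
    ∫ ω, Z ω * (ξ ω * (X ω + a * ξ ω) ^ m) ∂P =
      v * a * m * ∫ ω, Z ω * (X ω + a * ξ ω) ^ (m - 1) ∂P := by
  have hU : Measurable[m'] fun ω => (Z ω, X ω) := hZ.prodMk hX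
  have e1 := integral_comp_of_indep hm hU hξ hind
    (F := fun u => u.1.1 * (u.2 * (u.1.2 + a * u.2) ^ m)) (by fun_prop) h1
  have e2 := integral_comp_of_indep hm hU hξ hind
    (F := fun u => u.1.1 * (u.1.2 + a * u.2) ^ (m - 1)) (by fun_prop) h2
  simp only [integral_const_mul] at e1 e2
  rw [e1, e2, ← integral_const_mul]
  refine integral_congr_ae (Filter.Eventually.of_forall fun ω => ?_)
  simp only
  rw [integral_mul_affine_pow_gaussianReal]
  ring

/-- The heat equation for moments, `d/dt E[Z W_t^m] = (κ/2) m (m-1) E[Z W_t^{m-2}]`, follows by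
strong induction on `m`. The extra index `j` counts factors `W_r`, which the recursion creates. -/
theorem hasDerivWithinAt_of_moment_recursion {w : ℕ → ℕ → ℝ → ℂ} {κ : ℂ} {r : ℝ}
    (h0 : ∀ j t, r ≤ t → w j 0 t = w j 0 r)
    (hrec : ∀ j m t, r ≤ t → w j (m + 1) t = w (j + 1) m t + m * (κ * (t - r) * w j (m - 1) t))
    (m : ℕ) : ∀ j t, r ≤ t →
      HasDerivWithinAt (w j m) (κ / 2 * (m * (m - 1)) * w j (m - 2) t) (Set.Ici r) t := by
  induction m using Nat.strong_induction_on with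
  | _ m ih =>
    intro j t ht
    rcases m with _ | m
    · have h1 := hasDerivWithinAt_const t (Set.Ici r) (w j 0 r)
      refine (h1.congr (fun q hq => h0 j q hq) (h0 j t ht)).congr_deriv ?_
      simp
    · have hm := ih m (Nat.lt_succ_self m) (j + 1) t ht
      have hlin : HasDerivWithinAt (fun t : ℝ => κ * ((t : ℂ) - r)) κ (Set.Ici r) t := by
        have := ((Complex.ofRealCLM.hasDerivAt (x := t)).sub_const (r : ℂ)).const_mul κ
        simpa using this.hasDerivWithinAt
      have hm1 := ih (m - 1) (by omega) j t ht
      have h1 := hm.add ((hlin.mul hm1).const_mul (m : ℂ))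
      refine (h1.congr (fun q hq => hrec j m q hq) (hrec j m t ht)).congr_deriv ?_
      -- For small `m` the exponents are truncated, but their coefficients vanish. In the general
      -- case one more use of the recursion recombines two of the terms.
      rcases m with _ | _ | m
      · simp
      · have : κ = κ / 2 * (2 * (2 - 1)) := by ring
        simp [one_add_one_eq_two, ← this]
      · have h2 := hrec j m t ht
        simp only [show m + 1 + 1 - 1 = m + 1 by omega, show m + 1 + 1 - 2 = m by omega,
          show m + 1 + 1 + 1 - 2 = m + 1 by omega, show m + 1 - 2 = m - 1 by omega]
        rw [h2]
        push_cast
        ring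

theorem integral_of_moment_recursion {w : ℕ → ℕ → ℝ → ℂ} {κ : ℂ} {r : ℝ}
    (h0 : ∀ j t, r ≤ t → w j 0 t = w j 0 r)
    (hrec : ∀ j m t, r ≤ t → w j (m + 1) t = w (j + 1) m t + m * (κ * (t - r) * w j (m - 1) t))
    (j m : ℕ) {t : ℝ} (ht : r ≤ t) :
    ∫ q in r..t, κ / 2 * (m * (m - 1)) * w j (m - 2) q = w j m t - w j m r := by
  have hd := hasDerivWithinAt_of_moment_recursion h0 hrec
  have hc : ∀ m, ContinuousOn (w j m) (Set.Ici r) := fun m t ht => (hd m j t ht).continuousWithinAt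
  refine intervalIntegral.integral_eq_sub_of_hasDeriv_right_of_le ht
    ((hc m).mono Set.Icc_subset_Ici_self) (fun x hx => ?_) ?_
  · exact (hd m j x hx.1.le).mono (Set.Ioi_subset_Ici hx.1.le)
  · refine ContinuousOn.intervalIntegrable ?_
    rw [Set.uIcc_of_le ht]
    exact (continuousOn_const.mul ((hc (m - 2)).mono Set.Icc_subset_Ici_self))

end

/-! ### Dynkin's formula for powers of a Gaussian process -/

section

open scoped ENNReal

variable {Ω : Type*} {mΩ : MeasurableSpace Ω} {P : Measure Ω}

/-- The moment recursion at time `r`, tested against the random variable `Z`, of a process whose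
increments after time `r` are centred Gaussian of variance `κ (t - r)` and independent of `Z`. -/
def MomentRecursion (P : Measure Ω) (W : ℝ → Ω → ℂ) (κ : ℂ) (r : ℝ) (Z : Ω → ℂ) : Prop :=
  ∀ (j m : ℕ) (t : ℝ), r ≤ t → ∫ ω, Z ω * W r ω ^ j * W t ω ^ (m + 1) ∂P =
    ∫ ω, Z ω * W r ω ^ (j + 1) * W t ω ^ m ∂P +
      m * (κ * (t - r) * ∫ ω, Z ω * W r ω ^ j * W t ω ^ (m - 1) ∂P)

theorem MomentRecursion.integral_mul_pow [IsFiniteMeasure P] {W : ℝ → Ω → ℂ} {κ : ℂ} {r t : ℝ}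
    {Z : Ω → ℂ} (h : MomentRecursion P W κ r Z) (hW : MomentBounded P W)
    (hZ : MomentBounded P fun _ => Z) (hr : 0 ≤ r) (hrt : r ≤ t) (m : ℕ) :
    ∫ ω, Z ω * W t ω ^ m ∂P = ∫ ω, Z ω * W r ω ^ m ∂P +
      ∫ ω, Z ω * (∫ q in r..t, κ / 2 * (m * (m - 1)) * W q ω ^ (m - 2)) ∂P := by
  have h1 := integral_of_moment_recursion
    (w := fun j m t => ∫ ω, Z ω * W r ω ^ j * W t ω ^ m ∂P) (κ := κ) (r := r)
    (fun j t _ => by simp) h 0 m hrt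
  simp only [pow_zero, mul_one] at h1
  have h2 := ((hZ.mul (hW.pow (m - 2))).const_mul
    (κ / 2 * (m * (m - 1)))).integral_intervalIntegral hr hrt
  simp only [integral_const_mul] at h2
  rw [← h2] at h1
  rw [← sub_eq_iff_eq_add', ← h1]
  refine integral_congr_ae (Filter.Eventually.of_forall fun ω => ?_)
  simp only
  rw [← intervalIntegral.integral_const_mul]
  congr 1
  ext1 q
  ring

theorem MomentBounded.integrable_intervalIntegral [IsFiniteMeasure P] {X : ℝ → Ω → ℂ}
    (hX : MomentBounded P X) {s t : ℝ} (hs : 0 ≤ s) (ht : 0 ≤ t) :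
    Integrable (fun ω => ∫ r in s..t, X r ω) P := by
  have e : (fun ω => ∫ r in s..t, X r ω) =
      fun ω => (∫ r in (0 : ℝ)..t, X r ω) - ∫ r in (0 : ℝ)..s, X r ω := by
    ext1 ω
    exact (intervalIntegral.integral_interval_sub_left ((hX.cont ω).intervalIntegrable _ _)
      ((hX.cont ω).intervalIntegrable _ _)).symm
  rw [e]
  exact (hX.integral.integrable ht).sub (hX.integral.integrable hs)

/-- Dynkin's formula for the product of a power of a Gaussian process and a process of class
`C¹`. -/
theorem dynkin_pow_mul [IsFiniteMeasure P] {W V V' : ℝ → Ω → ℂ} {κ : ℂ} {s t : ℝ} (hs : 0 ≤ s)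
    (hst : s ≤ t) (hW : MomentBounded P W) (hV : MomentBounded P V) (hV' : MomentBounded P V')
    (hder : ∀ᵐ ω ∂P, ∀ r, s ≤ r → V r ω - V s ω = ∫ q in s..r, V' q ω)
    (hrV : MomentRecursion P W κ s (V s)) (hrV' : ∀ r, s ≤ r → MomentRecursion P W κ r (V' r))
    (m : ℕ) : ∫ ω, (W t ω ^ m * V t ω - W s ω ^ m * V s ω) ∂P =
      ∫ ω, (∫ r in s..t, (W r ω ^ m * V' r ω
        + κ / 2 * (m * (m - 1)) * W r ω ^ (m - 2) * V r ω)) ∂P := by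
  have ht : 0 ≤ t := hs.trans hst
  -- Tested against past variables, `W^m - J` behaves as a martingale, with `J` the primitive of
  -- `I`.
  set I : ℝ → Ω → ℂ := fun r ω => κ / 2 * (m * (m - 1)) * W r ω ^ (m - 2) with hI
  set J : ℝ → Ω → ℂ := fun r ω => ∫ q in (0 : ℝ)..r, I q ω with hJ
  have hIb : MomentBounded P I := (hW.pow (m - 2)).const_mul _
  have hJb : MomentBounded P J := hIb.integral
  have hIi : ∀ ω a b, IntervalIntegrable (fun q => I q ω) volume a b := fun ω a b =>
    (hIb.cont ω).intervalIntegrable a b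
  have hJsub : ∀ ω a b, ∫ q in a..b, I q ω = J b ω - J a ω := fun ω a b =>
    (intervalIntegral.integral_interval_sub_left (hIi ω _ _) (hIi ω _ _)).symm
  have hA1 : ∫ ω, V s ω * W t ω ^ m ∂P = ∫ ω, V s ω * W s ω ^ m ∂P +
      ∫ ω, V s ω * (J t ω - J s ω) ∂P := by
    rw [hrV.integral_mul_pow hW (hV.freeze hs) hs hst m]
    simp only [← hJsub]
    rfl
  have hA2 : ∀ r, s ≤ r → r ≤ t → ∫ ω, V' r ω * W t ω ^ m ∂P =
      ∫ ω, (V' r ω * W r ω ^ m + V' r ω * (J t ω - J r ω)) ∂P := by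
    intro r hsr hrt
    have hr : 0 ≤ r := hs.trans hsr
    rw [(hrV' r hsr).integral_mul_pow hW (hV'.freeze hr) hr hrt m,
      integral_add ((hV'.mul (hW.pow m)).integrable hr)
        (((hV'.freeze hr).mul ((hJb.freeze ht).sub (hJb.freeze hr))).integrable hr)]
    simp only [← hJsub]
    rfl
  have hG : MomentBounded P fun r ω => V' r ω * W r ω ^ m + V' r ω * (J t ω - J r ω) :=
    (hV'.mul (hW.pow m)).add (hV'.mul ((hJb.freeze ht).sub hJb))
  -- Write `V t - V s` as the integral of `V'`; for each `r`, the power at time `t` is then replaced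
  -- by the one at time `r` plus `J t - J r`.
  have hA3 : ∫ ω, W t ω ^ m * (V t ω - V s ω) ∂P =
      ∫ ω, (∫ r in s..t, (V' r ω * W r ω ^ m + V' r ω * (J t ω - J r ω))) ∂P := by
    have e1 : ∫ ω, W t ω ^ m * (V t ω - V s ω) ∂P =
        ∫ ω, (∫ r in s..t, V' r ω * W t ω ^ m) ∂P := by
      refine integral_congr_ae ?_
      filter_upwards [hder] with ω hω
      rw [hω t hst, intervalIntegral.integral_mul_const, mul_comm]
    rw [e1, (hV'.mul ((hW.pow m).freeze ht)).integral_intervalIntegral hs hst,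
      hG.integral_intervalIntegral hs hst]
    refine intervalIntegral.integral_congr fun r hr => ?_
    rw [Set.uIcc_of_le hst] at hr
    exact hA2 r hr.1 hr.2
  have hsplit : ∫ ω, (W t ω ^ m * V t ω - W s ω ^ m * V s ω) ∂P =
      ∫ ω, W t ω ^ m * (V t ω - V s ω) ∂P + (∫ ω, V s ω * W t ω ^ m ∂P -
        ∫ ω, V s ω * W s ω ^ m ∂P) := by
    have i1 := (((hW.pow m).freeze ht).mul ((hV.freeze ht).sub (hV.freeze hs))).integrable hs
    have i2 := ((hV.freeze hs).mul ((hW.pow m).freeze ht)).integrable hs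
    have i3 := ((hV.freeze hs).mul ((hW.pow m).freeze hs)).integrable hs
    have i4 : Integrable (fun ω => V s ω * W t ω ^ m - V s ω * W s ω ^ m) P := i2.sub i3
    rw [← integral_sub i2 i3, ← integral_add i1 i4]
    refine integral_congr_ae (Filter.Eventually.of_forall fun ω => ?_)
    simp only
    ring
  have hGi := hG.integrable_intervalIntegral hs ht
  have hsJ := ((hV.freeze hs).mul ((hJb.freeze ht).sub (hJb.freeze hs))).integrable hs
  rw [hsplit, hA3, hA1, add_sub_cancel_left, ← integral_add hGi hsJ]
  refine integral_congr_ae ?_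
  filter_upwards [hder] with ω hω
  have c1 : Continuous fun r => V' r ω := hV'.cont ω
  have c2 : Continuous fun r => W r ω ^ m := (hW.pow m).cont ω
  have c3 : Continuous fun r => J r ω := hJb.cont ω
  have c4 : Continuous fun r => I r ω := hIb.cont ω
  have c5 : Continuous fun r => V r ω := hV.cont ω
  -- Pathwise integration by parts turns `∫ V' (J t - J r)` into `∫ I V`; its boundary term cancels
  -- the contribution of `V s * (J t - J s)`.
  have hparts := intervalIntegral.integral_mul_deriv_eq_deriv_mul (a := s) (b := t)
    (u := fun r => V s ω + ∫ q in s..r, V' q ω) (v := fun r => J t ω - J r ω)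
    (u' := fun r => V' r ω) (v' := fun r => -I r ω)
    (fun r _ => (intervalIntegral.integral_hasDerivAt_right (c1.intervalIntegrable _ _)
      c1.stronglyMeasurable.stronglyMeasurableAtFilter c1.continuousAt).const_add _)
    (fun r _ => (intervalIntegral.integral_hasDerivAt_right (c4.intervalIntegrable _ _)
      c4.stronglyMeasurable.stronglyMeasurableAtFilter c4.continuousAt).const_sub _)
    (c1.intervalIntegrable _ _) (c4.neg.intervalIntegrable _ _)
  have hVI : ∫ r in s..t, (V s ω + ∫ q in s..r, V' q ω) * -I r ω =
      -∫ r in s..t, I r ω * V r ω := by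
    rw [← intervalIntegral.integral_neg]
    refine intervalIntegral.integral_congr fun r hr => ?_
    rw [Set.uIcc_of_le hst] at hr
    rw [← hω r hr.1]
    ring
  rw [hVI] at hparts
  simp only [sub_self, mul_zero, intervalIntegral.integral_same, add_zero, zero_sub] at hparts
  have k1 : IntervalIntegrable (fun r => V' r ω * W r ω ^ m) volume s t :=
    (c1.mul c2).intervalIntegrable _ _
  have k2 : IntervalIntegrable (fun r => V' r ω * (J t ω - J r ω)) volume s t :=
    (c1.mul (continuous_const.sub c3)).intervalIntegrable _ _
  have k3 : IntervalIntegrable (fun r => W r ω ^ m * V' r ω) volume s t :=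
    (c2.mul c1).intervalIntegrable _ _
  have k4 : IntervalIntegrable (fun r => κ / 2 * (m * (m - 1)) * W r ω ^ (m - 2) * V r ω)
      volume s t := (c4.mul c5).intervalIntegrable _ _
  rw [intervalIntegral.integral_add k1 k2, intervalIntegral.integral_add k3 k4]
  have e2 : ∫ r in s..t, V' r ω * W r ω ^ m = ∫ r in s..t, W r ω ^ m * V' r ω :=
    intervalIntegral.integral_congr fun r _ => mul_comm _ _
  rw [e2]
  linear_combination hparts

end

/-! ### The flow -/

section

variable {Ω : Type*} {m' mΩ : MeasurableSpace Ω} {P : Measure Ω}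

/-- Since `W t = W r + a ξ`, the difference `W_t^{m+1} - W_r W_t^m` is `a ξ W_t^m`, to which
Gaussian integration by parts applies. Measurability with respect to the past is only required of
the versions `Z'` and `X`. -/
theorem momentRecursion_of_increments [IsProbabilityMeasure P] (hm : m' ≤ mΩ) {W : ℝ → Ω → ℂ}
    {Z Z' X : Ω → ℂ} {ξ : ℝ → Ω → ℝ} {a : ℂ} {r : ℝ} (hr : 0 ≤ r) (hW : MomentBounded P W)
    (hZ : MomentBounded P fun _ => Z) (hZm : Measurable[m'] Z') (hXm : Measurable[m'] X)
    (hZZ : Z =ᵐ[P] Z') (hXW : W r =ᵐ[P] X)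
    (hξ : ∀ t, r ≤ t → HasLaw (ξ t) (gaussianReal 0 (t - r).toNNReal) P)
    (hind : ∀ t, r ≤ t → Indep (MeasurableSpace.comap (ξ t) inferInstance) m' P)
    (hWξ : ∀ t, r ≤ t → W t =ᵐ[P] fun ω => X ω + a * ξ t ω) :
    MomentRecursion P W (a ^ 2) r Z := by
  intro j m t hrt
  have ht : 0 ≤ t := hr.trans hrt
  have hZj : Measurable[m'] fun ω => Z' ω * X ω ^ j := hZm.mul (hXm.pow_const j)
  have hb : ∀ j m, Integrable (fun ω => Z ω * W r ω ^ j * W t ω ^ m) P := fun j m =>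
    ((hZ.mul ((hW.pow j).freeze hr)).mul ((hW.pow m).freeze ht)).integrable hr
  have e1 : (fun ω => Z ω * W r ω ^ j * W t ω ^ (m - 1)) =ᵐ[P]
      fun ω => Z' ω * X ω ^ j * (X ω + a * ξ t ω) ^ (m - 1) := by
    filter_upwards [hZZ, hXW, hWξ t hrt] with ω h1 h2 h3
    rw [h1, h2, h3]
  have hi : Integrable (fun ω => Z ω * W r ω ^ j * W t ω ^ (m + 1) -
      Z ω * W r ω ^ (j + 1) * W t ω ^ m) P := (hb j (m + 1)).sub (hb (j + 1) m)
  have e2 : (fun ω => Z ω * W r ω ^ j * W t ω ^ (m + 1) - Z ω * W r ω ^ (j + 1) * W t ω ^ m) =ᵐ[P]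
      fun ω => a * (Z' ω * X ω ^ j * (ξ t ω * (X ω + a * ξ t ω) ^ m)) := by
    filter_upwards [hZZ, hXW, hWξ t hrt] with ω h1 h2 h3
    rw [h1, h2, h3]
    ring
  rw [← sub_eq_iff_eq_add', ← integral_sub (hb j (m + 1)) (hb (j + 1) m), integral_congr_ae e2,
    integral_congr_ae e1, integral_const_mul]
  -- Integrability of the term with `ξ` is obtained by dividing by `a`.
  rcases eq_or_ne a 0 with rfl | ha
  · simp
  have hi' : Integrable (fun ω => Z' ω * X ω ^ j * (ξ t ω * (X ω + a * ξ t ω) ^ m)) P := by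
    have := (hi.congr e2).const_mul a⁻¹
    simpa [← mul_assoc, ha] using this
  rw [integral_mul_increment_mul_pow hm hZj hXm (hξ t hrt) (hind t hrt) a m hi'
    ((hb j (m - 1)).congr e1)]
  have hv : (((t - r).toNNReal : ℝ≥0) : ℂ) = t - r := by
    have : (((t - r).toNNReal : ℝ≥0) : ℝ) = t - r := Real.coe_toNNReal _ (sub_nonneg.2 hrt)
    rw [← Complex.ofReal_sub]
    exact congrArg Complex.ofReal this
  rw [hv]
  ring

theorem stronglyMeasurable_eval {ι : Type*} {x : ι → Ω → ℂ}
    (hx : ∀ k, StronglyMeasurable[m'] (x k)) (Q : MvPolynomial ι ℂ) :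
    StronglyMeasurable[m'] fun ω => MvPolynomial.eval (fun k => x k ω) Q := by
  induction Q using MvPolynomial.induction_on with
  | C a => simpa using stronglyMeasurable_const
  | add p q hp hq =>
    simp only [map_add]
    exact hp.add hq
  | mul_X p k hp =>
    simp only [map_mul, MvPolynomial.eval_X]
    exact hp.mul (hx k)

end

/-! ### The drift and the generator at infinity. -/

theorem loewnerDrift_one : loewnerDrift 1 = 0 := by simp [loewnerDrift, zcoeff]

/-- The drift of the `k`-th coefficient depends on the earlier coefficients only. -/
theorem eval_loewnerDrift_congr {x y : ℕ+ → ℂ} (k : ℕ+) (h : ∀ j < k, x j = y j) :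
    MvPolynomial.eval x (loewnerDrift k) = MvPolynomial.eval y (loewnerDrift k) := by
  refine MvPolynomial.eval₂_congr _ _ _ fun {i c} hi hc => h i ?_
  have hw := homogSeries_gInv.zcoeff ((k : ℤ) - 2) hc
  have hle : (wt i : ℤ) ≤ Finsupp.weight wt c := by
    have hc' : c = Finsupp.single i 1 + (c - Finsupp.single i 1) :=
      (add_tsub_cancel_of_le (Finsupp.single_le_iff.2
        (Nat.one_le_iff_ne_zero.2 (Finsupp.mem_support_iff.1 hi)))).symm
    have := weight_wt_nonneg (c - Finsupp.single i 1)
    rw [hc', map_add]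
    simpa [Finsupp.weight_apply, wt] using this
  rw [hw] at hle
  have : ((i : ℕ) : ℤ) ≤ (k : ℕ) - 2 := by simpa [wt] using hle
  rw [← PNat.coe_lt_coe]
  omega

/-- The generator of the flow at infinity. -/
noncomputable def flowGenerator (κ : ℝ) (Q : Sec) : Sec :=
  MvPolynomial.C ((κ : ℂ) / 2) * MvPolynomial.pderiv 1 (MvPolynomial.pderiv 1 Q)
    + 2 * vectorField loewnerDrift Q

theorem flowGenerator_inversion {κ : ℝ} {σ : Sec} (h : liftedGenerator κ σ = 0) :
    flowGenerator κ (inversion σ) = 0 := by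
  have h1 := congrArg inversion h
  rw [liftedGenerator_apply, lhat1, lhat2, liftDer_apply, liftDer_apply, liftDer_apply,
    inversion_inversion, map_sub, map_smul, map_smul, inversion_inversion, inversion_inversion,
    map_zero, Derivation.neg_apply] at h1
  rw [flowGenerator, vectorField_apply, ← h1, MvPolynomial.smul_eq_C_mul,
    MvPolynomial.smul_eq_C_mul]
  simp only [map_ofNat]
  ring

theorem flowGenerator_add (κ : ℝ) (p q : Sec) :
    flowGenerator κ (p + q) = flowGenerator κ p + flowGenerator κ q := by
  simp only [flowGenerator, map_add]; ring

theorem pderiv_one_monomial_erase (s : ℕ+ →₀ ℕ) (a : ℂ) :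
    MvPolynomial.pderiv (1 : ℕ+) (MvPolynomial.monomial (s.erase 1) a) = 0 := by
  simp [MvPolynomial.pderiv_monomial]

theorem monomial_eq_X_one_pow_mul (s : ℕ+ →₀ ℕ) (a : ℂ) : (MvPolynomial.monomial s a : Sec) =
    MvPolynomial.X 1 ^ s 1 * MvPolynomial.monomial (s.erase 1) a := by
  rw [MvPolynomial.X_pow_eq_monomial, MvPolynomial.monomial_mul, one_mul,
    Finsupp.single_add_erase]

/-- The generator decouples: `P₁ = 0`, so the drift does not see `b₁`, and the second-order part
does not see `v`. The result matches the integrand of `dynkin_pow_mul`. -/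
theorem flowGenerator_X_one_pow_mul (κ : ℝ) (m : ℕ) {v : Sec}
    (hv : MvPolynomial.pderiv (1 : ℕ+) v = 0) :
    flowGenerator κ (MvPolynomial.X 1 ^ m * v) = MvPolynomial.X 1 ^ m *
      (2 * vectorField loewnerDrift v) +
      MvPolynomial.C ((κ : ℂ) / 2 * (m * (m - 1))) * MvPolynomial.X 1 ^ (m - 2) * v := by
  have hX : ∀ n : ℕ, MvPolynomial.pderiv (1 : ℕ+) (MvPolynomial.X 1 ^ n : Sec) =
      (n : Sec) * MvPolynomial.X 1 ^ (n - 1) := fun n => by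
    simp [Derivation.leibniz_pow]
  have h1 : vectorField loewnerDrift (MvPolynomial.X 1 ^ m * v) =
      MvPolynomial.X 1 ^ m * vectorField loewnerDrift v := by
    have : vectorField loewnerDrift (MvPolynomial.X 1 ^ m) = 0 := by
      rw [vectorField_apply, Derivation.leibniz_pow, ← vectorField_apply, vectorField_X,
        loewnerDrift_one]
      simp
    rw [vectorField_mul, this, zero_mul, add_zero]
  have h2 : MvPolynomial.pderiv (1 : ℕ+) (MvPolynomial.pderiv 1 (MvPolynomial.X 1 ^ m * v)) =
      MvPolynomial.C (m * (m - 1) : ℂ) * MvPolynomial.X 1 ^ (m - 2) * v := by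
    simp only [Derivation.leibniz, hv, hX, smul_eq_mul, mul_zero, zero_add, Derivation.map_natCast,
      add_zero]
    rcases m with _ | m
    · simp
    · rw [Nat.add_sub_cancel]
      push_cast
      simp only [map_mul, map_sub, map_add, map_natCast, map_one]
      ring
  rw [flowGenerator, h1, h2, map_mul]
  simp only [map_mul]
  ring

section

variable {Ω : Type*} {mΩ : MeasurableSpace Ω} {P : Measure Ω}

/-- Gaussian scaling gives a bound uniform in `t ≤ T`. -/
theorem lintegral_enorm_pow_le_of_hasLaw {X : Ω → ℝ} {t : ℝ≥0} {T : ℝ}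
    (hX : HasLaw X (gaussianReal 0 t) P) (hT : t ≤ T) (p : ℕ) :
    ∫⁻ ω, ‖(X ω : ℂ)‖ₑ ^ p ∂P ≤ ‖((√T : ℝ) : ℂ)‖ₑ ^ p *
      ∫⁻ y, ‖(y : ℂ)‖ₑ ^ p ∂(gaussianReal 0 1) := by
  have hmeas : Measurable fun y : ℝ => ‖(y : ℂ)‖ₑ ^ p := by fun_prop
  have h1 : gaussianReal 0 t = (gaussianReal 0 1).map (√(t : ℝ) * ·) := by
    rw [gaussianReal_map_const_mul, mul_zero, mul_one]
    congr 1
    ext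
    simp
  rw [← lintegral_map' (f := fun y : ℝ => ‖(y : ℂ)‖ₑ ^ p) hmeas.aemeasurable hX.aemeasurable,
    hX.map_eq, h1, lintegral_map hmeas (by fun_prop), ← lintegral_const_mul _ hmeas]
  refine lintegral_mono fun y => ?_
  rw [← mul_pow]
  gcongr
  rw [Complex.ofReal_mul, enorm_mul]
  gcongr
  rw [← ofReal_norm, ← ofReal_norm]
  refine ENNReal.ofReal_le_ofReal ?_
  rw [Complex.norm_real, Complex.norm_real, Real.norm_of_nonneg (Real.sqrt_nonneg _),
    Real.norm_of_nonneg (Real.sqrt_nonneg _)]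
  exact Real.sqrt_le_sqrt hT

/-- A version of the flow with continuous paths, all of whose moments are bounded. -/
structure FlowVersion (κ : ℝ) (P : Measure Ω) (B : ℝ≥0 → Ω → ℝ) (b : ℕ+ → ℝ≥0 → Ω → ℂ)
    (Y : ℕ+ → ℝ → Ω → ℂ) : Prop where
  momentBounded : ∀ k, MomentBounded P (Y k)
  ae_eq : ∀ᵐ ω ∂P, ∀ k t, Y k t ω = b k t.toNNReal ω
  driving : ∀ᵐ ω ∂P, ∀ t, Y 1 t ω = -(√κ : ℂ) * B t.toNNReal ω
  drift : ∀ᵐ ω ∂P, ∀ k, k ≠ 1 → ∀ t, 0 ≤ t →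
    Y k t ω = ∫ r in (0 : ℝ)..t, 2 * MvPolynomial.eval (fun j => Y j r ω) (loewnerDrift k)

theorem IsSLEFlow.exists_flowVersion [IsProbabilityMeasure P] {κ : ℝ} {𝓕 : Filtration ℝ≥0 mΩ}
    {B : ℝ≥0 → Ω → ℝ} {b : ℕ+ → ℝ≥0 → Ω → ℂ} (hb : IsSLEFlow κ P 𝓕 B b) :
    ∃ Y, FlowVersion κ P B b Y := by
  have hgood := hb.brownian.cont.and hb.loewner
  -- Set the flow to zero on a measurable null set containing all bad paths; then every path is
  -- continuous.
  obtain ⟨N, hN, hNm, hN0⟩ := exists_measurable_superset_of_null (ae_iff.1 hgood)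
  have hG : ∀ ω ∈ Nᶜ, _ := fun ω hω => not_not.1 fun h => hω (hN h)
  have hae : ∀ᵐ ω ∂P, ω ∈ Nᶜ := by
    rw [ae_iff]; simpa using hN0
  classical
  let Y : ℕ+ → ℝ → Ω → ℂ := fun k t => Nᶜ.indicator (b k t.toNNReal)
  have hYG : ∀ ω ∈ Nᶜ, ∀ k t, Y k t ω = b k t.toNNReal ω := fun ω hω k t =>
    Set.indicator_of_mem hω _
  have hYN : ∀ ω, ω ∉ Nᶜ → ∀ k t, Y k t ω = 0 := fun ω hω k t => Set.indicator_of_notMem hω _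
  have hmeas : ∀ k t, Measurable (Y k t) := fun k t =>
    (((hb.adapted k _).mono (𝓕.le _)).measurable).indicator hNm.compl
  have hdrive : ∀ ω ∈ Nᶜ, ∀ t, Y 1 t ω = -(√κ : ℂ) * B t.toNNReal ω := by
    intro ω hω t
    rw [hYG ω hω, (hG ω hω).2, loewnerDrift_one]
    simp
  -- The maximum reflects that `t.toNNReal` is `0` at negative times.
  have hdrift : ∀ ω ∈ Nᶜ, ∀ k, k ≠ 1 → ∀ t, Y k t ω = ∫ r in (0 : ℝ)..max t 0,
      2 * MvPolynomial.eval (fun j => Y j r ω) (loewnerDrift k) := by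
    intro ω hω k hk t
    rw [hYG ω hω, (hG ω hω).2, if_neg hk, sub_zero, Real.coe_toNNReal']
    simp only [hYG ω hω]
  have hmom : ∀ k, MomentBounded P (Y k) := by
    intro k
    induction k using PNat.strongInductionOn with
    | _ k ih =>
      by_cases hk : k = 1
      · subst hk
        refine ⟨fun ω => ?_, hmeas 1, fun p T => ?_⟩
        · by_cases hω : ω ∈ Nᶜ
          · simp only [hdrive ω hω]
            have := (hG ω hω).1
            fun_prop
          · simp only [hYN ω hω]
            exact continuous_const
        · have hfin : (‖-(√κ : ℂ)‖ₑ ^ p * (‖((√T : ℝ) : ℂ)‖ₑ ^ p *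
              ∫⁻ y, ‖(y : ℂ)‖ₑ ^ p ∂(gaussianReal 0 1))) ≠ ⊤ :=
            ENNReal.mul_ne_top (by finiteness) (ENNReal.mul_ne_top (by finiteness)
              (lintegral_enorm_pow_gaussianReal_lt_top 1 p).ne)
          refine ⟨_, fun t h0 hT => le_trans ?_ (ENNReal.coe_toNNReal hfin).ge⟩
          have e : ∫⁻ ω, ‖Y 1 t ω‖ₑ ^ p ∂P =
              ∫⁻ ω, ‖-(√κ : ℂ)‖ₑ ^ p * ‖(B t.toNNReal ω : ℂ)‖ₑ ^ p ∂P := by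
            refine lintegral_congr_ae ?_
            filter_upwards [hae] with ω hω
            rw [hdrive ω hω, enorm_mul, mul_pow]
          rw [e, lintegral_const_mul' _ _ (by finiteness)]
          gcongr
          exact lintegral_enorm_pow_le_of_hasLaw (hb.brownian.hasLaw_eval _)
            (by rwa [Real.coe_toNNReal _ h0]) p
      -- Only coefficients before `k` enter the drift, and the induction hypothesis covers just
      -- these; the others are replaced by zero.
      · let Z : ℕ+ → ℝ → Ω → ℂ := fun j => if j < k then Y j else 0
        have hZ : ∀ j, MomentBounded P (Z j) := by
          intro j
          by_cases hj : j < k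
          · simp only [Z, if_pos hj]; exact ih j hj
          · simp only [Z, if_neg hj]; exact MomentBounded.const 0
        have hX := ((MomentBounded.eval hZ (loewnerDrift k)).const_mul 2).integral
        have hYX : ∀ ω ∈ Nᶜ, ∀ t, Y k t ω = ∫ r in (0 : ℝ)..max t 0,
            2 * MvPolynomial.eval (fun j => Z j r ω) (loewnerDrift k) := by
          intro ω hω t
          rw [hdrift ω hω k hk t]
          refine intervalIntegral.integral_congr fun r _ => ?_
          refine congrArg (2 * ·) (eval_loewnerDrift_congr k fun j hj => ?_)
          simp only [Z, if_pos hj]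
        refine hX.congr_ae (fun ω => ?_) (hmeas k) fun t ht => ?_
        · by_cases hω : ω ∈ Nᶜ
          · simp only [hYX ω hω]
            exact (hX.cont ω).comp (continuous_id.max continuous_const)
          · simp only [hYN ω hω]
            exact continuous_const
        · filter_upwards [hae] with ω hω
          rw [hYX ω hω, max_eq_left ht]
  refine ⟨Y, hmom, ?_, ?_, ?_⟩
  · filter_upwards [hae] with ω hω using hYG ω hω
  · filter_upwards [hae] with ω hω using hdrive ω hω
  · filter_upwards [hae] with ω hω k hk t ht
    rw [hdrift ω hω k hk, max_eq_left ht]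

theorem IsSLEFlow.momentRecursion [IsProbabilityMeasure P] {κ : ℝ} (hκ : 0 ≤ κ)
    {𝓕 : Filtration ℝ≥0 mΩ} {B : ℝ≥0 → Ω → ℝ} {b : ℕ+ → ℝ≥0 → Ω → ℂ} {Y : ℕ+ → ℝ → Ω → ℂ}
    (hb : IsSLEFlow κ P 𝓕 B b) (hY : FlowVersion κ P B b Y) {r : ℝ} (hr : 0 ≤ r) {Z Z' : Ω → ℂ}
    (hZ : MomentBounded P fun _ => Z) (hZZ : Z =ᵐ[P] Z')
    (hZm : StronglyMeasurable[𝓕 r.toNNReal] Z') : MomentRecursion P (Y 1) κ r Z := by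
  have hsq : (-(√κ : ℂ)) ^ 2 = κ := by
    rw [neg_sq, ← Complex.ofReal_pow, Real.sq_sqrt hκ]
  rw [← hsq]
  have hXm : StronglyMeasurable[𝓕 r.toNNReal] fun ω => -(√κ : ℂ) * B r.toNNReal ω :=
    (Complex.continuous_ofReal.comp_stronglyMeasurable (hb.adapted_driving _)).const_mul _
  refine momentRecursion_of_increments (𝓕.le r.toNNReal) (X := fun ω => -(√κ : ℂ) * B r.toNNReal ω)
    (ξ := fun t ω => B t.toNNReal ω - B r.toNNReal ω) hr (hY.momentBounded 1) hZ hZm.measurable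
    hXm.measurable hZZ ?_ (fun t ht => ?_) (fun t ht => ?_) fun t ht => ?_
  · filter_upwards [hY.driving] with ω hω using hω r
  · have h := hb.brownian.hasLaw_sub t.toNNReal r.toNNReal
    have hv : nndist (t.toNNReal : ℝ) (r.toNNReal : ℝ) = (t - r).toNNReal := by
      ext
      rw [coe_nndist, Real.coe_toNNReal _ hr, Real.coe_toNNReal _ (hr.trans ht),
        Real.coe_toNNReal _ (sub_nonneg.2 ht), Real.dist_eq, abs_of_nonneg (sub_nonneg.2 ht)]
    change HasLaw (B t.toNNReal - B r.toNNReal) _ P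
    rw [← hv]
    exact h
  · exact hb.indep_increments _ _ (Real.toNNReal_mono ht)
  · filter_upwards [hY.driving] with ω hω
    rw [hω t]
    push_cast
    ring

end

/-- Without a factor `b₁` there is no Brownian part, and the ordinary chain rule applies. The
derivative is taken within `Ici 0` because the flow equation holds at nonnegative times only. -/
theorem hasDerivWithinAt_eval_monomial {y : ℕ+ → ℝ → ℂ} (hc : ∀ k, Continuous (y k))
    (hy : ∀ k, k ≠ 1 → ∀ t, 0 ≤ t →
      y k t = ∫ r in (0 : ℝ)..t, 2 * MvPolynomial.eval (fun j => y j r) (loewnerDrift k))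
    {s : ℕ+ →₀ ℕ} (hs : s 1 = 0) (a : ℂ) {t : ℝ} (ht : 0 ≤ t) :
    HasDerivWithinAt (fun t => MvPolynomial.eval (fun k => y k t) (MvPolynomial.monomial s a))
      (MvPolynomial.eval (fun k => y k t) (2 * vectorField loewnerDrift (MvPolynomial.monomial s a)))
      (Set.Ici 0) t := by
  have key := monomial_one_induction (p := fun s Q => s 1 = 0 →
    HasDerivWithinAt (fun t => MvPolynomial.eval (fun k => y k t) Q)
      (MvPolynomial.eval (fun k => y k t) (2 * vectorField loewnerDrift Q)) (Set.Ici 0) t) ?_ ?_ ?_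
      s hs
  · have hm : (MvPolynomial.monomial s a : Sec) = a • MvPolynomial.monomial s 1 := by
      rw [MvPolynomial.smul_monomial, smul_eq_mul, mul_one]
    rw [hm, map_smul]
    simp only [MvPolynomial.smul_eval, map_mul, map_ofNat] at key ⊢
    exact (key.const_mul a).congr_deriv (by ring)
  · intro _
    simpa using hasDerivWithinAt_const _ _ _
  · intro k hk
    have hk1 : k ≠ 1 := by rintro rfl; simp at hk
    have hcont : Continuous fun r => 2 * MvPolynomial.eval (fun j => y j r) (loewnerDrift k) :=
      continuous_const.mul ((MvPolynomial.continuous_eval _).comp (continuous_pi hc))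
    have hd := (intervalIntegral.integral_hasDerivAt_right (hcont.intervalIntegrable 0 t)
      hcont.stronglyMeasurable.stronglyMeasurableAtFilter hcont.continuousAt).hasDerivWithinAt
      (s := Set.Ici 0)
    simp only [MvPolynomial.eval_X, vectorField_X, map_mul, map_ofNat]
    exact hd.congr (fun r hr => hy k hk1 r hr) (hy k hk1 t ht)
  · intro s1 s2 h1 h2 h12
    rw [Finsupp.add_apply] at h12
    have := (h1 (by omega)).mul (h2 (by omega))
    rw [vectorField_mul]
    simp only [map_mul, map_add, map_ofNat] at this ⊢
    exact this.congr_deriv (by ring)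

/-! ### Dynkin's formula for the flow -/

section

variable {Ω : Type*} {mΩ : MeasurableSpace Ω} {P : Measure Ω}

/-- Dynkin's formula for polynomials of the flow, localised at an event of the past. -/
theorem IsSLEFlow.dynkin [IsProbabilityMeasure P] {κ : ℝ} (hκ : 0 ≤ κ) {𝓕 : Filtration ℝ≥0 mΩ}
    {B : ℝ≥0 → Ω → ℝ} {b : ℕ+ → ℝ≥0 → Ω → ℂ} {Y : ℕ+ → ℝ → Ω → ℂ} (hb : IsSLEFlow κ P 𝓕 B b)
    (hY : FlowVersion κ P B b Y) {s t : ℝ} (hs : 0 ≤ s) (hst : s ≤ t) {A : Set Ω}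
    (hA : MeasurableSet[𝓕 s.toNNReal] A) (Q : Sec) :
    ∫ ω, A.indicator 1 ω * (MvPolynomial.eval (fun k => Y k t ω) Q -
      MvPolynomial.eval (fun k => Y k s ω) Q) ∂P =
    ∫ ω, A.indicator 1 ω * (∫ r in s..t,
      MvPolynomial.eval (fun k => Y k r ω) (flowGenerator κ Q)) ∂P := by
  have ht : 0 ≤ t := hs.trans hst
  have hAm : MeasurableSet A := 𝓕.le _ _ hA
  have hAb : MomentBounded P fun _ => A.indicator (1 : Ω → ℂ) := by
    refine MomentBounded.of_moments (measurable_one.indicator hAm) fun p => ?_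
    refine lt_of_le_of_lt (lintegral_mono (g := fun _ => 1) fun ω => ?_) (by simp)
    refine pow_le_one' ?_ p
    by_cases hω : ω ∈ A <;> simp [hω]
  have hev : ∀ Q : Sec, MomentBounded P fun r ω => MvPolynomial.eval (fun k => Y k r ω) Q :=
    fun Q => MomentBounded.eval hY.momentBounded Q
  have hrec : ∀ (Q : Sec) (r : ℝ), s ≤ r → MomentRecursion P (Y 1) κ r
      (fun ω => A.indicator 1 ω * MvPolynomial.eval (fun k => Y k r ω) Q) := by
    intro Q r hsr
    have hr : 0 ≤ r := hs.trans hsr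
    refine hb.momentRecursion hκ hY hr ((hAb.mul (hev Q)).freeze hr)
      -- The original flow is adapted, whereas `Y` need not be: the filtration is not assumed to
      -- contain the null sets.
      (Z' := fun ω => A.indicator 1 ω * MvPolynomial.eval (fun k => b k r.toNNReal ω) Q) ?_ ?_
    · filter_upwards [hY.ae_eq] with ω hω
      simp only [hω]
    · exact (stronglyMeasurable_one.indicator (𝓕.mono (Real.toNNReal_mono hsr) _ hA)).mul
        (stronglyMeasurable_eval (fun k => hb.adapted k _) Q)
  induction Q using MvPolynomial.induction_on' with
  | monomial u a =>
    set v : Sec := MvPolynomial.monomial (u.erase 1) a with hv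
    have hd : ∀ᵐ ω ∂P, ∀ r, s ≤ r → A.indicator 1 ω * MvPolynomial.eval (fun k => Y k r ω) v -
        A.indicator 1 ω * MvPolynomial.eval (fun k => Y k s ω) v = ∫ q in s..r,
          A.indicator 1 ω * MvPolynomial.eval (fun k => Y k q ω) (2 * vectorField loewnerDrift v) := by
      filter_upwards [hY.drift] with ω hω r hsr
      have hder := fun q (hq : 0 ≤ q) => hasDerivWithinAt_eval_monomial (y := fun k q => Y k q ω)
        (fun k => (hY.momentBounded k).cont ω) hω (s := u.erase 1) (by simp) a hq
      rw [intervalIntegral.integral_const_mul, ← mul_sub]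
      congr 1
      refine (intervalIntegral.integral_eq_sub_of_hasDeriv_right_of_le hsr
        ((hev v).cont ω).continuousOn (fun q hq => (hder q (hs.trans hq.1.le)).mono
          fun x hx => (hs.trans hq.1.le).trans (le_of_lt hx))
        (((hev _).cont ω).intervalIntegrable _ _)).symm
    have key := dynkin_pow_mul hs hst (hY.momentBounded 1) (hAb.mul (hev v))
      (hAb.mul (hev (2 * vectorField loewnerDrift v))) hd (hrec v s le_rfl)
      (fun r hr => hrec _ r hr) (u 1)
    -- Split off the power of `b₁`, the only coordinate driven by noise.
    rw [monomial_eq_X_one_pow_mul,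
      flowGenerator_X_one_pow_mul κ (u 1) (pderiv_one_monomial_erase u a), ← hv]
    convert key using 3 with ω ω
    · simp only [map_mul, map_pow, MvPolynomial.eval_X]
      ring
    · rw [← intervalIntegral.integral_const_mul]
      congr 1
      ext1 r
      simp only [map_add, map_mul, map_pow, MvPolynomial.eval_X, MvPolynomial.eval_C]
      ring
  | add p q hp hq =>
    have hi1 : ∀ Q : Sec, Integrable (fun ω => A.indicator 1 ω *
        (MvPolynomial.eval (fun k => Y k t ω) Q - MvPolynomial.eval (fun k => Y k s ω) Q)) P :=
      fun Q => (hAb.mul (((hev Q).freeze ht).sub ((hev Q).freeze hs))).integrable hs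
    have hi2 : ∀ Q : Sec, Integrable (fun ω => A.indicator 1 ω *
        ∫ r in s..t, MvPolynomial.eval (fun k => Y k r ω) Q) P := fun Q => by
      have := (hAb.mul (hev Q)).integrable_intervalIntegral hs ht
      simpa only [intervalIntegral.integral_const_mul] using this
    have e1 : ∀ ω, A.indicator 1 ω * (MvPolynomial.eval (fun k => Y k t ω) (p + q) -
        MvPolynomial.eval (fun k => Y k s ω) (p + q)) =
        A.indicator 1 ω * (MvPolynomial.eval (fun k => Y k t ω) p -
          MvPolynomial.eval (fun k => Y k s ω) p) +
        A.indicator 1 ω * (MvPolynomial.eval (fun k => Y k t ω) q -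
          MvPolynomial.eval (fun k => Y k s ω) q) := fun ω => by
      rw [map_add, map_add]; ring
    have e2 : ∀ ω, A.indicator 1 ω * ∫ r in s..t, MvPolynomial.eval (fun k => Y k r ω)
          (flowGenerator κ (p + q)) =
        A.indicator 1 ω * (∫ r in s..t, MvPolynomial.eval (fun k => Y k r ω) (flowGenerator κ p)) +
        A.indicator 1 ω * ∫ r in s..t, MvPolynomial.eval (fun k => Y k r ω) (flowGenerator κ q) :=
      fun ω => by
        rw [flowGenerator_add, ← mul_add, ← intervalIntegral.integral_add
          (((hev _).cont ω).intervalIntegrable _ _) (((hev _).cont ω).intervalIntegrable _ _)]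
        simp only [map_add]
    simp only [e1, e2]
    rw [integral_add (hi1 p) (hi1 q), integral_add (hi2 _) (hi2 _), hp, hq]

/-- Harmonicity kills the right side of Dynkin's formula, so increments integrate to zero over every
event of the past, which characterises the conditional expectation. -/
theorem IsSLEFlow.martingale_alongFlow [IsProbabilityMeasure P] {κ : ℝ} (hκ : 0 ≤ κ)
    {𝓕 : Filtration ℝ≥0 mΩ} {B : ℝ≥0 → Ω → ℝ} {b : ℕ+ → ℝ≥0 → Ω → ℂ} (hb : IsSLEFlow κ P 𝓕 B b)
    {σ : Sec} (hσ : liftedGenerator κ σ = 0) : Martingale (alongFlow b σ) 𝓕 P := by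
  obtain ⟨Y, hY⟩ := hb.exists_flowVersion
  have hmeas : StronglyAdapted 𝓕 (alongFlow b σ) := fun t =>
    stronglyMeasurable_eval (fun k => hb.adapted k t) _
  have hae : ∀ t : ℝ≥0, (fun ω => MvPolynomial.eval (fun k => Y k t ω) (inversion σ)) =ᵐ[P]
      alongFlow b σ t := fun t => by
    filter_upwards [hY.ae_eq] with ω hω
    simp only [hω, alongFlow, Real.toNNReal_coe]
  have hint' : ∀ t : ℝ≥0,
      Integrable (fun ω => MvPolynomial.eval (fun k => Y k t ω) (inversion σ)) P := fun t =>
    (MomentBounded.eval hY.momentBounded (inversion σ)).integrable t.2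
  have hint : ∀ t, Integrable (alongFlow b σ t) P := fun t => (hint' t).congr (hae t)
  refine ⟨hmeas, fun s t hst => (ae_eq_condExp_of_forall_setIntegral_eq (𝓕.le s) (hint t)
    (fun A _ _ => (hint s).integrableOn) (fun A hA _ => ?_)
    (hmeas s).aestronglyMeasurable).symm⟩
  have hAm : MeasurableSet A := 𝓕.le _ _ hA
  have h := hb.dynkin hκ hY s.coe_nonneg (NNReal.coe_le_coe.2 hst) (A := A)
    (by rwa [Real.toNNReal_coe]) (inversion σ)
  rw [flowGenerator_inversion hσ] at h
  simp only [map_zero, intervalIntegral.integral_zero, mul_zero, integral_zero] at h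
  have h2 : ∀ ω, A.indicator (1 : Ω → ℂ) ω * (MvPolynomial.eval (fun k => Y k t ω) (inversion σ) -
      MvPolynomial.eval (fun k => Y k s ω) (inversion σ)) =
      A.indicator (fun ω => MvPolynomial.eval (fun k => Y k t ω) (inversion σ) -
      MvPolynomial.eval (fun k => Y k s ω) (inversion σ)) ω := fun ω => by
    by_cases hω : ω ∈ A <;> simp [hω]
  change ∫ ω, A.indicator 1 ω * (MvPolynomial.eval (fun k => Y k t ω) (inversion σ) -
      MvPolynomial.eval (fun k => Y k s ω) (inversion σ)) ∂P = 0 at h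
  rw [integral_congr_ae (Filter.Eventually.of_forall h2), integral_indicator hAm,
    integral_sub (hint' t).integrableOn (hint' s).integrableOn, sub_eq_zero] at h
  rw [← setIntegral_congr_ae hAm ((hae t).mono fun ω h _ => h), h,
    setIntegral_congr_ae hAm ((hae s).mono fun ω h _ => h)]

end

end SLEVirasoro

theorem mainTheorem1 :
    -- the coordinate form of the operators
    (∀ c h : ℂ,
      (∀ n : ℕ+, L c h n = vectorField fun k =>
        if n ≤ k then (((k : ℕ) - n + 1 : ℕ) : Sec) * coord ((k : ℕ) - n) else 0) ∧
      L c h 0 = vectorField (fun k => ((k : ℕ) : Sec) * coord k)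
        + LinearMap.mulLeft ℂ (MvPolynomial.C h) ∧
      L c h (-1) = vectorField (fun k =>
          (((k : ℕ) + 2 : ℕ) : Sec) * coord (k + 1) - 2 * coord 1 * coord k)
        + LinearMap.mulLeft ℂ (MvPolynomial.C (2 * h) * coord 1) ∧
      L c h (-2) = vectorField (fun k =>
          (((k : ℕ) + 3 : ℕ) : Sec) * coord (k + 2) - (4 * coord 2 - coord 1 ^ 2) * coord k
            - PowerSeries.coeff ((k : ℕ) + 2) gInv)
        + LinearMap.mulLeft ℂ (MvPolynomial.C h * (4 * coord 2 - coord 1 ^ 2)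
            + MvPolynomial.C (c / 2) * (coord 2 - coord 1 ^ 2))) ∧
    -- the Verma module contains a null vector of level two exactly on the critical curve
    (∀ c h : ℂ, (∃ v, IsNullLevelTwo c h v) ↔
      ∃ κ : ℂ, κ ≠ 0 ∧ c = critC κ ∧ h = critH κ) ∧
    ∀ κ : ℝ, 0 < κ →
      -- for given `κ`, the vector that corresponds to the generator is null
      (∀ c h : ℂ,
        IsNullLevelTwo c h
          ((((κ : ℂ) / 2) • (dualL c h (-1) ^ 2) - (2 : ℂ) • dualL c h (-2)) vacuum) ↔
          c = critC κ ∧ h = critH κ) ∧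
      -- the same vector in the module of polynomial sections
      (∀ c h : ℂ,
        (((κ : ℂ) / 2) • (L c h (-1) ^ 2) - (2 : ℂ) • L c h (-2)) (1 : Sec) = 0 ↔
          (c = critC κ ∧ h = critH κ) ∨ (c = 0 ∧ h = 0)) ∧
      -- harmonicity of the sections generated from `1`
      (∀ c h : ℂ, (∀ σ ∈ polyModule c h, liftedGenerator κ σ = 0) ↔
          (c = critC κ ∧ h = critH κ) ∨ (c = 0 ∧ h = 0)) ∧
      -- harmonic sections give local martingales along the flow
      (∀ (Ω : Type*) (mΩ : MeasurableSpace Ω) (P : Measure Ω) (𝓕 : Filtration ℝ≥0 mΩ)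
        (B : ℝ≥0 → Ω → ℝ) (b : ℕ+ → ℝ≥0 → Ω → ℂ), IsProbabilityMeasure P →
        IsSLEFlow κ P 𝓕 B b →
        ∀ σ : Sec, liftedGenerator κ σ = 0 →
          Locally (fun X => Martingale X 𝓕 P) 𝓕 (alongFlow b σ) P) :=
  ⟨fun c h => ⟨L_pos c h, L_zero c h, L_neg_one c h, L_neg_two c h⟩, exists_isNullLevelTwo_iff,
    fun _κ hκ => ⟨isNullLevelTwo_generator_iff hκ, generator_one_eq_zero_iff hκ, harmonic_iff hκ,
      fun _Ω _mΩ _P _𝓕 _B _b _ hb _σ hσ => Locally.of_prop (hb.martingale_alongFlow hκ.le hσ)⟩⟩
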